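/- **Conventions.** Let $\omega=e^{2\pi i/3}$, $l_1=k,\ l_2=\omega^2k,\ l_3=\omega k$, $z_j=-l_j^2$, $\theta_{ij}(x,t,k)=(l_i-l_j)x+(z_i-z_j)t$, $D_n=\{(n-1)\pi/6<\arg k<n\pi/6\}$ for $n$ modulo $12$; on each $D_n$ the numbers $\mathrm{Re}\,l_i$, and likewise the numbers $\mathrm{Re}\,z_i$, are strictly ordered. Put $$V_1=\begin{pmatrix}0&q&r\\ r&0&q\\ q&r&0\end{pmatrix},\qquad V_2=k\begin{pmatrix}0&\omega q&\omega^2r\\ \omega r&0&q\\ \omega^2q&r&0\end{pmatrix}+\tfrac{i}{\sqrt3}\begin{pmatrix}0&q_x&-r_x\\ -r_x&0&q_x\\ q_x&-r_x&0\end{pmatrix}-\begin{pmatrix}0&r^2&q^2\\ q^2&0&r^2\\ r^2&q^2&0\end{pmatrix}.$$ **Setting.** Let $q,r$ be $C^2$ on the closed quarter plane $x,t\ge0$ and satisfy, for $0<x<\infty$, $0<t<\infty$, $$iq_t+\tfrac1{\sqrt3}q_{xx}+2irr_x=0,\qquad ir_t-\tfrac1{\sqrt3}r_{xx}+2iqq_x=0,$$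 with $q(x,0)=q_0(x)$, $r(x,0)=r_0(x)$ for $x>0$ and $q(0,t)=r(0,t)=0$ for $t>0$. Assume that $q,r$ and $q_x,r_x,q_{xx},r_{xx},q_t,r_t$ are $O((1+x)^{-2})$ locally uniformly in $t\ge 0$, that $\int_0^\infty(|q|+|r|)(x,t)\,dx=O(1+t)$, and that $q_x(0,\cdot),r_x(0,\cdot)\in L^1(0,\infty)$. **Spectral functions.** For $\lambda\in\mathbb C^3$ and a matrix function $U$ on $[0,\infty)$, the $j$-th Volterra column is the bounded continuous solution of $w_i(x)=\delta_{ij}-\int_x^\infty e^{(\lambda_i-\lambda_j)(x-y)}(Uw)_i(y)\,dy$. The $j$-th columns of $s$, $s^A$, $S$, $S^A$ (for those $k$ for which they are defined) are the values at $0$ of the $j$-th Volterra columns for, respectively, $(\lambda,U)=(l,V_1(\cdot,0))$, $(-l,-V_1^T(\cdot,0))$, $(z,V_2(0,\cdot,k))$, $(-z,-V_2^T(0,\cdot,k))$. Thus $s$ and $s^A$ depend on $q_0,r_0$ only, and $s^A$, $S^A$ are the cofactor matrices of $s$, $S$; write $m_{ij}(s)=(-1)^{i+j}(s^A)_{ij}$,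 $m_{ij}(S)=(-1)^{i+j}(S^A)_{ij}$ for the minors. Let $\hat s(k)=s(-k)$ and $$W_1=S_{11}m_{11}(s)-S_{21}m_{21}(s)+S_{31}m_{31}(s),\quad W_4=-S_{12}m_{12}(s)+S_{22}m_{22}(s)-S_{32}m_{32}(s),$$ $$W_2=m_{11}(s)m_{22}(S)-m_{21}(s)m_{12}(S),\quad W_3=m_{22}(s)m_{11}(S)-m_{12}(s)m_{21}(S),$$ $$\mathcal W_1=\hat s_{11}m_{11}(s)-\hat s_{21}m_{21}(s)+\hat s_{31}m_{31}(s),\quad \mathcal W_4=-\hat s_{12}m_{12}(s)+\hat s_{22}m_{22}(s)-\hat s_{32}m_{32}(s).$$ **Eigenfunctions and jump matrices.** For $k\in\bar D_n$ the $j$-th column of $M_n(x,t,k)$ is the continuous solution $w$, bounded in $x\ge 0$ for each $t$ and bounded in $t\ge 0$ for $x=0$, of the $j$-th column of $\mu_x-[\mathrm{diag}(l),\mu]=V_1\mu$, $\mu_t-[\mathrm{diag}(z),\mu]=V_2\mu$ such that $$w_i(x,t)=\delta_{ij}+\int_{\gamma^n_{ij}}e^{(l_i-l_j)(x-x')+(z_i-z_j)(t-t')}\big((V_1dx'+V_2dt')w\big)_i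 ,$$ where $\gamma^n_{ij}$ is the path $(0,\infty)\to(0,t)\to(x,t)$ if $\mathrm{Re}\,l_i<\mathrm{Re}\,l_j$, $\mathrm{Re}\,z_i\ge\mathrm{Re}\,z_j$ on $D_n$; the path $(0,0)\to(0,t)\to(x,t)$ if $\mathrm{Re}\,l_i<\mathrm{Re}\,l_j$, $\mathrm{Re}\,z_i<\mathrm{Re}\,z_j$ on $D_n$; and the path $(\infty,t)\to(x,t)$ if $\mathrm{Re}\,l_i\ge\mathrm{Re}\,l_j$ on $D_n$. Let $S_n(k)=M_n(0,0,k)$, and let $J_{m,n}(x,t,k)$ be the matrix with entries $e^{\theta_{ij}}(S_m^{-1}S_n)_{ij}$, $k\in\bar D_m\cap\bar D_n$. Let $M=M_n$ for $k\in D_n$, and let $[M]_j$ be its $j$-th column. **Theorem.** Assume that $s_{33}$ has no zeros on $\partial D_1,\dots,\partial D_4$ and that $W_j$ has no zeros on $\partial D_j$, $j=1,\dots,4$. Then, for all $x,t\ge0$, the following holds. (i) On $\bar D_1\cap\bar D_2$, on $\bar D_2\cap\bar D_3$ (at points where $\mathcal W_1\mathcal W_4\neq0$), on $\bar D_3\cap\bar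 D_4$ and on $\bar D_4\cap\bar D_5$, respectively, $$J_{1,2}=\begin{pmatrix}1&0&0\\0&1&0\\-\frac{e^{\theta_{31}}\hat s_{31}}{s_{33}\mathcal W_1}&0&1\end{pmatrix},\qquad J_{2,3}=\begin{pmatrix}1&\frac{e^{\theta_{12}}(\hat s^Ts^A)_{21}}{\mathcal W_4}&0\\-\frac{e^{\theta_{21}}(\hat s^Ts^A)_{12}}{\mathcal W_1}&1-\frac{(\hat s^Ts^A)_{21}(\hat s^Ts^A)_{12}}{\mathcal W_1\mathcal W_4}&0\\0&0&1\end{pmatrix},$$ $$J_{3,4}=\begin{pmatrix}1&0&0\\0&1&0\\0&\frac{e^{\theta_{32}}\hat s_{32}}{s_{33}\mathcal W_4}&1\end{pmatrix},\qquad J_{4,5}=\begin{pmatrix}1&0&-\frac{e^{\theta_{13}}s_{13}}{s_{11}}\\0&1&0\\\frac{e^{\theta_{31}}s_{31}}{s_{33}}&0&\frac{m_{22}(s)}{s_{11}s_{33}}\end{pmatrix};$$ moreover $\mathcal W_1\ne0$ on $\bar D_1\cap\bar D_2$, $\mathcal W_4\neq0$ on $\bar D_3\cap\bar D_4$ and $s_{11}\ne0$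 on $\bar D_4\cap\bar D_5$. The remaining jump matrices follow from these and the symmetry, valid for all $n$ modulo $12$ and $k\in\bar D_n\cap\bar D_{n+1}$, $$J_{n,n+1}(x,t,k)=\mathcal AJ_{n+4,n+5}(x,t,\omega k)\mathcal A^{-1},\quad J_{n+1,n}(x,t,k)=\mathcal AJ_{n+5,n+4}(x,t,\omega k)\mathcal A^{-1},\quad \mathcal A=\begin{pmatrix}0&1&0\\0&0&1\\1&0&0\end{pmatrix}.$$ (ii) The columns of $M$ below have at most a simple pole at $\kappa$, with the following residues (a dot denotes $d/dk$; all coefficients and the columns on the right are evaluated at $\kappa$). * If $\kappa\in D_1\cup D_2$ is a simple zero of $s_{33}$ and $s_{13}\ne0$ there: $\operatorname{Res}_\kappa[M]_2=\frac{m_{21}(s)}{s_{13}\dot s_{33}}e^{\theta_{32}}[M]_3$. * If $\kappa\in D_1$ is a simple zero of $W_1$ and $s_{33},m_{31}(s)\neq0$ there: $\dot{\mathcal W}_1\ne0$ and $\operatorname{Res}_\kappa[M]_1=\frac1{\dot{\mathcal W}_1}\Big\{\frac{\hat s_{11}s_{23}-\hat s_{21}s_{13}}{m_{31}(s)}e^{\theta_{21}}[M]_2+\frac{\hat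 s_{31}}{s_{33}}e^{\theta_{31}}[M]_3\Big\}$. * If $\kappa\in D_2$ is a simple zero of $W_2$ and $s_{33},m_{21}(s),\dot{\mathcal W}_1\ne0$ there: $\operatorname{Res}_\kappa[M]_1=\frac{\hat s_{11}s_{33}-\hat s_{31}s_{13}}{\dot{\mathcal W}_1m_{21}(s)}e^{\theta_{21}}[M]_2$. * If $\kappa\in D_3\cup D_4$ is a simple zero of $s_{33}$ and $s_{13}\ne0$ there: $\operatorname{Res}_\kappa[M]_1=\frac{m_{22}(s)}{s_{13}\dot s_{33}}e^{\theta_{31}}[M]_3$. * If $\kappa\in D_3$ is a simple zero of $W_3$ and $s_{33},m_{22}(s),\dot{\mathcal W}_4\ne0$ there: $\operatorname{Res}_\kappa[M]_2=\frac{\hat s_{12}s_{33}-\hat s_{32}s_{13}}{\dot{\mathcal W}_4m_{22}(s)}e^{\theta_{12}}[M]_1$. * If $\kappa\in D_4$ is a simple zero of $W_4$ and $s_{33},m_{32}(s)\ne0$ there: $\dot{\mathcal W}_4\neq0$ and $\operatorname{Res}_\kappa[M]_2=\frac1{\dot{\mathcal W}_4}\Big\{\frac{\hat s_{12}s_{23}-\hat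 s_{22}s_{13}}{m_{32}(s)}e^{\theta_{12}}[M]_1+\frac{\hat s_{32}}{s_{33}}e^{\theta_{32}}[M]_3\Big\}$. -/

import Mathlib

open Complex Set Filter Topology MeasureTheory

noncomputable section

/-- Complex `3 × 3` matrices. Rows and columns are indexed by `Fin 3`, so that the entry written
`(1,1)` in mathematical notation is the entry `0 0` here. -/
abbrev Mat3 := Matrix (Fin 3) (Fin 3) ℂ

/-! ### The system on the quarter plane -/

/-- Partial derivative in `x` on the closed quarter plane (one-sided at `x = 0`). -/
def pdx (f : ℝ → ℝ → ℂ) (x t : ℝ) : ℂ := derivWithin (fun y => f y t) (Ici 0) x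

/-- Partial derivative in `t` on the closed quarter plane (one-sided at `t = 0`). -/
def pdt (f : ℝ → ℝ → ℂ) (x t : ℝ) : ℂ := derivWithin (fun τ => f x τ) (Ici 0) t

/-- `f(x,t) = O((1+x)⁻²)` as `x → ∞`, locally uniformly in `t ≥ 0`. -/
def DecaysInX (f : ℝ → ℝ → ℂ) : Prop :=
  ∀ T : ℝ, ∃ C : ℝ, ∀ x t : ℝ, 0 ≤ x → 0 ≤ t → t ≤ T → ‖f x t‖ * (1 + x) ^ 2 ≤ C

/-- `(q,r)` is a sufficiently smooth and decaying solution, on the quarter plane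
`0 < x < ∞`, `0 < t < ∞`, of
`i q_t + q_xx / √3 + 2 i r r_x = 0`, `i r_t - r_xx / √3 + 2 i q q_x = 0`. -/
structure IsHalfLineSolution (q r : ℝ → ℝ → ℂ) : Prop where
  smooth_q : ContDiffOn ℝ 2 (fun p : ℝ × ℝ => q p.1 p.2) (Ici 0 ×ˢ Ici 0)
  smooth_r : ContDiffOn ℝ 2 (fun p : ℝ × ℝ => r p.1 p.2) (Ici 0 ×ˢ Ici 0)
  eq_q : ∀ x t : ℝ, 0 < x → 0 < t →
    I * pdt q x t + (1 / (Real.sqrt 3 : ℂ)) * pdx (pdx q) x t + 2 * I * r x t * pdx r x t = 0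
  eq_r : ∀ x t : ℝ, 0 < x → 0 < t →
    I * pdt r x t - (1 / (Real.sqrt 3 : ℂ)) * pdx (pdx r) x t + 2 * I * q x t * pdx q x t = 0
  decay_q : DecaysInX q ∧ DecaysInX (pdx q) ∧ DecaysInX (pdx (pdx q)) ∧ DecaysInX (pdt q)
  decay_r : DecaysInX r ∧ DecaysInX (pdx r) ∧ DecaysInX (pdx (pdx r)) ∧ DecaysInX (pdt r)
  /-- the `L¹` norm in `x` grows at most linearly in time -/
  growth : ∃ C : ℝ, ∀ t : ℝ, 0 ≤ t → ∫ x in Ioi (0 : ℝ), (‖q x t‖ + ‖r x t‖) ≤ C * (1 + t)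
  /-- the Neumann boundary values are integrable in time -/
  neumann_q : IntegrableOn (fun t => pdx q 0 t) (Ioi 0)
  neumann_r : IntegrableOn (fun t => pdx r 0 t) (Ioi 0)

/-! ### The Lax pair -/

/-- `ω = e^{2πi/3}`. -/
def om : ℂ := exp (2 * Real.pi * I / 3)

/-- The diagonal entries `l₁ = k`, `l₂ = ω² k`, `l₃ = ω k` of `kJ`. -/
def lx (k : ℂ) : Fin 3 → ℂ := ![k, om ^ 2 * k, om * k]

/-- The diagonal entries `z_j = -l_j²` of `-k²J²`. -/
def zt (k : ℂ) : Fin 3 → ℂ := fun i => -(lx k i) ^ 2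

/-- `θ_{ij}(x,t,k) = (l_i - l_j) x + (z_i - z_j) t`. -/
def theta (i j : Fin 3) (x t : ℝ) (k : ℂ) : ℂ :=
  (lx k i - lx k j) * x + (zt k i - zt k j) * t

/-- `V₁` as a function of the values of `q, r`. -/
def laxV1 (q r : ℂ) : Mat3 := !![0, q, r; r, 0, q; q, r, 0]

/-- `V₂` as a function of the values of `q, r, q_x, r_x` and of `k`. -/
def laxV2 (q r qx rx k : ℂ) : Mat3 :=
  k • !![0, om * q, om ^ 2 * r; om * r, 0, q; om ^ 2 * q, r, 0]
    + (I / (Real.sqrt 3 : ℂ)) • !![0, qx, -rx; -rx, 0, qx; qx, -rx, 0]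
    - !![0, r ^ 2, q ^ 2; q ^ 2, 0, r ^ 2; r ^ 2, q ^ 2, 0]

/-- `V₁(x,t)` along `(q,r)`. -/
def fieldV1 (q r : ℝ → ℝ → ℂ) (x t : ℝ) : Mat3 := laxV1 (q x t) (r x t)

/-- `V₂(x,t,k)` along `(q,r)`. -/
def fieldV2 (q r : ℝ → ℝ → ℂ) (x t : ℝ) (k : ℂ) : Mat3 :=
  laxV2 (q x t) (r x t) (pdx q x t) (pdx r x t) k

/-! ### The spectral functions `s`, `S` and their cofactor matrices -/

open Classical in
/-- An object satisfying `P`, or `0` if there is none. It is applied to integral equations whose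
solution is unique (on the domain of interest) wherever the spectral functions are used. -/
def solutionOf {α : Type} [Zero α] (P : α → Prop) : α :=
  if h : ∃ a, P a then h.choose else 0

/-- `w` is a bounded continuous solution on `[0,∞)` of the Volterra equation, with normalization
at `∞`,
`w(x) = e_j - ∫_x^∞ diag_i (e^{(λ_i - λ_j)(x - y)}) U(y) w(y) dy`. -/
def IsVolterraColumn (lam : Fin 3 → ℂ) (U : ℝ → Mat3) (j : Fin 3) (w : ℝ → Fin 3 → ℂ) : Prop :=
  ContinuousOn w (Ici 0) ∧
  (∃ C : ℝ, ∀ x : ℝ, 0 ≤ x → ‖w x‖ ≤ C) ∧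
  ∀ x : ℝ, 0 ≤ x → ∀ i : Fin 3,
    w x i = (if i = j then 1 else 0)
      - ∫ y in Ioi x, exp ((lam i - lam j) * ((x - y : ℝ) : ℂ)) * ((U y).mulVec (w y) i)

/-- The matrix whose `j`-th column is the value at `0` of the `j`-th Volterra column. -/
def volterraMatrix (lam : Fin 3 → ℂ) (U : ℝ → Mat3) : Mat3 :=
  Matrix.of fun i j => solutionOf (IsVolterraColumn lam U j) 0 i

/-- `s(k) = μ₃(0,0,k)`, computed columnwise from the initial data. -/
def sMat (q₀ r₀ : ℝ → ℂ) (k : ℂ) : Mat3 :=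
  volterraMatrix (lx k) (fun x => laxV1 (q₀ x) (r₀ x))

/-- `s^A(k) = μ₃^A(0,0,k)`, where `μ₃^A` solves the Volterra equation of the cofactor Lax pair. -/
def sCof (q₀ r₀ : ℝ → ℂ) (k : ℂ) : Mat3 :=
  volterraMatrix (fun i => -lx k i) (fun x => -(laxV1 (q₀ x) (r₀ x)).transpose)

/-- `S(k) = μ₁(0,0,k)` for `T = ∞`, computed columnwise from all boundary values at `x = 0`. -/
def bMat (q r : ℝ → ℝ → ℂ) (k : ℂ) : Mat3 :=
  volterraMatrix (zt k) (fun t => fieldV2 q r 0 t k)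

/-- `S^A(k) = μ₁^A(0,0,k)` for `T = ∞`. -/
def bCof (q r : ℝ → ℝ → ℂ) (k : ℂ) : Mat3 :=
  volterraMatrix (fun i => -zt k i) (fun t => -(fieldV2 q r 0 t k).transpose)

/-- The minors `m_{ij}(X)`, read off from the cofactor matrix `X^A = ((-1)^{i+j} m_{ij}(X))`. -/
def minorOf (A : Mat3) (i j : Fin 3) : ℂ := (-1) ^ ((i : ℕ) + (j : ℕ)) * A i j

/-- `X₁₁ m₁₁(s) - X₂₁ m₂₁(s) + X₃₁ m₃₁(s)`, where `sA = s^A`. -/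
def combOne (X sA : Mat3) : ℂ :=
  X 0 0 * minorOf sA 0 0 - X 1 0 * minorOf sA 1 0 + X 2 0 * minorOf sA 2 0

/-- `-X₁₂ m₁₂(s) + X₂₂ m₂₂(s) - X₃₂ m₃₂(s)`, where `sA = s^A`. -/
def combFour (X sA : Mat3) : ℂ :=
  -(X 0 1 * minorOf sA 0 1) + X 1 1 * minorOf sA 1 1 - X 2 1 * minorOf sA 2 1

/-- `W₁ = S₁₁ m₁₁(s) - S₂₁ m₂₁(s) + S₃₁ m₃₁(s)`. -/
def W1 (q r : ℝ → ℝ → ℂ) (q₀ r₀ : ℝ → ℂ) (k : ℂ) : ℂ := combOne (bMat q r k) (sCof q₀ r₀ k)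

/-- `W₂ = m₁₁(s) m₂₂(S) - m₂₁(s) m₁₂(S)`. -/
def W2 (q r : ℝ → ℝ → ℂ) (q₀ r₀ : ℝ → ℂ) (k : ℂ) : ℂ :=
  minorOf (sCof q₀ r₀ k) 0 0 * minorOf (bCof q r k) 1 1
    - minorOf (sCof q₀ r₀ k) 1 0 * minorOf (bCof q r k) 0 1

/-- `W₃ = m₂₂(s) m₁₁(S) - m₁₂(s) m₂₁(S)`. -/
def W3 (q r : ℝ → ℝ → ℂ) (q₀ r₀ : ℝ → ℂ) (k : ℂ) : ℂ :=
  minorOf (sCof q₀ r₀ k) 1 1 * minorOf (bCof q r k) 0 0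
    - minorOf (sCof q₀ r₀ k) 0 1 * minorOf (bCof q r k) 1 0

/-- `W₄ = -S₁₂ m₁₂(s) + S₂₂ m₂₂(s) - S₃₂ m₃₂(s)`. -/
def W4 (q r : ℝ → ℝ → ℂ) (q₀ r₀ : ℝ → ℂ) (k : ℂ) : ℂ := combFour (bMat q r k) (sCof q₀ r₀ k)

/-- `𝒲₁ = ŝ₁₁ m₁₁(s) - ŝ₂₁ m₂₁(s) + ŝ₃₁ m₃₁(s)`, with `ŝ(k) = s(-k)`. -/
def calW1 (q₀ r₀ : ℝ → ℂ) (k : ℂ) : ℂ := combOne (sMat q₀ r₀ (-k)) (sCof q₀ r₀ k)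

/-- `𝒲₄ = -ŝ₁₂ m₁₂(s) + ŝ₂₂ m₂₂(s) - ŝ₃₂ m₃₂(s)`, with `ŝ(k) = s(-k)`. -/
def calW4 (q₀ r₀ : ℝ → ℂ) (k : ℂ) : ℂ := combFour (sMat q₀ r₀ (-k)) (sCof q₀ r₀ k)

/-! ### The sectors `D₁, …, D₁₂` and the eigenfunctions `M₁, …, M₁₂`

The index `n` of a sector lives in `Fin 12`, with arithmetic modulo `12`; thus `D₁₂` is `sector 0`,
which is also `sector 12`. -/

/-- Position of `Re l₁, Re l₂, Re l₃` in increasing order on `D_n`, rows `n = 12, 1, 2, …, 11`. -/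
def lRank : Fin 12 → Fin 3 → ℕ :=
  ![![2, 0, 1], ![2, 1, 0], ![2, 1, 0], ![1, 2, 0], ![1, 2, 0], ![0, 2, 1],
    ![0, 2, 1], ![0, 1, 2], ![0, 1, 2], ![1, 0, 2], ![1, 0, 2], ![2, 0, 1]]

/-- Position of `Re z₁, Re z₂, Re z₃` in increasing order on `D_n`, rows `n = 12, 1, 2, …, 11`. -/
def zRank : Fin 12 → Fin 3 → ℕ :=
  ![![0, 1, 2], ![0, 2, 1], ![1, 2, 0], ![2, 1, 0], ![2, 0, 1], ![1, 0, 2],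
    ![0, 1, 2], ![0, 2, 1], ![1, 2, 0], ![2, 1, 0], ![2, 0, 1], ![1, 0, 2]]

/-- The sector `D_n`: the real parts of the `l_i` and of the `z_i` are strictly ordered as
prescribed by the tables (this is the open sector `(n-1)π/6 < arg k < nπ/6`). -/
def sector (n : Fin 12) : Set ℂ :=
  {k | ∀ i j : Fin 3,
    (lRank n i < lRank n j → (lx k i).re < (lx k j).re) ∧
    (zRank n i < zRank n j → (zt k i).re < (zt k j).re)}

/-- The `i`-th entry of the integral of `e^{(l_i-l_j)(x-x') + (z_i-z_j)(t-t')} (V₁ dx' + V₂ dt') w`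
along `γ₁ : (0,∞) → (0,t) → (x,t)`. -/
def gammaOne (q r : ℝ → ℝ → ℂ) (k : ℂ) (w : ℝ → ℝ → Fin 3 → ℂ) (i j : Fin 3) (x t : ℝ) : ℂ :=
  -(∫ τ in Ioi t, exp (theta i j x (t - τ) k) * ((fieldV2 q r 0 τ k).mulVec (w 0 τ) i))
    + ∫ y in (0 : ℝ)..x, exp (theta i j (x - y) 0 k) * ((fieldV1 q r y t).mulVec (w y t) i)

/-- The same integral along `γ₂ : (0,0) → (0,t) → (x,t)`. -/
def gammaTwo (q r : ℝ → ℝ → ℂ) (k : ℂ) (w : ℝ → ℝ → Fin 3 → ℂ) (i j : Fin 3) (x t : ℝ) : ℂ :=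
  (∫ τ in (0 : ℝ)..t, exp (theta i j x (t - τ) k) * ((fieldV2 q r 0 τ k).mulVec (w 0 τ) i))
    + ∫ y in (0 : ℝ)..x, exp (theta i j (x - y) 0 k) * ((fieldV1 q r y t).mulVec (w y t) i)

/-- The same integral along `γ₃ : (∞,t) → (x,t)`. -/
def gammaThree (q r : ℝ → ℝ → ℂ) (k : ℂ) (w : ℝ → ℝ → Fin 3 → ℂ) (i j : Fin 3) (x t : ℝ) : ℂ :=
  -∫ y in Ioi x, exp (theta i j (x - y) 0 k) * ((fieldV1 q r y t).mulVec (w y t) i)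

/-- The integral along the contour `γ^n_{ij}`: it is `γ₁` if `Re l_i < Re l_j` and
`Re z_i ≥ Re z_j` on `D_n`, `γ₂` if `Re l_i < Re l_j` and `Re z_i < Re z_j` on `D_n`, and `γ₃` if
`Re l_i ≥ Re l_j` on `D_n`. -/
def gammaInt (q r : ℝ → ℝ → ℂ) (n : Fin 12) (k : ℂ) (w : ℝ → ℝ → Fin 3 → ℂ)
    (i j : Fin 3) (x t : ℝ) : ℂ :=
  if lRank n i < lRank n j then
    if zRank n j ≤ zRank n i then gammaOne q r k w i j x t else gammaTwo q r k w i j x t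
  else gammaThree q r k w i j x t

/-- `w` is the `j`-th column of the eigenfunction `M_n(·,·,k)`: a solution of the Lax pair
`μ_x - [𝓛,μ] = V₁ μ`, `μ_t - [𝓩,μ] = V₂ μ` on the closed quarter plane which satisfies
`w_i = δ_{ij} + ∫_{γ^n_{ij}} (…)`. The two boundedness clauses make the integrals converge. -/
structure IsEigenColumn (q r : ℝ → ℝ → ℂ) (n : Fin 12) (j : Fin 3) (k : ℂ)
    (w : ℝ → ℝ → Fin 3 → ℂ) : Prop where
  cont : ContinuousOn (fun p : ℝ × ℝ => w p.1 p.2) (Ici 0 ×ˢ Ici 0)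
  bounded_x : ∀ t : ℝ, 0 ≤ t → ∃ C : ℝ, ∀ x : ℝ, 0 ≤ x → ‖w x t‖ ≤ C
  bounded_t : ∃ C : ℝ, ∀ t : ℝ, 0 ≤ t → ‖w 0 t‖ ≤ C
  lax_x : ∀ x t : ℝ, 0 ≤ x → 0 ≤ t → ∀ i : Fin 3,
    HasDerivWithinAt (fun y => w y t i)
      ((lx k i - lx k j) * w x t i + (fieldV1 q r x t).mulVec (w x t) i) (Ici 0) x
  lax_t : ∀ x t : ℝ, 0 ≤ x → 0 ≤ t → ∀ i : Fin 3,
    HasDerivWithinAt (fun τ => w x τ i)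
      ((zt k i - zt k j) * w x t i + (fieldV2 q r x t k).mulVec (w x t) i) (Ici 0) t
  integral_eq : ∀ x t : ℝ, 0 ≤ x → 0 ≤ t → ∀ i : Fin 3,
    w x t i = (if i = j then 1 else 0) + gammaInt q r n k w i j x t

/-- The `j`-th column `[M_n(x,t,k)]_j`. -/
def eigenCol (q r : ℝ → ℝ → ℂ) (n : Fin 12) (j : Fin 3) (k : ℂ) : ℝ → ℝ → Fin 3 → ℂ :=
  solutionOf (IsEigenColumn q r n j k)

/-- `S_n(k) = M_n(0,0,k)`. -/
def specS (q r : ℝ → ℝ → ℂ) (n : Fin 12) (k : ℂ) : Mat3 :=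
  Matrix.of fun i j => eigenCol q r n j k 0 0 i

/-- The jump matrix `J_{m,n}(x,t,k) = e^{x 𝓛^ + t 𝓩^} (S_m(k)⁻¹ S_n(k))`. -/
def jump (q r : ℝ → ℝ → ℂ) (m n : Fin 12) (x t : ℝ) (k : ℂ) : Mat3 :=
  Matrix.of fun i j => exp (theta i j x t k) * ((specS q r m k)⁻¹ * specS q r n k) i j

/-- The cyclic permutation matrix `𝒜` of the `ℤ₃` symmetry. -/
def cycA : Mat3 := !![0, 1, 0; 0, 0, 1; 1, 0, 0]

/-- `f` is holomorphic in a punctured neighbourhood of `κ`, with at most a simple pole at `κ`, where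
its residue is `ρ`. -/
def HasSimpleResidue (f : ℂ → ℂ) (κ ρ : ℂ) : Prop :=
  (∀ᶠ k in 𝓝[≠] κ, DifferentiableAt ℂ f k) ∧ Tendsto (fun k => (k - κ) * f k) (𝓝[≠] κ) (𝓝 ρ)

/-- `κ` is a simple zero of `f`. -/
def IsSimpleZero (f : ℂ → ℂ) (κ : ℂ) : Prop := f κ = 0 ∧ deriv f κ ≠ 0

end

open scoped Matrix

/-! ### Matrix estimates and Gronwall's inequality -/

/-! With vanishing Dirichlet data the `k`-linear term of `V₂` disappears at `x = 0`, so `S` and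
`S^A` depend on `k` only through the numbers `z_j`, which are even in `k`. Hence `S(-k) = S(k)`, and
this is what finally allows `S` to be replaced by `ŝ`.

A solution of the Lax pair is determined by its value at the corner `(0,0)`, and by the zero
curvature identity every corner value occurs (`zero_curvature`, `exists_lax_flow`). The integral
equation for a column of `M_n` is equivalent to boundedness and limits along the two axes together
with the vanishing of some corner components (`EigenCond`, `isEigenColumn_iff`). These conditions
become linear equations for the corner value by pairing with solutions of the adjoint system and by
taking cross products, which again solve the adjoint system. Where `Re l_j` is smallest the corner
value is the column of `s`. Where it is intermediate, the cross product with that column of `s` is a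
column of `s^A`. Where it is largest, the pairing with the column of `s^A` equals `1`, and the
remaining equations come from the `t`-axis.

The link between the axes is the global relation. A column starting from the subdominant column of
`s` stays a Volterra column in `x` at each time, so on the `t`-axis it grows at most like `e^{Ct}`
with `C` independent of `k`. If it had a component along a faster mode in time, it would grow at a
rate proportional to `|k|²`; thus this component vanishes far out on each ray, then in the sector by
analytic continuation, then on the closure by continuity (`bAdj_dot_sCol`, `sCol_cross_bCol`).
Applied at `k` it provides boundedness in time of the subdominant column. Applied at `-k`, where the
order of the `Re l_i` is reversed and `S` is unchanged, it makes the column of `ŝ` parallel to the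
column of `S` in `D₁`, `D₄`, and orthogonal to the dominant column of `S^A` in `D₂`, `D₃`
(`UpperSector.exists_hat_eq`, `UpperSector.bAdj_dot_hat`).

The columns of `S_n` are then explicit, and a jump matrix is verified by multiplying out `S_n = S_m
K` with `det S_m = 1`. For the residues, a column has the corner value `g/f` with `f`, `g`
holomorphic; expanding in solutions that are entire in `k`, the residue is the solution with corner
value `g/f'`, and it is enough to compare corner values (`hasSimpleResidue_eigenCol`).
Multiplication by `ω` permutes the exponents cyclically and shifts the sectors by four, which gives
the symmetry once corner values are unique (`jump_rot`). -/

/-- Column vectors with three complex entries. -/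
abbrev V3 := Fin 3 → ℂ

/-- The entrywise `ℓ¹` norm of a `3 × 3` matrix. -/
noncomputable def mnorm (M : Mat3) : ℝ := ∑ i, ∑ j, ‖M i j‖

theorem mnorm_nonneg (M : Mat3) : 0 ≤ mnorm M :=
  Finset.sum_nonneg fun _ _ => Finset.sum_nonneg fun _ _ => norm_nonneg _

theorem mnorm_neg_transpose (M : Mat3) : mnorm (-M.transpose) = mnorm M := by
  simp only [mnorm, Matrix.neg_apply, Matrix.transpose_apply, norm_neg]
  exact Finset.sum_comm

theorem continuous_mnorm : Continuous mnorm := by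
  unfold mnorm
  fun_prop

theorem norm_mulVec_apply_le (M : Mat3) (v : V3) (i : Fin 3) :
    ‖(M *ᵥ v) i‖ ≤ mnorm M * ‖v‖ := by
  have h1 : ‖(M *ᵥ v) i‖ ≤ ∑ j, ‖M i j‖ * ‖v‖ := by
    refine (norm_sum_le Finset.univ fun j => M i j * v j).trans (Finset.sum_le_sum fun j _ => ?_)
    rw [norm_mul]
    exact mul_le_mul_of_nonneg_left (norm_le_pi_norm v j) (norm_nonneg _)
  rw [← Finset.sum_mul] at h1
  refine h1.trans (mul_le_mul_of_nonneg_right ?_ (norm_nonneg _))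
  exact Finset.single_le_sum (f := fun i => ∑ j, ‖M i j‖)
    (fun _ _ => Finset.sum_nonneg fun _ _ => norm_nonneg _) (Finset.mem_univ i)

theorem norm_mulVec_le (M : Mat3) (v : V3) : ‖M *ᵥ v‖ ≤ mnorm M * ‖v‖ :=
  (pi_norm_le_iff_of_nonneg (mul_nonneg (mnorm_nonneg M) (norm_nonneg v))).2
    (norm_mulVec_apply_le M v)

/-- With `G` the right-hand side of the hypothesis, `G · exp(-∫u)` has derivative `u (f - G)
exp(-∫u) ≤ 0`, so it stays below its initial value `C`. -/
theorem gronwall_of_continuous {f u : ℝ → ℝ} {C a b : ℝ} (hf : Continuous f) (hu : Continuous u)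
    (hu0 : ∀ x, 0 ≤ u x) (h : ∀ x ∈ Icc a b, f x ≤ C + ∫ y in a..x, u y * f y) :
    ∀ x ∈ Icc a b, f x ≤ C * Real.exp (∫ y in a..x, u y) := by
  intro x hx
  set G : ℝ → ℝ := fun x => C + ∫ y in a..x, u y * f y with hG
  set H : ℝ → ℝ := fun x => G x * Real.exp (-∫ y in a..x, u y) with hH
  have hGd : ∀ x, HasDerivAt G (u x * f x) x := fun x =>
    ((hu.mul hf).integral_hasStrictDerivAt a x).hasDerivAt.const_add C
  have hUd : ∀ x, HasDerivAt (fun x => ∫ y in a..x, u y) (u x) x := fun x =>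
    (hu.integral_hasStrictDerivAt a x).hasDerivAt
  have hHd : ∀ x, HasDerivAt H ((u x * f x) * Real.exp (-∫ y in a..x, u y)
      + G x * (Real.exp (-∫ y in a..x, u y) * -(u x))) x := fun x =>
    (hGd x).mul ((hUd x).neg.exp)
  have hanti : AntitoneOn H (Icc a b) := by
    refine antitoneOn_of_deriv_nonpos (convex_Icc a b)
      (fun x _ => (hHd x).continuousAt.continuousWithinAt)
      (fun x _ => (hHd x).differentiableAt.differentiableWithinAt) fun x hx' => ?_
    rw [interior_Icc] at hx'
    rw [(hHd x).deriv]
    have h1 := h x (Ioo_subset_Icc_self hx')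
    have h2 : 0 ≤ u x * (G x - f x) * Real.exp (-∫ y in a..x, u y) :=
      mul_nonneg (mul_nonneg (hu0 x) (sub_nonneg.2 h1)) (Real.exp_pos _).le
    nlinarith
  have h3 := hanti (left_mem_Icc.2 (hx.1.trans hx.2)) hx hx.1
  simp only [hH, hG, intervalIntegral.integral_same, add_zero, neg_zero, Real.exp_zero,
    mul_one] at h3
  have h4 : G x ≤ C * Real.exp (∫ y in a..x, u y) := by
    rw [Real.exp_neg, ← div_eq_mul_inv, div_le_iff₀ (Real.exp_pos _)] at h3
    exact h3
  exact (h x hx).trans h4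

theorem gronwall {f u : ℝ → ℝ} {C a b : ℝ} (hf : ContinuousOn f (Icc a b)) (hu : Continuous u)
    (hu0 : ∀ x, 0 ≤ u x) (h : ∀ x ∈ Icc a b, f x ≤ C + ∫ y in a..x, u y * f y) :
    ∀ x ∈ Icc a b, f x ≤ C * Real.exp (∫ y in a..x, u y) := by
  intro x hx
  have hab : a ≤ b := hx.1.trans hx.2
  -- Freezing `f` at its end values outside `[a,b]` makes it continuous on the whole line.
  have hext : ∀ y ∈ Icc a b, IccExtend hab ((Icc a b).domRestrict f) y = f y := fun y hy =>
    IccExtend_of_mem hab _ hy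
  have key := gronwall_of_continuous (f := IccExtend hab ((Icc a b).domRestrict f)) (C := C) (a := a)
    (b := b) (hf.domRestrict.Icc_extend') hu hu0 (fun y hy => by
      rw [hext y hy]
      refine (h y hy).trans_eq ?_
      congr 1
      refine intervalIntegral.integral_congr fun z hz => ?_
      rw [uIcc_of_le hy.1] at hz
      rw [hext z ⟨hz.1, hz.2.trans hy.2⟩]) x hx
  rwa [hext x hx] at key

/-- Reflection `s ↦ a + b - s` of the forward version. This is the form suited to solutions
normalized at infinity. -/
theorem gronwall_backward {f u : ℝ → ℝ} {C a b : ℝ} (hf : ContinuousOn f (Icc a b))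
    (hu : Continuous u) (hu0 : ∀ x, 0 ≤ u x)
    (h : ∀ x ∈ Icc a b, f x ≤ C + ∫ y in x..b, u y * f y) :
    ∀ x ∈ Icc a b, f x ≤ C * Real.exp (∫ y in x..b, u y) := by
  intro x hx
  have key := gronwall (f := fun s => f (a + b - s)) (u := fun s => u (a + b - s)) (C := C) (a := a)
    (b := b) (hf.comp (by fun_prop) fun s hs => ⟨by linarith [hs.2], by linarith [hs.1]⟩)
    (by fun_prop) (fun s => hu0 _) (fun s hs => by
      have := h (a + b - s) ⟨by linarith [hs.2], by linarith [hs.1]⟩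
      rw [intervalIntegral.integral_comp_sub_left (fun y => u y * f y)]
      simpa using this) (a + b - x) ⟨by linarith [hx.2], by linarith [hx.1]⟩
  rw [intervalIntegral.integral_comp_sub_left (fun y => u y)] at key
  simpa using key

/-! ### Linear systems with a parameter -/

theorem pi_norm_zero_or {ι : Type*} [Fintype ι] [Nonempty ι] (v : ι → ℂ) : ∃ i, ‖v‖ = ‖v i‖ := by
  obtain ⟨i, -, hi⟩ := Finset.exists_mem_eq_sup' (Finset.univ_nonempty (α := ι)) fun i => ‖v i‖
  refine ⟨i, le_antisymm ((pi_norm_le_iff_of_nonneg (norm_nonneg _)).2 fun j => ?_)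
    (norm_le_pi_norm v i)⟩
  rw [← hi]
  exact Finset.le_sup' (fun i => ‖v i‖) (Finset.mem_univ j)

/-- Terms of the Dyson series of `Y' = A Y + F`, `Y(0) = e`. -/
noncomputable def dysonTerm {P : Type*} (A : P → ℝ → Mat3) (F : P → ℝ → V3) (e : P → V3) :
    ℕ → P → ℝ → V3
  | 0 => fun p x => e p + ∫ s in (0 : ℝ)..x, F p s
  | n + 1 => fun p x => ∫ s in (0 : ℝ)..x, A p s *ᵥ dysonTerm A F e n p s

section Dyson

variable {P : Type*} {A : P → ℝ → Mat3} {F : P → ℝ → V3} {e : P → V3}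

/-- Each integration turns `(M|s|)ⁿ/n!` into the next term of the exponential series. For `x < 0`
the integral is first reflected to positive arguments. -/
theorem norm_dysonTerm_le {p : P} {X M C : ℝ} (hM : ∀ s, |s| ≤ X → mnorm (A p s) ≤ M)
    (hC : ∀ s, |s| ≤ X → ‖dysonTerm A F e 0 p s‖ ≤ C) (n : ℕ) :
    ∀ x, |x| ≤ X → ‖dysonTerm A F e n p x‖ ≤ C * (M ^ n * |x| ^ n / n.factorial) := by
  induction n with
  | zero => intro x hx; simpa using hC x hx
  | succ n ih =>
    intro x hx
    have hX : 0 ≤ X := (abs_nonneg x).trans hx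
    have hM0 : 0 ≤ M := (mnorm_nonneg _).trans (hM 0 (by simpa using hX))
    have hb : ∀ s, |s| ≤ X → ‖A p s *ᵥ dysonTerm A F e n p s‖
        ≤ M * (C * (M ^ n * |s| ^ n / n.factorial)) := fun s hs =>
      (norm_mulVec_le _ _).trans (mul_le_mul (hM s hs) (ih s hs) (norm_nonneg _) hM0)
    have hval : ∀ x : ℝ, 0 ≤ x → ∫ s in (0:ℝ)..x, M * (C * (M ^ n * s ^ n / n.factorial))
        = C * (M ^ (n + 1) * x ^ (n + 1) / (n + 1).factorial) := by
      intro x hx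
      have : ∀ s : ℝ, M * (C * (M ^ n * s ^ n / n.factorial))
        = (M * C * M ^ n / n.factorial) * s ^ n := fun s => by ring
      simp_rw [this]
      rw [intervalIntegral.integral_const_mul, integral_pow, Nat.factorial_succ]
      push_cast
      have : (n.factorial : ℝ) ≠ 0 := by positivity
      have : (n + 1 : ℝ) ≠ 0 := by positivity
      field_simp
      ring
    have hint : ∀ x, IntervalIntegrable
        (fun s : ℝ => M * (C * (M ^ n * s ^ n / n.factorial))) volume 0 x :=
      fun x => Continuous.intervalIntegrable (by fun_prop) _ _
    rcases le_total 0 x with h0 | h0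
    · rw [abs_of_nonneg h0] at hx ⊢
      refine (intervalIntegral.norm_integral_le_of_norm_le h0
        (Eventually.of_forall fun s hs => ?_) (hint x)).trans_eq (hval x h0)
      have := hb s (by rw [abs_of_nonneg hs.1.le]; exact hs.2.trans hx)
      rwa [abs_of_nonneg hs.1.le] at this
    · rw [abs_of_nonpos h0] at hx ⊢
      have hrw : dysonTerm A F e (n + 1) p x
          = -∫ s in (0:ℝ)..(-x), A p (-s) *ᵥ dysonTerm A F e n p (-s) := by
        rw [intervalIntegral.integral_comp_neg (fun s => A p s *ᵥ dysonTerm A F e n p s), neg_neg,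
          neg_zero, ← intervalIntegral.integral_symm]
        rfl
      rw [hrw, norm_neg]
      refine (intervalIntegral.norm_integral_le_of_norm_le (by linarith)
        (Eventually.of_forall fun s hs => ?_) (hint (-x))).trans_eq (hval (-x) (by linarith))
      have := hb (-s) (by rw [abs_neg, abs_of_nonneg hs.1.le]; exact hs.2.trans hx)
      rwa [abs_neg, abs_of_nonneg hs.1.le] at this

variable [TopologicalSpace P]

theorem continuous_integral_param {f : P → ℝ → V3} (hf : Continuous (Function.uncurry f)) :
    Continuous (Function.uncurry fun p x => ∫ s in (0 : ℝ)..x, f p s) := by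
  have h : Continuous fun z : P × ℝ => ∫ s in (0 : ℝ)..z.2, f z.1 s :=
    intervalIntegral.continuous_parametric_intervalIntegral_of_continuous
      (f := fun (z : P × ℝ) s => f z.1 s)
      (hf.comp ((continuous_fst.comp continuous_fst).prodMk continuous_snd)) continuous_snd
  exact h

theorem continuous_dysonTerm (hA : Continuous (Function.uncurry A))
    (hF : Continuous (Function.uncurry F)) (he : Continuous e) (n : ℕ) :
    Continuous (Function.uncurry (dysonTerm A F e n)) := by
  induction n with
  | zero => exact (he.comp continuous_fst).add (continuous_integral_param hF)
  | succ n ih =>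
    refine continuous_integral_param (f := fun p s => A p s *ᵥ dysonTerm A F e n p s) ?_
    exact Continuous.matrix_mulVec hA ih

theorem summable_dyson_bound (C M X : ℝ) :
    Summable fun n : ℕ => C * (M ^ n * X ^ n / n.factorial) := by
  have := (Real.summable_pow_div_factorial (M * X)).mul_left C
  simpa [mul_pow] using this

theorem exists_local_bound [LocallyCompactSpace P] {f : P → ℝ → ℝ}
    (hf : Continuous (Function.uncurry f)) (p : P) (X : ℝ) :
    ∃ K ∈ 𝓝 p, ∃ C, ∀ p' ∈ K, ∀ s, |s| ≤ X → f p' s ≤ C := by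
  obtain ⟨K, hK, hKp⟩ := exists_compact_mem_nhds p
  obtain ⟨C, hC⟩ := ((hK.prod (isCompact_Icc (a := -X) (b := X))).image hf).bddAbove
  exact ⟨K, hKp, C, fun p' hp' s hs => hC ⟨(p', s), ⟨hp', abs_le.1 hs⟩, rfl⟩⟩

/-- The Dyson series converges uniformly for `p` in a compact neighbourhood and `x` in a bounded
interval, which gives joint continuity. Summing term by term yields the integral equation, and
differentiating it yields the system. -/
theorem exists_linear_solution [LocallyCompactSpace P] (hA : Continuous (Function.uncurry A))
    (hF : Continuous (Function.uncurry F)) (he : Continuous e) :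
    ∃ Y : P → ℝ → V3, Continuous (Function.uncurry Y) ∧ (∀ p, Y p 0 = e p) ∧
      ∀ p x, HasDerivAt (Y p) (A p x *ᵥ Y p x + F p x) x := by
  set Z := dysonTerm A F e with hZ
  have hZc := continuous_dysonTerm hA hF he
  have hloc : ∀ (p : P) (X : ℝ), ∃ K ∈ 𝓝 p, ∃ M C, ∀ p' ∈ K, ∀ n s, |s| ≤ X →
      ‖Z n p' s‖ ≤ C * (M ^ n * X ^ n / n.factorial) := by
    intro p X
    obtain ⟨K₁, hK₁, M, hM⟩ := exists_local_bound (f := fun p s => mnorm (A p s))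
      (continuous_mnorm.comp hA) p X
    obtain ⟨K₂, hK₂, C, hC⟩ := exists_local_bound (f := fun p s => ‖Z 0 p s‖)
      (continuous_norm.comp (hZc 0)) p X
    refine ⟨K₁ ∩ K₂, inter_mem hK₁ hK₂, M, C, fun p' hp' n s hs => ?_⟩
    refine (norm_dysonTerm_le (fun s hs => hM p' hp'.1 s hs) (fun s hs => hC p' hp'.2 s hs) n s
      hs).trans ?_
    have hX : 0 ≤ X := (abs_nonneg s).trans hs
    have hM0 : 0 ≤ M := (mnorm_nonneg _).trans (hM p' hp'.1 s hs)
    have hC0 : 0 ≤ C := (norm_nonneg _).trans (hC p' hp'.2 s hs)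
    gcongr
  set Y : P → ℝ → V3 := fun p x => ∑' n, Z n p x with hY
  have hsum : ∀ p x, Summable fun n => Z n p x := by
    intro p x
    obtain ⟨K, hK, M, C, h⟩ := hloc p |x|
    exact Summable.of_norm_bounded (summable_dyson_bound C M |x|)
      fun n => h p (mem_of_mem_nhds hK) n x le_rfl
  have hYc : Continuous (Function.uncurry Y) := by
    rw [continuous_iff_continuousAt]
    rintro ⟨p, x⟩
    obtain ⟨K, hK, M, C, h⟩ := hloc p (|x| + 1)
    have hmem : K ×ˢ Icc (x - 1) (x + 1) ∈ 𝓝 (p, x) :=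
      prod_mem_nhds hK (Icc_mem_nhds (by linarith) (by linarith))
    have : ContinuousOn (fun z : P × ℝ => ∑' n, Z n z.1 z.2) (K ×ˢ Icc (x - 1) (x + 1)) :=
      continuousOn_tsum (fun n => (hZc n).continuousOn)
        (summable_dyson_bound C M (|x| + 1)) fun n z hz => h z.1 hz.1 n z.2 (by
          have h1 := hz.2.1
          have h2 := hz.2.2
          rw [abs_le]
          constructor <;> cases abs_cases x <;> linarith)
    exact this.continuousAt hmem
  have hAY : ∀ p, Continuous fun s => A p s *ᵥ Y p s := fun p =>
    Continuous.matrix_mulVec (hA.comp (by fun_prop : Continuous fun s : ℝ => (p, s)))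
      (hYc.comp (by fun_prop : Continuous fun s : ℝ => (p, s)))
  have hFp : ∀ p, Continuous fun s => F p s := fun p =>
    hF.comp (by fun_prop : Continuous fun s : ℝ => (p, s))
  have hint : ∀ p x, Y p x = (e p + ∫ s in (0 : ℝ)..x, F p s)
      + ∫ s in (0 : ℝ)..x, A p s *ᵥ Y p s := by
    intro p x
    obtain ⟨K, hK, M, C, h⟩ := hloc p |x|
    obtain ⟨K₁, hK₁, M₁, hM₁⟩ := exists_local_bound (f := fun p s => mnorm (A p s))
      (continuous_mnorm.comp hA) p |x|
    have habs : ∀ s ∈ Set.uIoc 0 x, |s| ≤ |x| := fun s hs => by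
      rcases le_total 0 x with h0 | h0
      · rw [uIoc_of_le h0] at hs
        rw [abs_of_nonneg hs.1.le, abs_of_nonneg h0]; exact hs.2
      · rw [uIoc_of_ge h0] at hs
        rw [abs_of_nonpos hs.2, abs_of_nonpos h0]; linarith [hs.1]
    have hs1 : HasSum (fun n => ∫ s in (0 : ℝ)..x, A p s *ᵥ Z n p s)
        (∫ s in (0 : ℝ)..x, A p s *ᵥ Y p s) := by
      refine intervalIntegral.hasSum_integral_of_dominated_convergence
        (fun n _ => M₁ * (C * (M ^ n * |x| ^ n / n.factorial))) (fun n => ?_) (fun n => ?_)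
        ?_ ?_ ?_
      · exact (Continuous.matrix_mulVec (hA.comp (by fun_prop : Continuous fun s : ℝ => (p, s)))
          ((hZc n).comp (by fun_prop : Continuous fun s : ℝ => (p, s)))).aestronglyMeasurable
      · refine Eventually.of_forall fun s hs => (norm_mulVec_le _ _).trans ?_
        have h1 := hM₁ p (mem_of_mem_nhds hK₁) s (habs s hs)
        exact mul_le_mul h1 (h p (mem_of_mem_nhds hK) n s (habs s hs)) (norm_nonneg _)
          ((mnorm_nonneg _).trans h1)
      · exact Eventually.of_forall fun s hs => (summable_dyson_bound C M |x|).mul_left M₁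
      · exact intervalIntegrable_const
      · refine Eventually.of_forall fun s hs => ?_
        exact ((hsum p s).hasSum).map (Matrix.mulVecLin (A p s))
          (Continuous.matrix_mulVec continuous_const continuous_id)
    have hs2 : HasSum (fun n => Z (n + 1) p x) (∫ s in (0 : ℝ)..x, A p s *ᵥ Y p s) := hs1
    -- Integrating the series produces the terms of index `n + 1`; the term of index `0` has to be
    -- added back.
    have h3 : HasSum (fun n => Z n p x) ((∫ s in (0 : ℝ)..x, A p s *ᵥ Y p s)
        + ∑ n ∈ Finset.range 1, Z n p x) :=
      (hasSum_nat_add_iff (f := fun n => Z n p x) 1).1 hs2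
    rw [Finset.sum_range_one] at h3
    have h4 : Y p x = _ := h3.tsum_eq
    rw [h4, add_comm]
    rfl
  refine ⟨Y, hYc, fun p => by rw [hint]; simp, fun p x => ?_⟩
  have h1 : HasDerivAt (fun x => (e p + ∫ s in (0 : ℝ)..x, F p s)
      + ∫ s in (0 : ℝ)..x, A p s *ᵥ Y p s) (F p x + A p x *ᵥ Y p x) x :=
    (((hFp p).integral_hasStrictDerivAt 0 x).hasDerivAt.const_add _).add
      ((hAY p).integral_hasStrictDerivAt 0 x).hasDerivAt
  rw [add_comm]
  convert h1 using 1
  exact funext (hint p)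

end Dyson

/-- The equation is available only for `x > a`. Gronwall's bound is therefore started at `c > a`,
and `c → a` uses the continuity of `f` at `a`. -/
theorem linear_eq_zero {A : ℝ → Mat3} {f : ℝ → V3} {a : ℝ} (hA : Continuous A)
    (hf : ContinuousOn f (Ici a)) (h0 : f a = 0)
    (hd : ∀ x, a < x → HasDerivWithinAt f (A x *ᵥ f x) (Ici x) x) : ∀ x, a ≤ x → f x = 0 := by
  intro b hb
  obtain ⟨K, hK⟩ := (isCompact_Icc (a := a) (b := b)).image (continuous_mnorm.comp hA)
    |>.bddAbove
  have hKx : ∀ x ∈ Icc a b, mnorm (A x) ≤ K := fun x hx => hK ⟨x, hx, rfl⟩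
  rcases hb.eq_or_lt with rfl | hab
  · exact h0
  have key : ∀ c ∈ Ioo a b, ‖f b‖ ≤ ‖f c‖ * Real.exp (K * (b - c)) := by
    intro c hc
    have := norm_le_gronwallBound_of_norm_deriv_right_le (f := f) (f' := fun x => A x *ᵥ f x)
      (δ := ‖f c‖) (K := K) (ε := 0) (a := c) (b := b)
      (hf.mono fun x hx => hc.1.le.trans hx.1)
      (fun x hx => hd x (hc.1.trans_le hx.1)) le_rfl
      (fun x hx => by
        rw [add_zero]
        exact (norm_mulVec_le _ _).trans (mul_le_mul_of_nonneg_right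
          (hKx x ⟨hc.1.le.trans hx.1, hx.2.le⟩) (norm_nonneg _))) b ⟨hc.2.le, le_rfl⟩
    rwa [gronwallBound_ε0] at this
  have hlim : Tendsto (fun c => ‖f c‖ * Real.exp (K * (b - c))) (𝓝[Ioo a b] a)
      (𝓝 (‖f a‖ * Real.exp (K * (b - a)))) := by
    refine Tendsto.mul ?_ ?_
    · exact ((hf a self_mem_Ici).mono fun x hx => hx.1.le).norm
    · exact ((by fun_prop : Continuous fun c : ℝ => Real.exp (K * (b - c))).tendsto a).mono_left
        nhdsWithin_le_nhds
  have hne : (𝓝[Ioo a b] a).NeBot := by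
    rw [nhdsWithin_Ioo_eq_nhdsGT hab]; infer_instance
  have := ge_of_tendsto hlim (eventually_nhdsWithin_of_forall key)
  rw [h0, norm_zero, zero_mul] at this
  exact norm_le_zero_iff.1 this

/-- Differentiability of the solution of a linear system with respect to a parameter. -/
theorem hasDerivAt_param {𝕜 : Type*} [NontriviallyNormedField 𝕜] [LocallyCompactSpace 𝕜]
    [NormedAlgebra 𝕜 ℂ] {A D : 𝕜 → ℝ → Mat3} {e : 𝕜 → V3} {Y : 𝕜 → ℝ → V3} {p₀ : 𝕜}
    {e' : V3} {R₀ : ℝ → V3}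
    (hA : Continuous (A p₀)) (hD : Continuous (Function.uncurry D))
    (hAD : ∀ p x, 0 < x → A p x - A p₀ x = (p - p₀) • D p x)
    (hY : Continuous (Function.uncurry Y)) (hY0 : ∀ p, Y p 0 = e p)
    (hYd : ∀ p x, 0 < x → HasDerivAt (Y p) (A p x *ᵥ Y p x) x) (he : HasDerivAt e e' p₀)
    (hR0 : R₀ 0 = e') (hRc : ContinuousOn R₀ (Ici 0))
    (hRd : ∀ x, 0 < x → HasDerivAt R₀ (A p₀ x *ᵥ R₀ x + D p₀ x *ᵥ Y p₀ x) x) :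
    ∀ x, 0 ≤ x → HasDerivAt (fun p => Y p x) (R₀ x) p₀ := by
  have hec : Continuous e := by
    have : e = fun p => Y p 0 := funext fun p => (hY0 p).symm
    rw [this]
    exact hY.comp (by fun_prop : Continuous fun p : 𝕜 => (p, (0 : ℝ)))
  have hsl : Continuous (dslope e p₀) := by
    rw [continuous_iff_continuousAt]
    intro p
    rcases eq_or_ne p p₀ with rfl | hp
    · exact continuousAt_dslope_same.2 he.differentiableAt
    · exact (continuousAt_dslope_of_ne hp).2 hec.continuousAt
  -- `R` is the divided difference of `Y`: it solves the system with coefficient frozen at `p₀`,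
  -- source `D p · Y p` and initial value the slope of `e`. By uniqueness `Y p = Y p₀ + (p - p₀) R
  -- p`, so the continuity of `R` at `p₀` is the differentiability of `Y`.
  obtain ⟨R, hRcont, hRe, hRder⟩ := exists_linear_solution (P := 𝕜) (A := fun _ => A p₀)
    (F := fun p x => D p x *ᵥ Y p x) (e := dslope e p₀) (hA.comp continuous_snd)
    (Continuous.matrix_mulVec hD hY) hsl
  have hRp : ∀ p, Continuous (R p) := fun p =>
    hRcont.comp (by fun_prop : Continuous fun s : ℝ => (p, s))
  have hYp : ∀ p, Continuous (Y p) := fun p =>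
    hY.comp (by fun_prop : Continuous fun s : ℝ => (p, s))
  have hdiff : ∀ p x, 0 ≤ x → Y p x = Y p₀ x + (p - p₀) • R p x := by
    intro p x hx
    have hc : Continuous fun x => Y p x - Y p₀ x - (p - p₀) • R p x :=
      ((hYp p).sub (hYp p₀)).sub ((hRp p).const_smul (p - p₀))
    have h00 : Y p 0 - Y p₀ 0 - (p - p₀) • R p 0 = 0 := by
      rw [hY0, hY0, hRe, sub_smul_dslope, sub_self]
    have := linear_eq_zero (A := A p₀) (f := fun x => Y p x - Y p₀ x - (p - p₀) • R p x) (a := 0)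
      hA hc.continuousOn h00 (fun x hx => by
        have h1 := (((hYd p x hx).sub (hYd p₀ x hx)).sub
          ((hRder p x).const_smul (p - p₀))).hasDerivWithinAt (s := Ici x)
        refine h1.congr_deriv ?_
        have h2 : A p x = A p₀ x + (p - p₀) • D p x := by rw [← hAD p x hx]; abel
        rw [Matrix.mulVec_sub, Matrix.mulVec_sub, h2, Matrix.add_mulVec, smul_add,
          Matrix.mulVec_smul, Matrix.smul_mulVec]
        abel) x hx
    rw [sub_sub, sub_eq_zero] at this
    exact this
  intro x hx
  have hR₀ : R p₀ x = R₀ x := by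
    have := linear_eq_zero (A := A p₀) (f := fun x => R p₀ x - R₀ x) (a := 0) hA
      ((hRp p₀).continuousOn.sub hRc) (by simp [hRe, hR0, he.deriv]) (fun x hx => by
        refine ((hRder p₀ x).sub (hRd x hx)).hasDerivWithinAt.congr_deriv ?_
        rw [Matrix.mulVec_sub]
        abel) x hx
    exact sub_eq_zero.1 this
  rw [hasDerivAt_iff_tendsto_slope, ← hR₀]
  have hcont : Continuous fun p => R p x := hRcont.comp (by fun_prop : Continuous fun p : 𝕜 => (p, x))
  refine ((hcont.tendsto p₀).mono_left nhdsWithin_le_nhds).congr' ?_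
  filter_upwards [self_mem_nhdsWithin] with p hp
  have hp' : p - p₀ ≠ 0 := sub_ne_zero.2 hp
  rw [slope_def_module, hdiff p x hx, add_sub_cancel_left, smul_smul, inv_mul_cancel₀ hp', one_smul]

/-! ### Scalar linear equations on the half-line -/

theorem norm_exp_mul_ofReal (ν : ℂ) (s : ℝ) : ‖exp (ν * (s : ℂ))‖ = Real.exp (ν.re * s) := by
  rw [Complex.norm_exp, Complex.re_mul_ofReal]

theorem norm_exp_mul_ofReal_le_one {ν : ℂ} {s : ℝ} (h : ν.re * s ≤ 0) :
    ‖exp (ν * (s : ℂ))‖ ≤ 1 := by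
  rw [norm_exp_mul_ofReal]
  exact Real.exp_le_one_iff.2 h

/-- The fundamental theorem of calculus for `e^{ν(X-y)} f(y)`. No order between `x` and `X` is
imposed, so the formula serves both directions. -/
theorem scalar_duhamel {f g : ℝ → ℂ} {ν : ℂ}
    (hf : ∀ x, 0 ≤ x → HasDerivWithinAt f (ν * f x + g x) (Ici 0) x)
    (hg : ContinuousOn g (Ici 0)) {x X : ℝ} (hx : 0 ≤ x) (hX : 0 ≤ X) :
    f X = exp (ν * ((X - x : ℝ) : ℂ)) * f x
      + ∫ y in x..X, exp (ν * ((X - y : ℝ) : ℂ)) * g y := by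
  have hsub : ∀ y ∈ uIcc x X, 0 ≤ y := fun y hy => (le_min hx hX).trans hy.1
  have hE : ∀ y : ℝ, HasDerivAt (fun y : ℝ => exp (ν * ((X - y : ℝ) : ℂ)))
      (exp (ν * ((X - y : ℝ) : ℂ)) * (ν * (-1))) y := by
    intro y
    have h1 : HasDerivAt (fun y : ℝ => ((X - y : ℝ) : ℂ)) (-1 : ℂ) y := by
      have := ((hasDerivAt_id y).const_sub X).ofReal_comp
      simpa using this
    exact (h1.const_mul ν).cexp
  have hd : ∀ y, 0 ≤ y → HasDerivWithinAt (fun y => exp (ν * ((X - y : ℝ) : ℂ)) * f y)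
      (exp (ν * ((X - y : ℝ) : ℂ)) * g y) (Ici 0) y := fun y hy => by
    refine ((hE y).hasDerivWithinAt.mul (hf y hy)).congr_deriv ?_
    ring
  have key := intervalIntegral.integral_eq_sub_of_hasDeriv_right
    (f := fun y => exp (ν * ((X - y : ℝ) : ℂ)) * f y) (a := x) (b := X)
    (fun y hy => (hd y (hsub y hy)).continuousWithinAt.mono fun z hz => hsub z hz)
    (fun y hy => (hd y (hsub y (Ioo_subset_Icc_self hy))).mono
      fun z hz => (hsub y (Ioo_subset_Icc_self hy)).trans (le_of_lt hz))
    (ContinuousOn.intervalIntegrable (ContinuousOn.mul (by fun_prop)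
      (hg.mono fun z hz => hsub z hz)))
  rw [key]
  simp

theorem integrableOn_exp_mul {g : ℝ → ℂ} {ν : ℂ} (hν : 0 ≤ ν.re) {x : ℝ} (hx : 0 ≤ x)
    (hg : IntegrableOn g (Ioi 0)) :
    IntegrableOn (fun y => exp (ν * ((x - y : ℝ) : ℂ)) * g y) (Ioi x) := by
  have hg' : IntegrableOn g (Ioi x) := hg.mono_set (Ioi_subset_Ioi hx)
  refine Integrable.mono hg' (AEStronglyMeasurable.mul ?_ hg'.aestronglyMeasurable) ?_
  · exact (by fun_prop : Continuous fun y : ℝ => exp (ν * ((x - y : ℝ) : ℂ))).aestronglyMeasurable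
  · filter_upwards [ae_restrict_mem measurableSet_Ioi] with y hy
    rw [norm_mul]
    refine mul_le_of_le_one_left (norm_nonneg _) (norm_exp_mul_ofReal_le_one ?_)
    exact mul_nonpos_of_nonneg_of_nonpos hν (by linarith [mem_Ioi.1 hy])

theorem norm_integral_exp_mul_le {g : ℝ → ℂ} {ν : ℂ} (hν : 0 ≤ ν.re) {x : ℝ} (hx : 0 ≤ x)
    (hg : IntegrableOn g (Ioi 0)) :
    ‖∫ y in Ioi x, exp (ν * ((x - y : ℝ) : ℂ)) * g y‖ ≤ ∫ y in Ioi x, ‖g y‖ := by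
  refine norm_integral_le_of_norm_le (hg.mono_set (Ioi_subset_Ioi hx)).norm ?_
  filter_upwards [ae_restrict_mem measurableSet_Ioi] with y hy
  rw [norm_mul]
  refine mul_le_of_le_one_left (norm_nonneg _) (norm_exp_mul_ofReal_le_one ?_)
  exact mul_nonpos_of_nonneg_of_nonpos hν (by linarith [mem_Ioi.1 hy])

/-- Let the starting point `X` of Duhamel's formula go to infinity. The boundary term `e^{ν(x-X)}
f(X)` tends to `c`: if `ν = 0` the exponential is absent, and if `c = 0` the exponential is bounded
by `1`. -/
theorem scalar_eq_of_tendsto {f g : ℝ → ℂ} {ν c : ℂ}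
    (hf : ∀ x, 0 ≤ x → HasDerivWithinAt f (ν * f x + g x) (Ici 0) x)
    (hg : ContinuousOn g (Ici 0)) (hgi : IntegrableOn g (Ioi 0)) (hν : 0 ≤ ν.re)
    (hc : ν = 0 ∨ c = 0) (hlim : Tendsto f atTop (𝓝 c)) {x : ℝ} (hx : 0 ≤ x) :
    f x = c - ∫ y in Ioi x, exp (ν * ((x - y : ℝ) : ℂ)) * g y := by
  have h1 : Tendsto (fun X => exp (ν * ((x - X : ℝ) : ℂ)) * f X
      - ∫ y in x..X, exp (ν * ((x - y : ℝ) : ℂ)) * g y) atTop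
      (𝓝 (c - ∫ y in Ioi x, exp (ν * ((x - y : ℝ) : ℂ)) * g y)) := by
    refine Tendsto.sub ?_ (intervalIntegral_tendsto_integral_Ioi x
      (integrableOn_exp_mul hν hx hgi) tendsto_id)
    rcases hc with rfl | rfl
    · simpa using hlim
    · refine squeeze_zero_norm' ?_ (tendsto_zero_iff_norm_tendsto_zero.1 hlim)
      filter_upwards [eventually_ge_atTop x] with X hX
      rw [norm_mul]
      refine mul_le_of_le_one_left (norm_nonneg _) (norm_exp_mul_ofReal_le_one ?_)
      exact mul_nonpos_of_nonneg_of_nonpos hν (by linarith)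
  refine tendsto_nhds_unique (tendsto_const_nhds.congr' ?_) h1
  filter_upwards [eventually_ge_atTop 0] with X hX
  have := scalar_duhamel hf hg hX hx
  rw [intervalIntegral.integral_symm] at this
  rw [this]
  ring

theorem scalar_tendsto_of_eq {f g : ℝ → ℂ} {ν c : ℂ} (hgi : IntegrableOn g (Ioi 0))
    (hν : 0 ≤ ν.re)
    (h : ∀ x, 0 ≤ x → f x = c - ∫ y in Ioi x, exp (ν * ((x - y : ℝ) : ℂ)) * g y) :
    Tendsto f atTop (𝓝 c) := by
  have h1 : Tendsto (fun x => ∫ y in Ioi x, exp (ν * ((x - y : ℝ) : ℂ)) * g y) atTop (𝓝 0) := by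
    refine squeeze_zero_norm' ?_ (tendsto_integral_Ioi_zero (f := fun y => ‖g y‖)
      (μ := volume) tendsto_id)
    filter_upwards [eventually_ge_atTop 0] with x hx using norm_integral_exp_mul_le hν hx hgi
  have h2 := h1.const_sub c
  rw [sub_zero] at h2
  refine h2.congr' ?_
  filter_upwards [eventually_ge_atTop 0] with x hx using (h x hx).symm

/-! ### Systems on the half-line with an integrable potential -/

/-- `w` solves `w_i' = (λ_i - α) w_i + (U w)_i` on `[0,∞)`. -/
def IsSol (lam : V3) (α : ℂ) (U : ℝ → Mat3) (w : ℝ → V3) : Prop :=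
  ∀ x, 0 ≤ x → ∀ i, HasDerivWithinAt (fun y => w y i)
    ((lam i - α) * w x i + (U x *ᵥ w x) i) (Ici 0) x

/-- A continuous integrable potential. -/
structure IsPot (U : ℝ → Mat3) : Prop where
  cont : Continuous U
  int : IntegrableOn (fun x => mnorm (U x)) (Ioi 0)

/-- The adjoint potential. -/
def adjPot (U : ℝ → Mat3) : ℝ → Mat3 := fun x => -(U x).transpose

theorem adjPot_adjPot (U : ℝ → Mat3) : adjPot (adjPot U) = U := by
  funext x
  simp [adjPot]

theorem IsPot.adj {U : ℝ → Mat3} (hU : IsPot U) : IsPot (adjPot U) where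
  cont := hU.cont.matrix_transpose.neg
  int := by
    simp only [adjPot, mnorm_neg_transpose]
    exact hU.int

theorem IsPot.cont_mnorm {U : ℝ → Mat3} (hU : IsPot U) : Continuous fun x => mnorm (U x) :=
  continuous_mnorm.comp hU.cont

/-- The total mass of a potential. -/
noncomputable def mass (U : ℝ → Mat3) : ℝ := ∫ x in Ioi (0 : ℝ), mnorm (U x)

theorem IsPot.integral_Ioi_le {U : ℝ → Mat3} (hU : IsPot U) {x : ℝ} (hx : 0 ≤ x) :
    ∫ y in Ioi x, mnorm (U y) ≤ mass U :=
  setIntegral_mono_set hU.int (Eventually.of_forall fun _ => mnorm_nonneg _)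
    (Ioi_subset_Ioi hx).eventuallyLE

theorem IsPot.integral_le_Ioi {U : ℝ → Mat3} (hU : IsPot U) {x X : ℝ} (hx : 0 ≤ x)
    (hX : x ≤ X) : ∫ y in x..X, mnorm (U y) ≤ ∫ y in Ioi x, mnorm (U y) := by
  rw [intervalIntegral.integral_of_le hX]
  exact setIntegral_mono_set (hU.int.mono_set (Ioi_subset_Ioi hx))
    (Eventually.of_forall fun _ => mnorm_nonneg _) (Ioc_subset_Ioi_self).eventuallyLE

theorem IsPot.integral_le {U : ℝ → Mat3} (hU : IsPot U) {x X : ℝ} (hx : 0 ≤ x)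
    (hX : x ≤ X) : ∫ y in x..X, mnorm (U y) ≤ mass U :=
  (hU.integral_le_Ioi hx hX).trans (hU.integral_Ioi_le hx)

section IsSol

variable {lam : V3} {α : ℂ} {U : ℝ → Mat3} {w w' : ℝ → V3}

theorem IsSol.hasDerivWithinAt (h : IsSol lam α U w) {x : ℝ} (hx : 0 ≤ x) :
    HasDerivWithinAt w ((Matrix.diagonal (fun i => lam i - α) + U x) *ᵥ w x) (Ici 0) x := by
  rw [hasDerivWithinAt_pi]
  intro i
  refine (h x hx i).congr_deriv ?_
  rw [Matrix.add_mulVec, Pi.add_apply, Matrix.mulVec_diagonal]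

theorem isSol_of_hasDerivAt
    (h : ∀ x, 0 ≤ x → HasDerivAt w ((Matrix.diagonal (fun i => lam i - α) + U x) *ᵥ w x) x) :
    IsSol lam α U w := fun x hx i => by
  refine (hasDerivAt_pi.1 (h x hx) i).hasDerivWithinAt.congr_deriv ?_
  rw [Matrix.add_mulVec, Pi.add_apply, Matrix.mulVec_diagonal]

theorem IsSol.continuousOn (h : IsSol lam α U w) : ContinuousOn w (Ici 0) := fun _ hx =>
  (h.hasDerivWithinAt hx).continuousWithinAt

theorem IsSol.continuousOn_mulVec (hU : IsPot U) (h : IsSol lam α U w) (i : Fin 3) :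
    ContinuousOn (fun x => (U x *ᵥ w x) i) (Ici 0) := by
  have h1 : ContinuousOn (fun x => U x *ᵥ w x) (Ici 0) := by
    intro x hx
    have h2 := h.continuousOn x hx
    have h3 : ContinuousWithinAt U (Ici 0) x := hU.cont.continuousWithinAt
    have h4 : Continuous fun z : Mat3 × V3 => z.1 *ᵥ z.2 :=
      Continuous.matrix_mulVec continuous_fst continuous_snd
    exact h4.continuousAt.comp_continuousWithinAt (h3.prodMk h2)
  exact (continuous_apply i).comp_continuousOn h1

theorem IsSol.sub (h : IsSol lam α U w) (h' : IsSol lam α U w') :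
    IsSol lam α U (fun x => w x - w' x) := fun x hx i => by
  refine ((h x hx i).sub (h' x hx i)).congr_deriv ?_
  simp only [Matrix.mulVec_sub, Pi.sub_apply]
  ring

theorem IsSol.smul (h : IsSol lam α U w) (c : ℂ) : IsSol lam α U (fun x => c • w x) :=
  fun x hx i => by
  refine ((h x hx i).const_mul c).congr_deriv ?_
  simp only [Matrix.mulVec_smul, Pi.smul_apply, smul_eq_mul]
  ring

theorem IsSol.eq_of_zero (hU : IsPot U) (h : IsSol lam α U w) (h' : IsSol lam α U w')
    (h0 : w 0 = w' 0) {x : ℝ} (hx : 0 ≤ x) : w x = w' x := by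
  have := linear_eq_zero (A := fun x => Matrix.diagonal (fun i => lam i - α) + U x)
    (f := fun x => w x - w' x) (a := 0) (continuous_const.add hU.cont)
    (h.sub h').continuousOn (sub_eq_zero.2 h0) (fun x hx =>
      ((h.sub h').hasDerivWithinAt hx.le).mono (Ici_subset_Ici.2 hx.le)) x hx
  exact sub_eq_zero.1 this

theorem IsSol.sub_exp_le (hU : IsPot U) (h : IsSol lam α U w) {x X : ℝ} (hx : 0 ≤ x)
    (hX : x ≤ X) {i : Fin 3} (hre : (lam i).re ≤ α.re) :
    ‖w X i - exp ((lam i - α) * ((X - x : ℝ) : ℂ)) * w x i‖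
      ≤ ∫ y in x..X, mnorm (U y) * ‖w y‖ := by
  rw [scalar_duhamel (fun x hx => h x hx i) (h.continuousOn_mulVec hU i) hx (hx.trans hX),
    add_sub_cancel_left]
  refine intervalIntegral.norm_integral_le_of_norm_le hX (Eventually.of_forall fun y hy => ?_) ?_
  · rw [norm_mul]
    refine (mul_le_of_le_one_left (norm_nonneg _) (norm_exp_mul_ofReal_le_one ?_)).trans
      (norm_mulVec_apply_le _ _ _)
    refine mul_nonpos_of_nonpos_of_nonneg ?_ (by linarith [hy.2])
    rw [Complex.sub_re]; linarith
  · refine ContinuousOn.intervalIntegrable_of_Icc hX ?_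
    exact hU.cont_mnorm.continuousOn.mul ((h.continuousOn.norm).mono fun y hy => hx.trans hy.1)

theorem IsSol.sub_exp_le_backward (hU : IsPot U) (h : IsSol lam α U w) {x X : ℝ} (hx : 0 ≤ x)
    (hX : x ≤ X) {i : Fin 3} (hre : α.re ≤ (lam i).re) :
    ‖w x i - exp ((lam i - α) * ((x - X : ℝ) : ℂ)) * w X i‖
      ≤ ∫ y in x..X, mnorm (U y) * ‖w y‖ := by
  rw [scalar_duhamel (fun x hx => h x hx i) (h.continuousOn_mulVec hU i) (hx.trans hX) hx,
    add_sub_cancel_left, intervalIntegral.integral_symm, norm_neg]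
  refine intervalIntegral.norm_integral_le_of_norm_le hX (Eventually.of_forall fun y hy => ?_) ?_
  · rw [norm_mul]
    refine (mul_le_of_le_one_left (norm_nonneg _) (norm_exp_mul_ofReal_le_one ?_)).trans
      (norm_mulVec_apply_le _ _ _)
    refine mul_nonpos_of_nonneg_of_nonpos ?_ (by linarith [hy.1])
    rw [Complex.sub_re]; linarith
  · refine ContinuousOn.intervalIntegrable_of_Icc hX ?_
    exact hU.cont_mnorm.continuousOn.mul ((h.continuousOn.norm).mono fun y hy => hx.trans hy.1)

theorem IsSol.norm_apply_le (hU : IsPot U) (h : IsSol lam α U w) {x X : ℝ} (hx : 0 ≤ x)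
    (hX : x ≤ X) {i : Fin 3} (hre : (lam i).re ≤ α.re) :
    ‖w X i‖ ≤ ‖w x‖ + ∫ y in x..X, mnorm (U y) * ‖w y‖ := by
  have h1 := h.sub_exp_le hU hx hX hre
  have h2 : ‖exp ((lam i - α) * ((X - x : ℝ) : ℂ)) * w x i‖ ≤ ‖w x‖ := by
    rw [norm_mul]
    refine (mul_le_of_le_one_left (norm_nonneg _) (norm_exp_mul_ofReal_le_one ?_)).trans
      (norm_le_pi_norm _ _)
    exact mul_nonpos_of_nonpos_of_nonneg (by rw [Complex.sub_re]; linarith) (by linarith)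
  have h3 := norm_sub_norm_le (w X i) (exp ((lam i - α) * ((X - x : ℝ) : ℂ)) * w x i)
  linarith

theorem IsSol.norm_apply_le_backward (hU : IsPot U) (h : IsSol lam α U w) {x X : ℝ} (hx : 0 ≤ x)
    (hX : x ≤ X) {i : Fin 3} (hre : α.re ≤ (lam i).re) :
    ‖w x i‖ ≤ ‖w X‖ + ∫ y in x..X, mnorm (U y) * ‖w y‖ := by
  have h1 := h.sub_exp_le_backward hU hx hX hre
  have h2 : ‖exp ((lam i - α) * ((x - X : ℝ) : ℂ)) * w X i‖ ≤ ‖w X‖ := by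
    rw [norm_mul]
    refine (mul_le_of_le_one_left (norm_nonneg _) (norm_exp_mul_ofReal_le_one ?_)).trans
      (norm_le_pi_norm _ _)
    exact mul_nonpos_of_nonneg_of_nonpos (by rw [Complex.sub_re]; linarith) (by linarith)
  have h3 := norm_sub_norm_le (w x i) (exp ((lam i - α) * ((x - X : ℝ) : ℂ)) * w X i)
  linarith

/-- If `α` has the smallest real part, the diagonal part does not expand towards smaller `x`, so
only the mass of the potential enters the bound. -/
theorem IsSol.norm_le_backward (hU : IsPot U) (h : IsSol lam α U w)
    (hre : ∀ i, α.re ≤ (lam i).re) {x X : ℝ} (hx : 0 ≤ x) (hX : x ≤ X) :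
    ‖w x‖ ≤ ‖w X‖ * Real.exp (∫ y in x..X, mnorm (U y)) := by
  refine gronwall_backward (f := fun x => ‖w x‖) (a := x) (b := X)
    ((h.continuousOn.norm).mono fun y hy => hx.trans hy.1) hU.cont_mnorm
    (fun _ => mnorm_nonneg _) (fun y hy => ?_) x ⟨le_rfl, hX⟩
  obtain ⟨i, hi⟩ := pi_norm_zero_or (w y)
  rw [hi]
  exact h.norm_apply_le_backward hU (hx.trans hy.1) hy.2 (hre i)

theorem IsSol.eq_zero_of_tendsto (hU : IsPot U) (h : IsSol lam α U w)
    (hre : ∀ i, α.re ≤ (lam i).re) (hlim : Tendsto w atTop (𝓝 0)) {x : ℝ} (hx : 0 ≤ x) :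
    w x = 0 := by
  have h1 : Tendsto (fun X => ‖w X‖ * Real.exp (mass U)) atTop (𝓝 0) := by
    simpa using hlim.norm.mul_const (Real.exp (mass U))
  have h2 : ‖w x‖ ≤ 0 := by
    refine ge_of_tendsto h1 ?_
    filter_upwards [eventually_ge_atTop x] with X hX
    refine (h.norm_le_backward hU hre hx hX).trans ?_
    gcongr
    exact hU.integral_le hx hX
  exact norm_le_zero_iff.1 h2

theorem IsSol.integrableOn_mulVec (hU : IsPot U) (h : IsSol lam α U w) {C : ℝ}
    (hC : ∀ x, 0 ≤ x → ‖w x‖ ≤ C) (i : Fin 3) :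
    IntegrableOn (fun x => (U x *ᵥ w x) i) (Ioi 0) := by
  refine Integrable.mono' (hU.int.mul_const C) ?_ ?_
  · exact ((h.continuousOn_mulVec hU i).mono Ioi_subset_Ici_self).aestronglyMeasurable
      measurableSet_Ioi
  · filter_upwards [ae_restrict_mem measurableSet_Ioi] with y hy
    exact (norm_mulVec_apply_le _ _ _).trans
      (mul_le_mul_of_nonneg_left (hC y (le_of_lt hy)) (mnorm_nonneg _))

theorem bounded_of_continuousOn_of_eventually {f : ℝ → V3} (hf : ContinuousOn f (Ici 0)) {C : ℝ}
    (h : ∀ᶠ x in atTop, ‖f x‖ ≤ C) : ∃ C, ∀ x, 0 ≤ x → ‖f x‖ ≤ C := by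
  obtain ⟨X, hX⟩ := eventually_atTop.1 h
  obtain ⟨C', hC'⟩ := isCompact_Icc.exists_bound_of_continuousOn (s := Icc 0 X)
    (hf.mono fun y hy => hy.1)
  refine ⟨max C C', fun x hx => ?_⟩
  rcases le_total X x with h1 | h1
  · exact (hX x h1).trans (le_max_left _ _)
  · exact (hC' x ⟨hx, h1⟩).trans (le_max_right _ _)

theorem bounded_of_tendsto {f : ℝ → V3} (hf : ContinuousOn f (Ici 0)) {c : V3}
    (h : Tendsto f atTop (𝓝 c)) : ∃ C, ∀ x, 0 ≤ x → ‖f x‖ ≤ C :=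
  bounded_of_continuousOn_of_eventually hf
    ((h.norm.eventually (gt_mem_nhds (lt_add_one ‖c‖))).mono fun _ hx => hx.le)

end IsSol

/-! ### Volterra columns -/

/-- The `j`-th unit vector. -/
def e3 (j : Fin 3) : V3 := fun i => if i = j then 1 else 0

theorem norm_e3 (j : Fin 3) : ‖e3 j‖ = 1 := by
  refine le_antisymm ((pi_norm_le_iff_of_nonneg zero_le_one).2 fun i => ?_) ?_
  · unfold e3; split_ifs <;> simp
  · have := norm_le_pi_norm (e3 j) j
    simpa [e3] using this

/-- The solution of the system which tends to the `j`-th unit vector. -/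
def IsVcol (lam : V3) (U : ℝ → Mat3) (j : Fin 3) (w : ℝ → V3) : Prop :=
  IsSol lam (lam j) U w ∧ Tendsto w atTop (𝓝 (e3 j))

section Volterra

variable {lam : V3} {U : ℝ → Mat3} {w w' : ℝ → V3} {j : Fin 3}

theorem IsVcol.norm_le (hU : IsPot U) (h : IsVcol lam U j w)
    (hre : ∀ i, (lam j).re ≤ (lam i).re) {x : ℝ} (hx : 0 ≤ x) :
    ‖w x‖ ≤ Real.exp (mass U) := by
  have h1 : Tendsto (fun X => ‖w X‖ * Real.exp (mass U)) atTop (𝓝 (Real.exp (mass U))) := by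
    have := h.2.norm.mul_const (Real.exp (mass U))
    rwa [norm_e3, one_mul] at this
  refine ge_of_tendsto h1 ?_
  filter_upwards [eventually_ge_atTop x] with X hX
  refine (h.1.norm_le_backward hU hre hx hX).trans ?_
  gcongr
  exact hU.integral_le hx hX

theorem IsVcol.isVolterraColumn (hU : IsPot U) (h : IsVcol lam U j w)
    (hre : ∀ i, (lam j).re ≤ (lam i).re) : IsVolterraColumn lam U j w := by
  have hb : ∀ x : ℝ, 0 ≤ x → ‖w x‖ ≤ Real.exp (mass U) := fun x hx => h.norm_le hU hre hx
  refine ⟨h.1.continuousOn, ⟨_, hb⟩, fun x hx i => ?_⟩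
  refine scalar_eq_of_tendsto (f := fun x => w x i) (fun x hx => h.1 x hx i)
    (h.1.continuousOn_mulVec hU i) (h.1.integrableOn_mulVec hU hb i) ?_ ?_ ?_ hx
  · rw [Complex.sub_re]; linarith [hre i]
  · by_cases hij : i = j
    · left; rw [hij, sub_self]
    · right; rw [if_neg hij]
  · exact (tendsto_pi_nhds.1 h.2) i

/-- `volterraMatrix` selects some bounded solution, so uniqueness is what identifies it. The
difference of two solutions obeys the homogeneous integral inequality, and backward Gronwall on
`[x,X]` bounds it by a tail integral that vanishes as `X → ∞`. -/
theorem IsVolterraColumn.eq (hU : IsPot U) (h : IsVolterraColumn lam U j w)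
    (h' : IsVolterraColumn lam U j w') (hre : ∀ i, (lam j).re ≤ (lam i).re) {x : ℝ}
    (hx : 0 ≤ x) : w x = w' x := by
  obtain ⟨hc, ⟨C, hC⟩, he⟩ := h
  obtain ⟨hc', ⟨C', hC'⟩, he'⟩ := h'
  set d : ℝ → V3 := fun x => w x - w' x with hd
  have hdc : ContinuousOn d (Ici 0) := hc.sub hc'
  have hB : ∀ x, 0 ≤ x → ‖d x‖ ≤ C + C' := fun x hx =>
    (norm_sub_le _ _).trans (add_le_add (hC x hx) (hC' x hx))
  have hmeas : ∀ {f : ℝ → V3}, ContinuousOn f (Ici 0) → ∀ i,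
      AEStronglyMeasurable (fun y => (U y *ᵥ f y) i) (volume.restrict (Ioi 0)) := by
    intro f hf i
    have h4 : Continuous fun z : Mat3 × V3 => (z.1 *ᵥ z.2) i :=
      (continuous_apply i).comp (Continuous.matrix_mulVec continuous_fst continuous_snd)
    have h5 : ContinuousOn (fun y => (U y *ᵥ f y) i) (Ici 0) :=
      h4.comp_continuousOn (hU.cont.continuousOn.prodMk hf)
    exact (h5.mono Ioi_subset_Ici_self).aestronglyMeasurable measurableSet_Ioi
  have hint : ∀ {f : ℝ → V3} {C : ℝ}, ContinuousOn f (Ici 0) → (∀ x, 0 ≤ x → ‖f x‖ ≤ C) → ∀ i,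
      IntegrableOn (fun y => (U y *ᵥ f y) i) (Ioi 0) := by
    intro f C hf hfC i
    refine Integrable.mono' (hU.int.mul_const C) (hmeas hf i) ?_
    filter_upwards [ae_restrict_mem measurableSet_Ioi] with y hy
    exact (norm_mulVec_apply_le _ _ _).trans
      (mul_le_mul_of_nonneg_left (hfC y (le_of_lt hy)) (mnorm_nonneg _))
  have hν : ∀ i, 0 ≤ (lam i - lam j).re := fun i => by
    rw [Complex.sub_re]; linarith [hre i]
  have hdi : ∀ x, 0 ≤ x → ∀ i, ‖d x i‖ ≤ ∫ y in Ioi x, mnorm (U y) * ‖d y‖ := by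
    intro x hx i
    have h1 : d x i = -∫ y in Ioi x, exp ((lam i - lam j) * ((x - y : ℝ) : ℂ))
        * (U y *ᵥ d y) i := by
      have : ∀ y, exp ((lam i - lam j) * ((x - y : ℝ) : ℂ)) * (U y *ᵥ d y) i
          = exp ((lam i - lam j) * ((x - y : ℝ) : ℂ)) * (U y *ᵥ w y) i
          - exp ((lam i - lam j) * ((x - y : ℝ) : ℂ)) * (U y *ᵥ w' y) i := fun y => by
        simp only [hd, Matrix.mulVec_sub, Pi.sub_apply]; ring
      simp_rw [this]
      rw [integral_sub (integrableOn_exp_mul (hν i) hx (hint hc hC i))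
        (integrableOn_exp_mul (hν i) hx (hint hc' hC' i))]
      simp only [hd, Pi.sub_apply]
      rw [he x hx i, he' x hx i]
      ring
    rw [h1, norm_neg]
    have hdint := hint hdc hB i
    refine (norm_integral_exp_mul_le (hν i) hx hdint).trans ?_
    refine setIntegral_mono_on (hdint.mono_set (Ioi_subset_Ioi hx)).norm ?_ measurableSet_Ioi
      fun y _ => norm_mulVec_apply_le _ _ _
    refine Integrable.mono' ((hU.int.mono_set (Ioi_subset_Ioi hx)).mul_const (C + C')) ?_ ?_
    · exact ((hU.cont_mnorm.continuousOn.mul hdc.norm).mono fun y hy =>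
        hx.trans (le_of_lt hy)).aestronglyMeasurable measurableSet_Ioi
    · filter_upwards [ae_restrict_mem measurableSet_Ioi] with y hy
      rw [norm_mul, norm_norm, Real.norm_of_nonneg (mnorm_nonneg _)]
      exact mul_le_mul_of_nonneg_left (hB y (hx.trans (le_of_lt hy))) (mnorm_nonneg _)
  have hint2 : ∀ x, 0 ≤ x → IntegrableOn (fun y => mnorm (U y) * ‖d y‖) (Ioi x) := by
    intro x hx
    refine Integrable.mono' ((hU.int.mono_set (Ioi_subset_Ioi hx)).mul_const (C + C')) ?_ ?_
    · exact ((hU.cont_mnorm.continuousOn.mul hdc.norm).mono fun y hy =>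
        hx.trans (le_of_lt hy)).aestronglyMeasurable measurableSet_Ioi
    · filter_upwards [ae_restrict_mem measurableSet_Ioi] with y hy
      rw [norm_mul, norm_norm, Real.norm_of_nonneg (mnorm_nonneg _)]
      exact mul_le_mul_of_nonneg_left (hB y (hx.trans (le_of_lt hy))) (mnorm_nonneg _)
  have hfin : ∀ X, x ≤ X → ‖d x‖ ≤ (∫ y in Ioi X, mnorm (U y) * ‖d y‖) * Real.exp (mass U) := by
    intro X hX
    have h1 := gronwall_backward (f := fun x => ‖d x‖) (u := fun y => mnorm (U y)) (a := x)
      (b := X) (C := ∫ y in Ioi X, mnorm (U y) * ‖d y‖)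
      (hdc.norm.mono fun y hy => hx.trans hy.1) hU.cont_mnorm (fun _ => mnorm_nonneg _)
      (fun y hy => by
        have hy0 := hx.trans hy.1
        obtain ⟨i, hi⟩ := pi_norm_zero_or (d y)
        rw [hi, add_comm, intervalIntegral.integral_interval_add_Ioi (hint2 y hy0)
          (hint2 X (hy0.trans hy.2))]
        exact hdi y hy0 i) x ⟨le_rfl, hX⟩
    refine h1.trans (mul_le_mul_of_nonneg_left (Real.exp_le_exp.2 (hU.integral_le hx hX)) ?_)
    exact setIntegral_nonneg measurableSet_Ioi fun y _ =>
      mul_nonneg (mnorm_nonneg _) (norm_nonneg _)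
  have hlim : Tendsto (fun X => (∫ y in Ioi X, mnorm (U y) * ‖d y‖) * Real.exp (mass U)) atTop
      (𝓝 0) := by
    simpa using (tendsto_integral_Ioi_zero (f := fun y => mnorm (U y) * ‖d y‖) (μ := volume)
      (tendsto_id (α := ℝ) (x := atTop))).mul_const (Real.exp (mass U))
  have h0 : ‖d x‖ ≤ 0 := ge_of_tendsto hlim ((eventually_ge_atTop x).mono hfin)
  exact sub_eq_zero.1 (norm_le_zero_iff.1 h0)

/-- The `j`-th column of the matrix of Volterra columns at `0`. -/
noncomputable def vvec (lam : V3) (U : ℝ → Mat3) (j : Fin 3) : V3 :=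
  fun i => volterraMatrix lam U i j

theorem solutionOf_spec {β : Type} [Zero β] {Q : β → Prop} (h : ∃ a, Q a) : Q (solutionOf Q) := by
  unfold solutionOf
  rw [dif_pos h]
  exact h.choose_spec

theorem IsVcol.zero_eq_vvec (hU : IsPot U) (h : IsVcol lam U j w)
    (hre : ∀ i, (lam j).re ≤ (lam i).re) : w 0 = vvec lam U j := by
  have h1 := h.isVolterraColumn hU hre
  have h2 : IsVolterraColumn lam U j (solutionOf (IsVolterraColumn lam U j)) :=
    solutionOf_spec ⟨w, h1⟩
  funext i
  exact congrFun (h1.eq hU h2 hre le_rfl) i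

theorem IsVolterraColumn.congr_pot {U' : ℝ → Mat3} (hUU : ∀ x, 0 < x → U x = U' x)
    (h : IsVolterraColumn lam U j w) : IsVolterraColumn lam U' j w := by
  refine ⟨h.1, h.2.1, fun x hx i => ?_⟩
  rw [h.2.2 x hx i]
  congr 1
  refine setIntegral_congr_fun measurableSet_Ioi fun y hy => ?_
  rw [hUU y (hx.trans_lt hy)]

/-- Only values at positive arguments enter the integrals. This permits replacing the data, which
agree with the solution for `x > 0` only, by continuous potentials on the line. -/
theorem volterraMatrix_congr {U' : ℝ → Mat3} (hUU : ∀ x, 0 < x → U x = U' x) :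
    volterraMatrix lam U = volterraMatrix lam U' := by
  have : ∀ j, IsVolterraColumn lam U j = IsVolterraColumn lam U' j := fun j =>
    funext fun w => propext ⟨fun h => h.congr_pot hUU,
      fun h => h.congr_pot fun x hx => (hUU x hx).symm⟩
  simp only [volterraMatrix, this]

end Volterra

/-! ### Existence of Volterra columns and their dependence on a complex parameter -/

/-- The parameter enters through the diagonal alone, so the divided difference of the coefficient is
the diagonal matrix of slopes of `ν`, which is continuous in the parameter. -/
theorem differentiable_linear_solution {ν : ℂ → V3} (hν : Differentiable ℂ ν) {V : ℝ → Mat3}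
    (hV : Continuous V) {Y : ℂ → ℝ → V3} (hYc : Continuous (Function.uncurry Y))
    (hYd : ∀ p x, 0 < x → HasDerivAt (Y p) ((Matrix.diagonal (ν p) + V x) *ᵥ Y p x) x)
    (hY0 : Differentiable ℂ fun p => Y p 0) {x : ℝ} (hx : 0 ≤ x) :
    Differentiable ℂ fun p => Y p x := by
  intro k₀
  have hYk : Continuous (Y k₀) := hYc.comp (by fun_prop : Continuous fun s : ℝ => (k₀, s))
  have hsl : Continuous (dslope ν k₀) := by
    rw [continuous_iff_continuousAt]
    intro p
    rcases eq_or_ne p k₀ with rfl | hp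
    · exact continuousAt_dslope_same.2 (hν _)
    · exact (continuousAt_dslope_of_ne hp).2 (hν p).continuousAt
  obtain ⟨R, hRc, hR0, hRd⟩ := exists_linear_solution (P := Unit)
    (A := fun _ x => Matrix.diagonal (ν k₀) + V x)
    (F := fun _ x => Matrix.diagonal (dslope ν k₀ k₀) *ᵥ Y k₀ x)
    (e := fun _ => deriv (fun p => Y p 0) k₀)
    (continuous_const.add (hV.comp continuous_snd))
    (Continuous.matrix_mulVec continuous_const (hYk.comp continuous_snd)) continuous_const
  exact (hasDerivAt_param (𝕜 := ℂ) (A := fun p x => Matrix.diagonal (ν p) + V x)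
    (D := fun p _ => Matrix.diagonal (dslope ν k₀ p)) (e := fun p => Y p 0)
    (continuous_const.add hV) ((hsl.comp continuous_fst).matrix_diagonal)
    (fun p x _ => by
      simp only [add_sub_add_right_eq_sub]
      rw [← Matrix.diagonal_smul, sub_smul_dslope, Matrix.diagonal_sub]
      rfl) hYc (fun _ => rfl) hYd
    (hY0 k₀).hasDerivAt (hR0 ()) (hRc.comp (by fun_prop : Continuous fun s : ℝ => ((), s))).continuousOn
    (fun x _ => hRd () x) x hx).differentiableAt

section Param

variable {lam : ℂ → V3} {U : ℝ → Mat3}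

/-- The substitution `s = X - x` turns the terminal condition at `X` into an initial condition, to
which the parameter theorem applies. -/
theorem exists_backward_solution (hU : Continuous U) (hlam : Differentiable ℂ lam) (j : Fin 3)
    (X : ℝ) (hX : 0 ≤ X) (e : V3) :
    ∃ W : ℂ → ℝ → V3, (∀ k, IsSol (lam k) (lam k j) U (W k)) ∧ (∀ k, W k X = e) ∧
      Differentiable ℂ fun k => W k 0 := by
  set ν : ℂ → V3 := fun k i => -(lam k i - lam k j) with hν
  have hνd : Differentiable ℂ ν := by
    rw [differentiable_pi] at hlam ⊢
    exact fun i => ((hlam i).sub (hlam j)).neg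
  obtain ⟨Z, hZc, hZ0, hZd⟩ := exists_linear_solution (P := ℂ)
    (A := fun k s => Matrix.diagonal (ν k) + -U (X - s)) (F := fun _ _ => 0) (e := fun _ => e)
    (((hνd.continuous.comp continuous_fst).matrix_diagonal).add
      (hU.comp (continuous_const.sub continuous_snd)).neg) continuous_const continuous_const
  refine ⟨fun k x => Z k (X - x), fun k => isSol_of_hasDerivAt fun x _ => ?_, fun k => ?_, ?_⟩
  · have h1 := (hZd k (X - x)).scomp x ((hasDerivAt_id x).const_sub X)
    refine h1.congr_deriv ?_
    simp only [add_zero, sub_sub_cancel, neg_smul, one_smul]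
    rw [← Matrix.neg_mulVec, neg_add, neg_neg]
    congr 2
    rw [← Matrix.diagonal_neg]
    funext i
    simp
  · simp only [sub_self, hZ0]
  · have := differentiable_linear_solution hνd (V := fun s => -U (X - s))
      (hU.comp (continuous_const.sub continuous_id)).neg hZc
      (fun p x _ => by simpa using hZd p x) (by simp only [hZ0]; fun_prop) hX
    simpa using this

/-- Approximate by the solutions equal to `e_j` at `x = n`. Their values at `0` are entire in `k`,
and they are uniformly Cauchy on the closed set where `λ_j` has minimal real part, with error
controlled by the tail of the potential. The uniform limit is continuous there and holomorphic on
open subsets. -/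
theorem exists_isVcol_param (hU : IsPot U) (hlam : Differentiable ℂ lam) (j : Fin 3) :
    ∃ s : ℂ → V3, ContinuousOn s {k | ∀ i, (lam k j).re ≤ (lam k i).re} ∧
      (∀ O : Set ℂ, IsOpen O → (∀ k ∈ O, ∀ i, (lam k j).re ≤ (lam k i).re) →
        DifferentiableOn ℂ s O) ∧
      ∀ k, (∀ i, (lam k j).re ≤ (lam k i).re) → ∃ w, IsVcol (lam k) U j w ∧ w 0 = s k := by
  choose W hWs hWX hWd using fun n : ℕ =>
    exists_backward_solution hU.cont hlam j (n : ℝ) n.cast_nonneg (e3 j)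
  set F : Set ℂ := {k | ∀ i, (lam k j).re ≤ (lam k i).re} with hF
  set E := Real.exp (mass U) with hE
  have hE0 : 0 < E := Real.exp_pos _
  have hbd : ∀ n : ℕ, ∀ k ∈ F, ∀ x : ℝ, 0 ≤ x → x ≤ n → ‖W n k x‖ ≤ E := by
    intro n k hk x hx hxn
    have := (hWs n k).norm_le_backward hU hk hx hxn
    rw [hWX, norm_e3, one_mul] at this
    exact this.trans (Real.exp_le_exp.2 (hU.integral_le hx hxn))
  have hnear : ∀ n : ℕ, ∀ k ∈ F, ∀ x : ℝ, 0 ≤ x → x ≤ n →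
      ‖W n k x - e3 j‖ ≤ E * ∫ y in Ioi x, mnorm (U y) := by
    intro n k hk x hx hxn
    have h0 : 0 ≤ ∫ y in Ioi x, mnorm (U y) := setIntegral_nonneg measurableSet_Ioi
      fun _ _ => mnorm_nonneg _
    refine (pi_norm_le_iff_of_nonneg (mul_nonneg hE0.le h0)).2 fun i => ?_
    have h1 := (hWs n k).sub_exp_le_backward hU hx hxn (hk i)
    have h2 : exp ((lam k i - lam k j) * ((x - n : ℝ) : ℂ)) * W n k n i = e3 j i := by
      rw [hWX]
      unfold e3
      split_ifs with hij
      · rw [hij]; simp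
      · simp
    rw [h2] at h1
    rw [Pi.sub_apply]
    refine h1.trans ?_
    have h3 : ∫ y in x..(n : ℝ), mnorm (U y) * ‖W n k y‖ ≤ ∫ y in x..(n : ℝ), mnorm (U y) * E := by
      refine intervalIntegral.integral_mono_on hxn ?_ ?_ fun y hy => ?_
      · refine ContinuousOn.intervalIntegrable_of_Icc hxn ?_
        exact hU.cont_mnorm.continuousOn.mul
          (((hWs n k).continuousOn.norm).mono fun y hy => hx.trans hy.1)
      · exact (hU.cont_mnorm.mul continuous_const).intervalIntegrable _ _
      · exact mul_le_mul_of_nonneg_left (hbd n k hk y (hx.trans hy.1) hy.2) (mnorm_nonneg _)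
    refine h3.trans ?_
    rw [intervalIntegral.integral_mul_const, mul_comm]
    exact mul_le_mul_of_nonneg_left (hU.integral_le_Ioi hx hxn) hE0.le
  have hdiff : ∀ n m : ℕ, n ≤ m → ∀ k ∈ F,
      ‖W m k 0 - W n k 0‖ ≤ E * (∫ y in Ioi (n : ℝ), mnorm (U y)) * E := by
    intro n m hnm k hk
    have h1 := ((hWs m k).sub (hWs n k)).norm_le_backward hU hk le_rfl (n.cast_nonneg (α := ℝ))
    refine h1.trans ?_
    rw [hWX n k]
    refine mul_le_mul (hnear m k hk n n.cast_nonneg (by exact_mod_cast hnm))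
      (Real.exp_le_exp.2 (hU.integral_le le_rfl n.cast_nonneg)) (Real.exp_pos _).le
      (mul_nonneg hE0.le ?_)
    exact setIntegral_nonneg measurableSet_Ioi fun _ _ => mnorm_nonneg _
  have htail : Tendsto (fun x : ℝ => ∫ y in Ioi x, mnorm (U y)) atTop (𝓝 0) :=
    tendsto_integral_Ioi_zero tendsto_id
  have htailn : Tendsto (fun n : ℕ => E * (∫ y in Ioi (n : ℝ), mnorm (U y)) * E) atTop (𝓝 0) := by
    have := ((htail.comp tendsto_natCast_atTop_atTop).const_mul E).mul_const E
    simpa using this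
  have hcau : UniformCauchySeqOn (fun n k => W n k 0) atTop F := by
    rw [Metric.uniformCauchySeqOn_iff]
    intro ε hε
    obtain ⟨N, hN⟩ := eventually_atTop.1 (htailn.eventually (gt_mem_nhds hε))
    refine ⟨N, fun m hm n hn k hk => ?_⟩
    rw [dist_eq_norm]
    rcases le_total n m with h | h
    · exact (hdiff n m h k hk).trans_lt (hN n hn)
    · rw [norm_sub_rev]
      exact (hdiff m n h k hk).trans_lt (hN m hm)
  have hex : ∀ k, ∃ v : V3, k ∈ F → Tendsto (fun n => W n k 0) atTop (𝓝 v) := by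
    intro k
    by_cases hk : k ∈ F
    · obtain ⟨v, hv⟩ := cauchySeq_tendsto_of_complete (hcau.cauchySeq hk)
      exact ⟨v, fun _ => hv⟩
    · exact ⟨0, fun h => absurd h hk⟩
  choose s hs using hex
  have hunif : TendstoUniformlyOn (fun n k => W n k 0) s atTop F :=
    hcau.tendstoUniformlyOn_of_tendsto hs
  refine ⟨s, hunif.continuousOn (Frequently.of_forall fun n => (hWd n).continuous.continuousOn),
    fun O hO hOF => ?_, fun k hk => ?_⟩
  · exact (hunif.mono hOF).tendstoLocallyUniformlyOn.differentiableOn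
      (Eventually.of_forall fun n => (hWd n).differentiableOn) hO
  -- The limiting initial value is propagated by continuous dependence on initial data. The estimate
  -- `hnear` survives the limit and forces convergence to `e_j` at infinity.
  · obtain ⟨Y, hYc, hY0, hYd⟩ := exists_linear_solution (P := V3)
      (A := fun _ x => Matrix.diagonal (fun i => lam k i - lam k j) + U x) (F := fun _ _ => 0)
      (e := fun v => v) (continuous_const.add (hU.cont.comp continuous_snd)) continuous_const
      continuous_id
    have hWY : ∀ n x, 0 ≤ x → W n k x = Y (W n k 0) x := fun n x hx =>
      (hWs n k).eq_of_zero hU (isSol_of_hasDerivAt fun x _ => by simpa using hYd (W n k 0) x)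
        (hY0 _).symm hx
    have hYc' : ∀ x, Tendsto (fun n => Y (W n k 0) x) atTop (𝓝 (Y (s k) x)) := fun x =>
      ((hYc.comp (by fun_prop : Continuous fun v : V3 => (v, x))).tendsto (s k)).comp (hs k hk)
    have hb : ∀ x, 0 ≤ x → ‖Y (s k) x - e3 j‖ ≤ E * ∫ y in Ioi x, mnorm (U y) := by
      intro x hx
      refine le_of_tendsto ((hYc' x).sub_const (e3 j)).norm ?_
      filter_upwards [tendsto_natCast_atTop_atTop.eventually (eventually_ge_atTop x)] with n hn
      rw [← hWY n x hx]
      exact hnear n k hk x hx hn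
    refine ⟨Y (s k), ⟨isSol_of_hasDerivAt fun x _ => by simpa using hYd (s k) x, ?_⟩, hY0 _⟩
    rw [tendsto_iff_norm_sub_tendsto_zero]
    refine squeeze_zero' (Eventually.of_forall fun _ => norm_nonneg _)
      ((eventually_ge_atTop 0).mono hb) ?_
    simpa using htail.const_mul E

theorem exists_isVcol (hU : IsPot U) (lam : V3) {j : Fin 3} (hre : ∀ i, (lam j).re ≤ (lam i).re) :
    ∃ w, IsVcol lam U j w ∧ w 0 = vvec lam U j := by
  obtain ⟨s, -, -, h⟩ := exists_isVcol_param (lam := fun _ => lam) hU (differentiable_const _) j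
  obtain ⟨w, hw, -⟩ := h 0 hre
  exact ⟨w, hw, hw.zero_eq_vvec hU hre⟩

theorem continuousOn_vvec (hU : IsPot U) (hlam : Differentiable ℂ lam) (j : Fin 3) :
    ContinuousOn (fun k => vvec (lam k) U j) {k | ∀ i, (lam k j).re ≤ (lam k i).re} := by
  obtain ⟨s, hs, -, h⟩ := exists_isVcol_param hU hlam j
  refine hs.congr fun k hk => ?_
  obtain ⟨w, hw, hw0⟩ := h k hk
  exact (hw.zero_eq_vvec hU hk).symm.trans hw0

theorem differentiableOn_vvec (hU : IsPot U) (hlam : Differentiable ℂ lam) (j : Fin 3) {O : Set ℂ}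
    (hO : IsOpen O) (hre : ∀ k ∈ O, ∀ i, (lam k j).re ≤ (lam k i).re) :
    DifferentiableOn ℂ (fun k => vvec (lam k) U j) O := by
  obtain ⟨s, -, hs, h⟩ := exists_isVcol_param hU hlam j
  refine (hs O hO hre).congr fun k hk => ?_
  obtain ⟨w, hw, hw0⟩ := h k (hre k hk)
  exact (hw.zero_eq_vvec hU (hre k hk)).symm.trans hw0

end Param

/-! ### Pairing with the adjoint system and cross products -/

section Pairing

variable {lam : V3} {α β : ℂ} {U : ℝ → Mat3} {w u y : ℝ → V3}

theorem mulVec_three (M : Mat3) (v : V3) (i : Fin 3) :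
    (M *ᵥ v) i = M i 0 * v 0 + M i 1 * v 1 + M i 2 * v 2 := by
  simp [Matrix.mulVec, dotProduct, Fin.sum_univ_three]

theorem dot_three (v w : V3) : v ⬝ᵥ w = v 0 * w 0 + v 1 * w 1 + v 2 * w 2 := by
  simp [dotProduct, Fin.sum_univ_three]

/-- The pairing of a solution with a solution of the adjoint system is an exponential. -/
theorem IsSol.pairing (h : IsSol lam α U w) (hy : IsSol (fun i => -lam i) β (adjPot U) y)
    {x X : ℝ} (hx : 0 ≤ x) (hX : 0 ≤ X) :
    y X ⬝ᵥ w X = exp (-(α + β) * ((X - x : ℝ) : ℂ)) * (y x ⬝ᵥ w x) := by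
  have hd : ∀ x, 0 ≤ x → HasDerivWithinAt (fun x => y x ⬝ᵥ w x)
      (-(α + β) * (y x ⬝ᵥ w x) + 0) (Ici 0) x := by
    intro x hx
    have h3 := fun i => (hy x hx i).mul (h x hx i)
    have h4 := ((h3 0).add (h3 1)).add (h3 2)
    have h5 : (fun x => y x ⬝ᵥ w x) = fun x => y x 0 * w x 0 + y x 1 * w x 1 + y x 2 * w x 2 :=
      funext fun x => dot_three _ _
    rw [h5]
    refine h4.congr_deriv ?_
    simp only [adjPot, mulVec_three, dot_three, Matrix.neg_apply, Matrix.transpose_apply]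
    ring
  have := scalar_duhamel (g := fun _ => 0) hd continuousOn_const hx hX
  simpa using this

/-- The cross product of two solutions solves the adjoint system. -/
theorem IsSol.cross (hlam : lam 0 + lam 1 + lam 2 = 0)
    (htr : ∀ x, U x 0 0 + U x 1 1 + U x 2 2 = 0) (h : IsSol lam α U w) (hu : IsSol lam β U u) :
    IsSol (fun i => -lam i) (α + β) (adjPot U) (fun x => w x ⨯₃ u x) := by
  intro x hx i
  have hw := h x hx
  have hv := hu x hx
  have ht := htr x
  fin_cases i
  · refine (((hw 1).mul (hv 2)).sub ((hw 2).mul (hv 1))).congr_deriv ?_ |>.congr_of_eventuallyEq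
      (Eventually.of_forall fun y => by simp [cross_apply]) (by simp [cross_apply])
    simp only [adjPot, mulVec_three, Matrix.neg_apply, Matrix.transpose_apply, cross_apply,
      Fin.zero_eta, Matrix.cons_val_zero, Matrix.cons_val_one, Matrix.cons_val]
    linear_combination (w x 1 * u x 2 - w x 2 * u x 1) * hlam
      + (w x 1 * u x 2 - w x 2 * u x 1) * ht
  · refine (((hw 2).mul (hv 0)).sub ((hw 0).mul (hv 2))).congr_deriv ?_ |>.congr_of_eventuallyEq
      (Eventually.of_forall fun y => by simp [cross_apply]) (by simp [cross_apply])
    simp only [adjPot, mulVec_three, Matrix.neg_apply, Matrix.transpose_apply, cross_apply,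
      Fin.mk_one, Matrix.cons_val_zero, Matrix.cons_val_one, Matrix.cons_val]
    linear_combination (w x 2 * u x 0 - w x 0 * u x 2) * hlam
      + (w x 2 * u x 0 - w x 0 * u x 2) * ht
  · refine (((hw 0).mul (hv 1)).sub ((hw 1).mul (hv 0))).congr_deriv ?_ |>.congr_of_eventuallyEq
      (Eventually.of_forall fun y => by simp [cross_apply]) (by simp [cross_apply])
    simp only [adjPot, mulVec_three, Matrix.neg_apply, Matrix.transpose_apply, cross_apply,
      Fin.reduceFinMk, Matrix.cons_val_zero, Matrix.cons_val_one, Matrix.cons_val]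
    linear_combination (w x 0 * u x 1 - w x 1 * u x 0) * hlam
      + (w x 0 * u x 1 - w x 1 * u x 0) * ht

end Pairing

/-- The three indices with the sign of the permutation `(a, b, c)`. -/
structure Tri (a b c : Fin 3) (ε : ℂ) : Prop where
  sq : ε * ε = 1
  cover : ∀ i, i = a ∨ i = b ∨ i = c
  ab : a ≠ b
  ac : a ≠ c
  bc : b ≠ c
  cross_a : ∀ p q : V3, (p ⨯₃ q) a = ε * (p b * q c - p c * q b)
  cross_b : ∀ p q : V3, (p ⨯₃ q) b = ε * (p c * q a - p a * q c)
  cross_c : ∀ p q : V3, (p ⨯₃ q) c = ε * (p a * q b - p b * q a)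
  dot : ∀ p q : V3, p ⬝ᵥ q = p a * q a + p b * q b + p c * q c

theorem tri_201 : Tri 2 0 1 1 := by
  constructor <;> first | decide | (intros; simp [cross_apply, dot_three]; try ring)

theorem tri_210 : Tri 2 1 0 (-1) := by
  constructor <;> first | decide | (intros; simp [cross_apply, dot_three]; try ring)

theorem tri_012 : Tri 0 1 2 1 := by
  constructor <;> first | decide | (intros; simp [cross_apply, dot_three]; try ring)

/-! ### Behaviour at infinity expressed through the value at `0` -/

section Asymptotics

variable {lam : V3} {α : ℂ} {U : ℝ → Mat3} {w u y : ℝ → V3} {a b c : Fin 3} {ε : ℂ}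

theorem tendsto_apply {f : ℝ → V3} {v : V3} (h : Tendsto f atTop (𝓝 v)) (i : Fin 3) :
    Tendsto (fun x => f x i) atTop (𝓝 (v i)) := tendsto_pi_nhds.1 h i

theorem IsVcol.tendsto_self (h : IsVcol lam U a w) : Tendsto (fun x => w x a) atTop (𝓝 1) := by
  have := tendsto_apply h.2 a
  simpa [e3] using this

theorem IsVcol.tendsto_ne (h : IsVcol lam U a w) {i : Fin 3} (hi : i ≠ a) :
    Tendsto (fun x => w x i) atTop (𝓝 0) := by
  have := tendsto_apply h.2 i
  simpa [e3, hi] using this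

/-- A function with values in `V3` which is bounded on `[0,∞)`. -/
def BddHalf (w : ℝ → V3) : Prop := ∃ C, ∀ x, 0 ≤ x → ‖w x‖ ≤ C

theorem IsVcol.bddHalf (h : IsVcol lam U a w) : BddHalf w :=
  bounded_of_tendsto h.1.continuousOn h.2

theorem BddHalf.tendsto_mul (h : BddHalf w) (i : Fin 3) {f : ℝ → ℂ} (hf : Tendsto f atTop (𝓝 0)) :
    Tendsto (fun x => f x * w x i) atTop (𝓝 0) := by
  obtain ⟨C, hC⟩ := h
  have h1 : Tendsto (fun x => ‖f x‖ * C) atTop (𝓝 0) := by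
    simpa using hf.norm.mul_const C
  refine squeeze_zero_norm' ?_ h1
  filter_upwards [eventually_ge_atTop 0] with x hx
  rw [norm_mul]
  exact mul_le_mul_of_nonneg_left ((norm_le_pi_norm _ _).trans (hC x hx)) (norm_nonneg _)

theorem BddHalf.tendsto_dot_sub (h : BddHalf w) (hy : Tendsto y atTop (𝓝 (e3 b))) :
    Tendsto (fun x => y x ⬝ᵥ w x - w x b) atTop (𝓝 0) := by
  have h1 : ∀ i, Tendsto (fun x => (y x i - e3 b i) * w x i) atTop (𝓝 0) := fun i =>
    h.tendsto_mul i (by simpa using (tendsto_apply hy i).sub_const (e3 b i))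
  have h2 := ((h1 0).add (h1 1)).add (h1 2)
  simp only [add_zero] at h2
  refine h2.congr fun x => ?_
  rw [dot_three]
  have : w x b = e3 b 0 * w x 0 + e3 b 1 * w x 1 + e3 b 2 * w x 2 := by
    fin_cases b <;> simp [e3]
  rw [this]
  ring

/-- For the sup norm, forward Gronwall needs the decay estimate only for a component that attains
the norm. -/
theorem IsSol.bddHalf_of_forward (hU : IsPot U) (h : IsSol lam α U w) {X₀ : ℝ} (hX₀ : 0 ≤ X₀)
    (hw : ∀ x, X₀ ≤ x → ∃ i, ‖w x‖ = ‖w x i‖ ∧ (lam i).re ≤ α.re) : BddHalf w := by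
  refine bounded_of_continuousOn_of_eventually h.continuousOn
    (C := ‖w X₀‖ * Real.exp (mass U)) ?_
  filter_upwards [eventually_ge_atTop X₀] with X hX
  have h1 := gronwall (f := fun x => ‖w x‖) (u := fun y => mnorm (U y)) (C := ‖w X₀‖) (a := X₀)
    (b := X) ((h.continuousOn.norm).mono fun y hy => hX₀.trans hy.1) hU.cont_mnorm
    (fun _ => mnorm_nonneg _) (fun x hx => by
      obtain ⟨i, hi, hre⟩ := hw x hx.1
      rw [hi]
      exact h.norm_apply_le hU hX₀ hx.1 hre) X ⟨hX, le_rfl⟩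
  refine h1.trans ?_
  gcongr
  exact hU.integral_le hX₀ hX

theorem IsSol.bddHalf_of_max (hU : IsPot U) (h : IsSol lam α U w)
    (hre : ∀ i, (lam i).re ≤ α.re) : BddHalf w :=
  h.bddHalf_of_forward hU le_rfl fun x _ => by
    obtain ⟨i, hi⟩ := pi_norm_zero_or (w x)
    exact ⟨i, hi, hre i⟩

/-- The initial value of the adjoint Volterra column. -/
noncomputable def avec (lam : V3) (U : ℝ → Mat3) (b : Fin 3) : V3 :=
  vvec (fun i => -lam i) (adjPot U) b

theorem exists_adj_isVcol (hU : IsPot U) (hb : ∀ i, (lam i).re ≤ (lam b).re) :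
    ∃ y, IsVcol (fun i => -lam i) (adjPot U) b y ∧ y 0 = avec lam U b :=
  exists_isVcol hU.adj _ fun i => by simpa using hb i

theorem avec_adj (lam : V3) (U : ℝ → Mat3) (b : Fin 3) :
    avec (fun i => -lam i) (adjPot U) b = vvec lam U b := by
  simp [avec, adjPot_adjPot]

/-- The pairing with the adjoint column tends to `0`, because that column tends to `e_b`. Carrying
it from `x` back to `0` costs a factor `e^{(α-λ_b)x}` of modulus at most `1`. -/
theorem IsSol.dot_avec_eq_zero (hU : IsPot U) (hb : ∀ i, (lam i).re ≤ (lam b).re)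
    (h : IsSol lam α U w) (hw : BddHalf w) (hwb : Tendsto (fun x => w x b) atTop (𝓝 0))
    (hα : α.re ≤ (lam b).re) : avec lam U b ⬝ᵥ w 0 = 0 := by
  obtain ⟨y, hy, hy0⟩ := exists_adj_isVcol hU hb
  rw [← hy0]
  have h1 : Tendsto (fun x => y x ⬝ᵥ w x) atTop (𝓝 0) := by
    simpa using (hw.tendsto_dot_sub hy.2).add hwb
  refine norm_le_zero_iff.1 (ge_of_tendsto (by simpa using h1.norm) ?_)
  filter_upwards [eventually_ge_atTop 0] with x hx
  rw [h.pairing hy.1 hx le_rfl, norm_mul]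
  refine mul_le_of_le_one_left (norm_nonneg _) (norm_exp_mul_ofReal_le_one ?_)
  refine mul_nonpos_of_nonneg_of_nonpos ?_ (by linarith)
  simp only [neg_re, add_re]
  linarith

/-- The orthogonality persists for all `x`. Once the adjoint column is close to `e_b` it makes `w_b`
a small multiple of `‖w‖`, so the norm is carried by components whose exponents do not grow. -/
theorem IsSol.bddHalf_and_tendsto_of_dot (hU : IsPot U) (hb : ∀ i, (lam i).re ≤ (lam b).re)
    (h : IsSol lam α U w) (hα : ∀ i, i ≠ b → (lam i).re ≤ α.re)
    (h0 : avec lam U b ⬝ᵥ w 0 = 0) :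
    BddHalf w ∧ Tendsto (fun x => w x b) atTop (𝓝 0) := by
  obtain ⟨y, hy, hy0⟩ := exists_adj_isVcol hU hb
  rw [← hy0] at h0
  have hyw : ∀ x, 0 ≤ x → y x ⬝ᵥ w x = 0 := fun x hx => by
    rw [h.pairing hy.1 le_rfl hx, h0, mul_zero]
  -- Three terms of size `1/4` give `|w_b| ≤ (3/4)‖w‖`, so `w_b` attains the norm only if `w = 0`.
  have hsm : ∀ᶠ x in atTop, ‖y x - e3 b‖ < 1 / 4 := by
    have : Tendsto (fun x => ‖y x - e3 b‖) atTop (𝓝 0) := by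
      simpa using (hy.2.sub_const (e3 b)).norm
    exact this.eventually (gt_mem_nhds (by norm_num))
  obtain ⟨X, hX⟩ := eventually_atTop.1 hsm
  have hbd : BddHalf w := by
    refine h.bddHalf_of_forward hU (le_max_right X 0) fun x hx => ?_
    have hx0 : 0 ≤ x := (le_max_right X 0).trans hx
    obtain ⟨i, hi⟩ := pi_norm_zero_or (w x)
    by_cases hib : i = b
    · have h1 : w x b = -((y x 0 - e3 b 0) * w x 0 + (y x 1 - e3 b 1) * w x 1
          + (y x 2 - e3 b 2) * w x 2) := by
        have h2 := hyw x hx0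
        rw [dot_three] at h2
        have : w x b = e3 b 0 * w x 0 + e3 b 1 * w x 1 + e3 b 2 * w x 2 := by
          clear hib hi hyw h0 hy0 hsm hX hb hα
          fin_cases b <;> simp [e3]
        linear_combination this + h2
      have h3 : ∀ j, ‖(y x j - e3 b j) * w x j‖ ≤ 1 / 4 * ‖w x‖ := fun j => by
        rw [norm_mul]
        refine mul_le_mul ?_ (norm_le_pi_norm _ _) (norm_nonneg _) (by norm_num)
        exact (norm_le_pi_norm (y x - e3 b) j).trans (hX x ((le_max_left X 0).trans hx)).le
      have h4 : ‖w x b‖ ≤ 3 / 4 * ‖w x‖ := by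
        rw [h1, norm_neg]
        have := (norm_add₃_le (a := (y x 0 - e3 b 0) * w x 0) (b := (y x 1 - e3 b 1) * w x 1)
          (c := (y x 2 - e3 b 2) * w x 2))
        linarith [h3 0, h3 1, h3 2]
      rw [hib] at hi
      have h5 : ‖w x‖ = 0 := by
        have := norm_nonneg (w x)
        linarith
      -- At a zero of `w` every component attains the norm, and one different from `b` is selected.
      obtain ⟨j, hj⟩ : ∃ j, j ≠ b := exists_ne b
      refine ⟨j, ?_, hα j hj⟩
      rw [h5, norm_eq_zero.1 h5]
      simp
    · exact ⟨i, hi, hα i hib⟩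
  refine ⟨hbd, ?_⟩
  have := (hbd.tendsto_dot_sub hy.2).neg
  rw [neg_zero] at this
  refine this.congr' ?_
  filter_upwards [eventually_ge_atTop 0] with x hx
  rw [hyw x hx]
  ring

/-- For `α = λ_b` the pairing with the adjoint column is constant in `x`, and asymptotically it
equals `w_b`. -/
theorem IsSol.tendsto_of_max (hU : IsPot U) (hb : ∀ i, (lam i).re ≤ (lam b).re)
    (h : IsSol lam (lam b) U w) :
    Tendsto (fun x => w x b) atTop (𝓝 (avec lam U b ⬝ᵥ w 0)) := by
  obtain ⟨y, hy, hy0⟩ := exists_adj_isVcol hU hb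
  rw [← hy0]
  have h1 := ((h.bddHalf_of_max hU hb).tendsto_dot_sub hy.2).const_sub (y 0 ⬝ᵥ w 0)
  rw [sub_zero] at h1
  refine h1.congr' ?_
  filter_upwards [eventually_ge_atTop 0] with x hx
  rw [h.pairing hy.1 le_rfl hx]
  simp

theorem IsSol.tendsto_of_eq_vvec (hU : IsPot U) (ha : ∀ i, (lam a).re ≤ (lam i).re)
    (h : IsSol lam (lam a) U w) {γ : ℂ} (h0 : w 0 = γ • vvec lam U a) :
    Tendsto w atTop (𝓝 (γ • e3 a)) := by
  obtain ⟨u, hu, hu0⟩ := exists_isVcol hU lam ha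
  refine (hu.2.const_smul γ).congr' ?_
  filter_upwards [eventually_ge_atTop 0] with x hx
  exact (hu.1.smul γ).eq_of_zero hU h (by rw [h0, hu0]) hx

/-- The `a`-th component has exponent zero and integrable source, hence a limit `γ`. After
subtracting `γ` times the Volterra column the solution tends to `0`, and the backward estimate makes
it vanish. -/
theorem IsSol.exists_eq_smul_vvec (hU : IsPot U) (ha : ∀ i, (lam a).re ≤ (lam i).re)
    (h : IsSol lam (lam a) U w) (hw : BddHalf w)
    (hlim : ∀ i, i ≠ a → Tendsto (fun x => w x i) atTop (𝓝 0)) :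
    ∃ γ : ℂ, w 0 = γ • vvec lam U a := by
  obtain ⟨u, hu, hu0⟩ := exists_isVcol hU lam ha
  obtain ⟨C, hC⟩ := hw
  have h1 := intervalIntegral_tendsto_integral_Ioi 0 (h.integrableOn_mulVec hU hC a)
    (tendsto_id (α := ℝ) (x := atTop))
  set γ : ℂ := w 0 a + ∫ x in Ioi (0 : ℝ), (U x *ᵥ w x) a with hγ
  have h2 : Tendsto (fun x => w x a) atTop (𝓝 γ) := by
    refine (h1.const_add (w 0 a)).congr' ?_
    filter_upwards [eventually_ge_atTop 0] with x hx
    rw [scalar_duhamel (fun x hx => h x hx a) (h.continuousOn_mulVec hU a) le_rfl hx]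
    simp
  have h3 : Tendsto (fun x => w x - γ • u x) atTop (𝓝 0) := by
    rw [tendsto_pi_nhds]
    intro i
    have hui := (tendsto_apply hu.2 i).const_mul γ
    by_cases hi : i = a
    · subst hi
      simpa [e3] using h2.sub hui
    · simpa [e3, hi] using (hlim i hi).sub hui
  refine ⟨γ, ?_⟩
  have := (h.sub (hu.1.smul γ)).eq_zero_of_tendsto hU ha h3 le_rfl
  rw [← hu0]
  exact sub_eq_zero.1 this

theorem vvec_ne_zero (hU : IsPot U) (ha : ∀ i, (lam a).re ≤ (lam i).re) : vvec lam U a ≠ 0 := by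
  intro h0
  obtain ⟨u, hu, hu0⟩ := exists_isVcol hU lam ha
  have h1 := hu.1.tendsto_of_eq_vvec hU ha (γ := 0) (by rw [hu0, h0, smul_zero])
  have h2 := tendsto_nhds_unique hu.2 h1
  have := congrFun h2 a
  simp [e3] at this

theorem avec_ne_zero (hU : IsPot U) (hb : ∀ i, (lam i).re ≤ (lam b).re) : avec lam U b ≠ 0 :=
  vvec_ne_zero hU.adj fun i => by simpa using hb i

theorem avec_dot_vvec (hU : IsPot U) (ha : ∀ i, (lam a).re ≤ (lam i).re)
    (hb : ∀ i, (lam i).re ≤ (lam b).re) (hab : a ≠ b) : avec lam U b ⬝ᵥ vvec lam U a = 0 := by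
  obtain ⟨u, hu, hu0⟩ := exists_isVcol hU lam ha
  rw [← hu0]
  exact hu.1.dot_avec_eq_zero hU hb hu.bddHalf (hu.tendsto_ne hab.symm) (hb a)

/-- A bounded solution with `w_b → 0`, `w_c → 1` is determined modulo the subdominant one. -/
theorem IsSol.cross_vvec_eq (hU : IsPot U) (hlam : lam 0 + lam 1 + lam 2 = 0)
    (htr : ∀ x, U x 0 0 + U x 1 1 + U x 2 2 = 0) (T : Tri a b c ε)
    (ha : ∀ i, (lam a).re ≤ (lam i).re) (hb : ∀ i, (lam i).re ≤ (lam b).re)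
    (h : IsSol lam (lam c) U w) (hw : BddHalf w) (hwb : Tendsto (fun x => w x b) atTop (𝓝 0))
    (hwc : Tendsto (fun x => w x c) atTop (𝓝 1)) :
    w 0 ⨯₃ vvec lam U a = ε • avec lam U b := by
  obtain ⟨u, hu, hu0⟩ := exists_isVcol hU lam ha
  -- Since the exponents sum to zero, the cross product has exactly the normalization of the adjoint
  -- column with index `b`.
  have hs : lam c + lam a = -lam b := by
    have h3 : lam a + lam b + lam c = 0 := by
      have := T.dot lam (fun _ => 1)
      rw [dot_three] at this
      simp only [mul_one] at this
      rw [← this, hlam]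
    linear_combination h3
  have hc := (h.cross hlam htr hu.1).smul ε
  rw [hs] at hc
  have hua := hu.tendsto_self
  have hub := hu.tendsto_ne T.ab.symm
  have huc := hu.tendsto_ne T.ac.symm
  have hlim : Tendsto (fun x => ε • (w x ⨯₃ u x)) atTop (𝓝 (e3 b)) := by
    rw [tendsto_pi_nhds]
    intro i
    simp only [Pi.smul_apply, smul_eq_mul]
    have z1 := hw.tendsto_mul a hub
    have z2 := hw.tendsto_mul a huc
    rcases T.cover i with rfl | rfl | rfl
    · simp only [T.cross_a]
      have := ((hwb.mul huc).sub (hwc.mul hub)).const_mul (ε * ε)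
      simp only [mul_zero, sub_zero] at this
      simpa [e3, T.ab, mul_assoc] using this
    · simp only [T.cross_b]
      have := ((hwc.mul hua).sub z2).const_mul (ε * ε)
      simp only [mul_one, sub_zero, T.sq] at this
      simp only [e3, if_true]
      refine this.congr fun x => ?_
      linear_combination -(w x c * u x a - u x c * w x a) * T.sq
    · simp only [T.cross_c]
      have := (z1.sub (hwb.mul hua)).const_mul (ε * ε)
      simp only [zero_mul, sub_zero, mul_zero] at this
      simp only [e3, if_neg T.bc.symm]
      refine this.congr fun x => ?_
      ring
  have := IsVcol.zero_eq_vvec hU.adj (j := b) ⟨hc, hlim⟩ fun i => by simpa using hb i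
  rw [avec, ← this, smul_smul, T.sq, one_smul, hu0]

/-- Converse of `IsSol.cross_vvec_eq`. A cross product is orthogonal to its factors, which gives
boundedness and `w_b → 0`. By uniqueness the cross product equals the adjoint column for all `x`,
and its `b`-th component, which tends to `1`, reveals the limit of `w_c`. -/
theorem IsSol.asymptotics_of_cross (hU : IsPot U) (hlam : lam 0 + lam 1 + lam 2 = 0)
    (htr : ∀ x, U x 0 0 + U x 1 1 + U x 2 2 = 0) (T : Tri a b c ε)
    (ha : ∀ i, (lam a).re ≤ (lam i).re) (hb : ∀ i, (lam i).re ≤ (lam b).re)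
    (h : IsSol lam (lam c) U w) (h0 : w 0 ⨯₃ vvec lam U a = ε • avec lam U b) :
    BddHalf w ∧ Tendsto (fun x => w x b) atTop (𝓝 0) ∧ Tendsto (fun x => w x c) atTop (𝓝 1) := by
  obtain ⟨u, hu, hu0⟩ := exists_isVcol hU lam ha
  obtain ⟨y, hy, hy0⟩ := exists_adj_isVcol hU hb
  have h0' : avec lam U b = ε • (w 0 ⨯₃ vvec lam U a) := by
    rw [h0, smul_smul, T.sq, one_smul]
  have hdot : avec lam U b ⬝ᵥ w 0 = 0 := by
    rw [h0', smul_dotProduct, dotProduct_comm, dot_self_cross, smul_zero]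
  have hα : ∀ i, i ≠ b → (lam i).re ≤ (lam c).re := by
    intro i hi
    rcases T.cover i with rfl | rfl | rfl
    · exact ha c
    · exact absurd rfl hi
    · exact le_rfl
  obtain ⟨hbd, hwb⟩ := h.bddHalf_and_tendsto_of_dot hU hb hα hdot
  refine ⟨hbd, hwb, ?_⟩
  have hs : lam c + lam a = -lam b := by
    have h3 : lam a + lam b + lam c = 0 := by
      have := T.dot lam (fun _ => 1)
      rw [dot_three] at this
      simp only [mul_one] at this
      rw [← this, hlam]
    linear_combination h3
  have hc := (h.cross hlam htr hu.1).smul ε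
  rw [hs] at hc
  have heq : ∀ x, 0 ≤ x → ε • (w x ⨯₃ u x) = y x := fun x hx =>
    hc.eq_of_zero hU.adj hy.1 (by rw [hy0, h0', hu0]) hx
  have h1 : Tendsto (fun x => w x c * u x a - w x a * u x c) atTop (𝓝 1) := by
    refine hy.tendsto_self.congr' ?_
    filter_upwards [eventually_ge_atTop 0] with x hx
    rw [← heq x hx, Pi.smul_apply, smul_eq_mul, T.cross_b]
    linear_combination (w x c * u x a - w x a * u x c) * T.sq
  have h2 := hbd.tendsto_mul a (hu.tendsto_ne T.ac.symm)
  have h3 : Tendsto (fun x => (u x a - 1) * w x c) atTop (𝓝 0) :=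
    hbd.tendsto_mul c (by simpa using hu.tendsto_self.sub_const 1)
  have h4 := (h1.add h2).sub h3
  simp only [add_zero, sub_zero] at h4
  refine h4.congr fun x => ?_
  ring

/-- Relevant on rays where two exponents share the minimal real part: both columns then exist, and
one of them serves as the bounded solution in `IsSol.cross_vvec_eq`. -/
theorem vvec_cross_vvec (hU : IsPot U) (hlam : lam 0 + lam 1 + lam 2 = 0)
    (htr : ∀ x, U x 0 0 + U x 1 1 + U x 2 2 = 0) (T : Tri a b c ε)
    (ha : ∀ i, (lam a).re ≤ (lam i).re) (hc : ∀ i, (lam c).re ≤ (lam i).re)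
    (hb : ∀ i, (lam i).re ≤ (lam b).re) :
    vvec lam U c ⨯₃ vvec lam U a = ε • avec lam U b := by
  obtain ⟨u, hu, hu0⟩ := exists_isVcol hU lam hc
  rw [← hu0]
  exact hu.1.cross_vvec_eq hU hlam htr T ha hb hu.bddHalf (hu.tendsto_ne T.bc) hu.tendsto_self

/-- The dual identity, obtained from the adjoint system because taking the adjoint twice returns the
original potential. -/
theorem avec_cross_avec (hU : IsPot U) (hlam : lam 0 + lam 1 + lam 2 = 0)
    (htr : ∀ x, U x 0 0 + U x 1 1 + U x 2 2 = 0) (T : Tri a b c ε)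
    (ha : ∀ i, (lam i).re ≤ (lam a).re) (hc : ∀ i, (lam i).re ≤ (lam c).re)
    (hb : ∀ i, (lam b).re ≤ (lam i).re) :
    avec lam U c ⨯₃ avec lam U a = ε • vvec lam U b := by
  have := vvec_cross_vvec (lam := fun i => -lam i) hU.adj (by linear_combination -hlam)
    (fun x => by
      simp only [adjPot, Matrix.neg_apply, Matrix.transpose_apply]
      linear_combination -htr x) T (fun i => by simpa using ha i) (fun i => by simpa using hc i)
      (fun i => by simpa using hb i)
  rw [avec_adj] at this
  exact this

end Asymptotics

/-! ### The zero curvature condition -/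

theorem om_rel : om ^ 2 + om + 1 = 0 := by
  have h3 : om ^ 3 = 1 := by
    rw [om, ← Complex.exp_nat_mul]
    rw [show ((3 : ℕ) : ℂ) * (2 * Real.pi * I / 3) = 2 * Real.pi * I by push_cast; ring]
    exact Complex.exp_two_pi_mul_I
  have h1 : om ≠ 1 := by
    intro h
    have h2 : om.re = -(1 / 2) := by
      rw [om, show (2 * Real.pi * I / 3 : ℂ) = ((2 * Real.pi / 3 : ℝ) : ℂ) * I by push_cast; ring,
        Complex.exp_ofReal_mul_I_re,
        show (2 * Real.pi / 3 : ℝ) = Real.pi - Real.pi / 3 by ring, Real.cos_pi_sub,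
        Real.cos_pi_div_three]
    rw [h] at h2
    norm_num at h2
  have : (om - 1) * (om ^ 2 + om + 1) = 0 := by linear_combination h3
  exact (mul_eq_zero.1 this).resolve_left (sub_ne_zero.2 h1)

theorem om_eq : om = -(1 / 2) + (Real.sqrt 3 : ℂ) / 2 * I := by
  rw [om, show (2 * Real.pi * I / 3 : ℂ) = ((2 * Real.pi / 3 : ℝ) : ℂ) * I by push_cast; ring,
    Complex.exp_mul_I, ← Complex.ofReal_cos, ← Complex.ofReal_sin,
    show (2 * Real.pi / 3 : ℝ) = Real.pi - Real.pi / 3 by ring, Real.cos_pi_sub, Real.sin_pi_sub,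
    Real.cos_pi_div_three, Real.sin_pi_div_three]
  push_cast
  ring

theorem sqrt_three_sq : (Real.sqrt 3 : ℂ) ^ 2 = 3 := by
  rw [← Complex.ofReal_pow, Real.sq_sqrt (by norm_num)]
  norm_num

theorem I_div_sqrt : I / (Real.sqrt 3 : ℂ) = (1 + 2 * om) / 3 := by
  rw [om_eq]
  field_simp
  linear_combination (-I) * sqrt_three_sq

theorem lx_sum (k : ℂ) : lx k 0 + lx k 1 + lx k 2 = 0 := by
  simp [lx]
  linear_combination k * om_rel

theorem zt_sum (k : ℂ) : zt k 0 + zt k 1 + zt k 2 = 0 := by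
  simp [zt, lx]
  linear_combination (-(k ^ 2) * (om ^ 2 - om + 1)) * om_rel

/-- The `x`-derivative of `V₂`. -/
noncomputable def laxV2x (q r qx rx qxx rxx k : ℂ) : Mat3 :=
  k • !![0, om * qx, om ^ 2 * rx; om * rx, 0, qx; om ^ 2 * qx, rx, 0]
    + (I / (Real.sqrt 3 : ℂ)) • !![0, qxx, -rxx; -rxx, 0, qxx; qxx, -rxx, 0]
    - !![0, 2 * r * rx, 2 * q * qx; 2 * q * qx, 0, 2 * r * rx; 2 * r * rx, 2 * q * qx, 0]

theorem diagonal_three (v : V3) :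
    (Matrix.diagonal v : Mat3) = !![v 0, 0, 0; 0, v 1, 0; 0, 0, v 2] := by
  ext i j
  fin_cases i <;> fin_cases j <;> simp

/-- Solving the evolution equations for `q_t`, `r_t` and writing `i/√3 = (1 + 2ω)/3` leaves a
polynomial identity modulo `ω² + ω + 1 = 0`, checked entry by entry. -/
theorem zero_curvature {k q r qx rx qxx rxx qt rt : ℂ}
    (hq : I * qt + (1 / (Real.sqrt 3 : ℂ)) * qxx + 2 * I * r * rx = 0)
    (hr : I * rt - (1 / (Real.sqrt 3 : ℂ)) * rxx + 2 * I * q * qx = 0) :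
    laxV2x q r qx rx qxx rxx k
      + (Matrix.diagonal (zt k) + laxV2 q r qx rx k) * (Matrix.diagonal (lx k) + laxV1 q r)
      = (Matrix.diagonal (lx k) + laxV1 q r) * (Matrix.diagonal (zt k) + laxV2 q r qx rx k)
        + laxV1 qt rt := by
  have hI := Complex.I_mul_I
  have hq' : qt = (1 + 2 * om) / 3 * qxx - 2 * r * rx := by
    rw [← I_div_sqrt]
    linear_combination (-I) * hq + (qt + 2 * r * rx) * hI
  have hr' : rt = -((1 + 2 * om) / 3 * rxx) - 2 * q * qx := by
    rw [← I_div_sqrt]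
    linear_combination (-I) * hr + (rt + 2 * q * qx) * hI
  have ho := om_rel
  clear hq hr hI
  subst hq' hr'
  unfold laxV2x laxV2 laxV1
  rw [I_div_sqrt, diagonal_three, diagonal_three]
  have h0 : lx k 0 = k := rfl
  have h1 : lx k 1 = om ^ 2 * k := rfl
  have h2 : lx k 2 = om * k := rfl
  simp only [zt, h0, h1, h2]
  generalize om = o at *
  clear h0 h1 h2
  ext i j
  fin_cases i <;> fin_cases j <;>
    simp <;> grind

/-! ### Regularity on the closed quarter plane -/

/-- The closed quarter plane. -/
def quarter : Set (ℝ × ℝ) := Ici 0 ×ˢ Ici 0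

/-- `f` is of class `C^n` on the closed quarter plane. -/
def QuarterC (n : ℕ∞) (f : ℝ → ℝ → ℂ) : Prop :=
  ContDiffOn ℝ n (fun p : ℝ × ℝ => f p.1 p.2) quarter

theorem uniqueDiffOn_quarter : UniqueDiffOn ℝ quarter :=
  (uniqueDiffOn_Ici 0).prod (uniqueDiffOn_Ici 0)

section Regularity

variable {f : ℝ → ℝ → ℂ}

theorem QuarterC.continuousOn {n : ℕ∞} (h : QuarterC n f) :
    ContinuousOn (fun p : ℝ × ℝ => f p.1 p.2) quarter := ContDiffOn.continuousOn h

theorem QuarterC.hasDerivWithinAt_x (h : QuarterC 1 f) {x t : ℝ} (hx : 0 ≤ x) (ht : 0 ≤ t) :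
    HasDerivWithinAt (fun y => f y t)
      (fderivWithin ℝ (fun p : ℝ × ℝ => f p.1 p.2) quarter (x, t) (1, 0)) (Ici 0) x := by
  have h1 := (ContDiffOn.differentiableOn h (by simp) (x, t) ⟨hx, ht⟩).hasFDerivWithinAt
  have h2 : HasDerivWithinAt (fun y : ℝ => (y, t)) ((1 : ℝ), (0 : ℝ)) (Ici 0) x :=
    ((hasDerivAt_id x).prodMk (hasDerivAt_const x t)).hasDerivWithinAt
  exact h1.comp_hasDerivWithinAt x h2
    (show MapsTo (fun y : ℝ => (y, t)) (Ici 0) quarter from fun y hy => ⟨hy, ht⟩)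

theorem QuarterC.hasDerivWithinAt_t (h : QuarterC 1 f) {x t : ℝ} (hx : 0 ≤ x) (ht : 0 ≤ t) :
    HasDerivWithinAt (fun τ => f x τ)
      (fderivWithin ℝ (fun p : ℝ × ℝ => f p.1 p.2) quarter (x, t) (0, 1)) (Ici 0) t := by
  have h1 := (ContDiffOn.differentiableOn h (by simp) (x, t) ⟨hx, ht⟩).hasFDerivWithinAt
  have h2 : HasDerivWithinAt (fun τ : ℝ => (x, τ)) ((0 : ℝ), (1 : ℝ)) (Ici 0) t :=
    ((hasDerivAt_const t x).prodMk (hasDerivAt_id t)).hasDerivWithinAt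
  exact h1.comp_hasDerivWithinAt t h2
    (show MapsTo (fun τ : ℝ => (x, τ)) (Ici 0) quarter from fun y hy => ⟨hx, hy⟩)

theorem QuarterC.pdx_eq (h : QuarterC 1 f) {x t : ℝ} (hx : 0 ≤ x) (ht : 0 ≤ t) :
    pdx f x t = fderivWithin ℝ (fun p : ℝ × ℝ => f p.1 p.2) quarter (x, t) (1, 0) :=
  (h.hasDerivWithinAt_x hx ht).derivWithin (uniqueDiffOn_Ici 0 x hx)

theorem QuarterC.pdt_eq (h : QuarterC 1 f) {x t : ℝ} (hx : 0 ≤ x) (ht : 0 ≤ t) :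
    pdt f x t = fderivWithin ℝ (fun p : ℝ × ℝ => f p.1 p.2) quarter (x, t) (0, 1) :=
  (h.hasDerivWithinAt_t hx ht).derivWithin (uniqueDiffOn_Ici 0 t ht)

theorem QuarterC.hasDeriv_x (h : QuarterC 1 f) {x t : ℝ} (hx : 0 ≤ x) (ht : 0 ≤ t) :
    HasDerivWithinAt (fun y => f y t) (pdx f x t) (Ici 0) x := by
  rw [h.pdx_eq hx ht]
  exact h.hasDerivWithinAt_x hx ht

theorem QuarterC.hasDeriv_t (h : QuarterC 1 f) {x t : ℝ} (hx : 0 ≤ x) (ht : 0 ≤ t) :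
    HasDerivWithinAt (fun τ => f x τ) (pdt f x t) (Ici 0) t := by
  rw [h.pdt_eq hx ht]
  exact h.hasDerivWithinAt_t hx ht

theorem QuarterC.pdx_continuousOn (h : QuarterC 1 f) :
    ContinuousOn (fun p : ℝ × ℝ => pdx f p.1 p.2) quarter := by
  refine ((ContDiffOn.continuousOn_fderivWithin h uniqueDiffOn_quarter (by simp)).clm_apply
    (continuousOn_const (c := ((1 : ℝ), (0 : ℝ))))).congr fun p hp => ?_
  exact h.pdx_eq hp.1 hp.2

theorem QuarterC.pdt_continuousOn (h : QuarterC 1 f) :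
    ContinuousOn (fun p : ℝ × ℝ => pdt f p.1 p.2) quarter := by
  refine ((ContDiffOn.continuousOn_fderivWithin h uniqueDiffOn_quarter (by simp)).clm_apply
    (continuousOn_const (c := ((0 : ℝ), (1 : ℝ))))).congr fun p hp => ?_
  exact h.pdt_eq hp.1 hp.2

theorem QuarterC.one (h : QuarterC 2 f) : QuarterC 1 f := ContDiffOn.of_le h (by norm_num)

theorem QuarterC.pdx (h : QuarterC 2 f) : QuarterC 1 (pdx f) := by
  have h1 : ContDiffOn ℝ 1 (fderivWithin ℝ (fun p : ℝ × ℝ => f p.1 p.2) quarter) quarter :=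
    ContDiffOn.fderivWithin h uniqueDiffOn_quarter (by norm_num)
  refine (h1.clm_apply (contDiffOn_const (c := ((1 : ℝ), (0 : ℝ))))).congr fun p hp => ?_
  exact h.one.pdx_eq hp.1 hp.2

/-! ### Extension from the quarter plane, smooth enough for parameter differentiation in `t` -/

/-- Clipping to the half-line. -/
noncomputable def clip (x : ℝ) : ℝ := max x 0

theorem clip_nonneg (x : ℝ) : 0 ≤ clip x := le_max_right _ _

theorem clip_of_nonneg {x : ℝ} (hx : 0 ≤ x) : clip x = x := max_eq_left hx

theorem continuous_clip : Continuous clip := by unfold clip; fun_prop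

theorem continuous_clip_clip (hf : ContinuousOn (fun p : ℝ × ℝ => f p.1 p.2) quarter) :
    Continuous fun p : ℝ × ℝ => f (clip p.1) (clip p.2) :=
  hf.comp_continuous (f := fun p : ℝ × ℝ => (clip p.1, clip p.2))
    ((continuous_clip.comp continuous_fst).prodMk (continuous_clip.comp continuous_snd))
    fun _ => ⟨clip_nonneg _, clip_nonneg _⟩

/-- An extension of `f` to the plane which is continuously differentiable in `t`. -/
noncomputable def text (f : ℝ → ℝ → ℂ) (x t : ℝ) : ℂ :=
  f (clip x) 0 + ∫ s in (0 : ℝ)..t, pdt f (clip x) (clip s)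

theorem QuarterC.continuous_pdt_clip (h : QuarterC 1 f) (x : ℝ) :
    Continuous fun s => pdt f (clip x) (clip s) :=
  (continuous_clip_clip h.pdt_continuousOn).comp (by fun_prop : Continuous fun s : ℝ => (x, s))

theorem QuarterC.text_eq (h : QuarterC 1 f) {x t : ℝ} (hx : 0 ≤ x) (ht : 0 ≤ t) :
    text f x t = f x t := by
  have := intervalIntegral.integral_eq_sub_of_hasDeriv_right (f := fun s => f x s)
    (f' := fun s => pdt f (clip x) (clip s)) (a := 0) (b := t)
    (fun s hs => by
      rw [uIcc_of_le ht] at hs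
      exact ((h.hasDeriv_t hx hs.1).continuousWithinAt).mono fun z hz => by
        rw [uIcc_of_le ht] at hz; exact hz.1)
    (fun s hs => by
      rw [min_eq_left ht] at hs
      rw [clip_of_nonneg hx, clip_of_nonneg hs.1.le]
      exact (h.hasDeriv_t hx hs.1.le).mono fun z hz => hs.1.le.trans (le_of_lt hz))
    ((h.continuous_pdt_clip x).intervalIntegrable _ _)
  rw [text, this, clip_of_nonneg hx]
  ring

theorem continuous_integral_param' {f : ℝ → ℝ → ℂ} (hf : Continuous fun p : ℝ × ℝ => f p.1 p.2) :
    Continuous fun p : ℝ × ℝ => ∫ s in (0 : ℝ)..p.2, f p.1 s :=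
  intervalIntegral.continuous_parametric_intervalIntegral_of_continuous
    (f := fun (z : ℝ × ℝ) s => f z.1 s)
    (hf.comp ((continuous_fst.comp continuous_fst).prodMk continuous_snd)) continuous_snd

theorem QuarterC.continuous_text (h : QuarterC 1 f) :
    Continuous fun p : ℝ × ℝ => text f p.1 p.2 := by
  refine Continuous.add ?_ (continuous_integral_param'
    (f := fun x s => pdt f (clip x) (clip s)) (continuous_clip_clip h.pdt_continuousOn))
  have := (continuous_clip_clip h.continuousOn).comp
    (by fun_prop : Continuous fun p : ℝ × ℝ => (p.1, (0 : ℝ)))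
  simpa [Function.comp_def, clip_of_nonneg le_rfl] using this

/-- The divided difference in `t` of `text f`. -/
noncomputable def textSlope (f : ℝ → ℝ → ℂ) (t₀ t x : ℝ) : ℂ :=
  ∫ s in (0 : ℝ)..1, pdt f (clip x) (clip (t₀ + (t - t₀) * s))

theorem QuarterC.continuous_textSlope (h : QuarterC 1 f) (t₀ : ℝ) :
    Continuous fun p : ℝ × ℝ => textSlope f t₀ p.1 p.2 := by
  refine intervalIntegral.continuous_parametric_intervalIntegral_of_continuous'
    (f := fun (p : ℝ × ℝ) s => pdt f (clip p.2) (clip (t₀ + (p.1 - t₀) * s))) ?_ 0 1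
  exact (continuous_clip_clip h.pdt_continuousOn).comp
    (by fun_prop : Continuous fun z : (ℝ × ℝ) × ℝ => (z.1.2, t₀ + (z.1.1 - t₀) * z.2))

/-- Substituting `s ↦ t₀ + (t - t₀)s` in the defining integral exhibits a divided difference that is
continuous also at `t = t₀`, as `hasDerivAt_param` requires. -/
theorem QuarterC.text_sub (h : QuarterC 1 f) (t₀ t x : ℝ) :
    text f x t - text f x t₀ = (t - t₀) • textSlope f t₀ t x := by
  have h1 := intervalIntegral.smul_integral_comp_add_mul (a := 0) (b := 1)
    (fun s => pdt f (clip x) (clip s)) (t - t₀) t₀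
  simp only [mul_zero, add_zero, mul_one, add_sub_cancel] at h1
  rw [textSlope, h1, text, text, add_sub_add_left_eq_sub,
    intervalIntegral.integral_interval_sub_left
      ((h.continuous_pdt_clip x).intervalIntegrable _ _)
      ((h.continuous_pdt_clip x).intervalIntegrable _ _)]

theorem textSlope_self {x t : ℝ} (hx : 0 ≤ x) (ht : 0 ≤ t) : textSlope f t t x = pdt f x t := by
  simp [textSlope, clip_of_nonneg hx, clip_of_nonneg ht]

end Regularity

/-! ### Solutions of the Lax pair -/

section Lax

variable {q r : ℝ → ℝ → ℂ}

theorem IsHalfLineSolution.q2 (h : IsHalfLineSolution q r) : QuarterC 2 q := h.smooth_q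

theorem IsHalfLineSolution.r2 (h : IsHalfLineSolution q r) : QuarterC 2 r := h.smooth_r

/-- The open quarter plane is dense in the closed one. The evolution equations, assumed in the
interior, thereby extend to both axes. -/
theorem eqOn_quarter {g g' : ℝ × ℝ → ℂ} (hg : ContinuousOn g quarter) (hg' : ContinuousOn g' quarter)
    (h : ∀ x t, 0 < x → 0 < t → g (x, t) = g' (x, t)) {x t : ℝ} (hx : 0 ≤ x) (ht : 0 ≤ t) :
    g (x, t) = g' (x, t) := by
  have h1 : EqOn g g' (Ioi 0 ×ˢ Ioi 0) := fun p hp => h p.1 p.2 hp.1 hp.2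
  have h2 : quarter ⊆ closure (Ioi (0 : ℝ) ×ˢ Ioi (0 : ℝ)) := by
    rw [closure_prod_eq, closure_Ioi]
    rfl
  exact h1.of_subset_closure hg hg' (prod_mono Ioi_subset_Ici_self Ioi_subset_Ici_self) h2
    ⟨hx, ht⟩

theorem IsHalfLineSolution.eq_q' (h : IsHalfLineSolution q r) {x t : ℝ} (hx : 0 ≤ x) (ht : 0 ≤ t) :
    I * pdt q x t + (1 / (Real.sqrt 3 : ℂ)) * pdx (pdx q) x t + 2 * I * r x t * pdx r x t = 0 := by
  refine eqOn_quarter (g := fun p => I * pdt q p.1 p.2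
    + (1 / (Real.sqrt 3 : ℂ)) * pdx (pdx q) p.1 p.2 + 2 * I * r p.1 p.2 * pdx r p.1 p.2)
    (g' := fun _ => 0) ?_ continuousOn_const (fun x t => h.eq_q x t) hx ht
  have h1 := h.q2.one.pdt_continuousOn
  have h2 := h.q2.pdx.pdx_continuousOn
  have h3 := h.r2.continuousOn
  have h4 := h.r2.one.pdx_continuousOn
  exact ((continuousOn_const.mul h1).add (continuousOn_const.mul h2)).add
    ((continuousOn_const.mul h3).mul h4)

theorem IsHalfLineSolution.eq_r' (h : IsHalfLineSolution q r) {x t : ℝ} (hx : 0 ≤ x) (ht : 0 ≤ t) :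
    I * pdt r x t - (1 / (Real.sqrt 3 : ℂ)) * pdx (pdx r) x t + 2 * I * q x t * pdx q x t = 0 := by
  refine eqOn_quarter (g := fun p => I * pdt r p.1 p.2
    - (1 / (Real.sqrt 3 : ℂ)) * pdx (pdx r) p.1 p.2 + 2 * I * q p.1 p.2 * pdx q p.1 p.2)
    (g' := fun _ => 0) ?_ continuousOn_const (fun x t => h.eq_r x t) hx ht
  have h1 := h.r2.one.pdt_continuousOn
  have h2 := h.r2.pdx.pdx_continuousOn
  have h3 := h.q2.continuousOn
  have h4 := h.q2.one.pdx_continuousOn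
  exact ((continuousOn_const.mul h1).sub (continuousOn_const.mul h2)).add
    ((continuousOn_const.mul h3).mul h4)

theorem continuous_laxV1 {X : Type*} [TopologicalSpace X] {f g : X → ℂ} (hf : Continuous f)
    (hg : Continuous g) : Continuous fun x => laxV1 (f x) (g x) := by
  refine continuous_matrix fun i j => ?_
  fin_cases i <;> fin_cases j <;> simp [laxV1] <;> first | exact continuous_const | assumption

theorem continuousOn_laxV2 {X : Type*} [TopologicalSpace X] {s : Set X} {f g f' g' : X → ℂ} {k : ℂ}
    (hf : ContinuousOn f s) (hg : ContinuousOn g s) (hf' : ContinuousOn f' s)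
    (hg' : ContinuousOn g' s) :
    ContinuousOn (fun x => laxV2 (f x) (g x) (f' x) (g' x) k) s := by
  refine continuousOn_pi.2 fun i => continuousOn_pi.2 fun j => ?_
  fin_cases i <;> fin_cases j <;> simp [laxV2] <;> fun_prop

theorem hasDerivAt_laxV2 {f g f' g' : ℝ → ℂ} {k qx rx qxx rxx : ℂ} {x : ℝ}
    (hf : HasDerivAt f qx x) (hg : HasDerivAt g rx x) (hf' : HasDerivAt f' qxx x)
    (hg' : HasDerivAt g' rxx x) (i j : Fin 3) :
    HasDerivAt (fun y => laxV2 (f y) (g y) (f' y) (g' y) k i j)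
      (laxV2x (f x) (g x) qx rx qxx rxx k i j) x := by
  have hf2 := hf.pow 2
  have hg2 := hg.pow 2
  have key : ∀ (a b c d : ℂ) , HasDerivAt (fun y => k * (a * f y) + k * (b * g y)
      + I / (Real.sqrt 3 : ℂ) * (c * f' y) + I / (Real.sqrt 3 : ℂ) * (d * g' y))
      (k * (a * qx) + k * (b * rx) + I / (Real.sqrt 3 : ℂ) * (c * qxx)
        + I / (Real.sqrt 3 : ℂ) * (d * rxx)) x := fun a b c d =>
    ((((hf.const_mul a).const_mul k).add ((hg.const_mul b).const_mul k)).add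
      ((hf'.const_mul c).const_mul _)).add ((hg'.const_mul d).const_mul _)
  fin_cases i <;> fin_cases j <;> simp only [laxV2, laxV2x]
  · simpa using hasDerivAt_const x (0 : ℂ)
  · exact (((key om 0 1 0).sub hg2).congr_of_eventuallyEq (Eventually.of_forall fun y => by simp)).congr_deriv (by simp)
  · exact (((key 0 (om ^ 2) 0 (-1)).sub hf2).congr_of_eventuallyEq (Eventually.of_forall fun y => by simp)).congr_deriv (by simp)
  · exact (((key 0 om 0 (-1)).sub hf2).congr_of_eventuallyEq (Eventually.of_forall fun y => by simp)).congr_deriv (by simp)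
  · simpa using hasDerivAt_const x (0 : ℂ)
  · exact (((key 1 0 1 0).sub hg2).congr_of_eventuallyEq (Eventually.of_forall fun y => by simp)).congr_deriv (by simp)
  · exact (((key (om ^ 2) 0 1 0).sub hg2).congr_of_eventuallyEq (Eventually.of_forall fun y => by simp)).congr_deriv (by simp)
  · exact (((key 0 1 0 (-1)).sub hf2).congr_of_eventuallyEq (Eventually.of_forall fun y => by simp)).congr_deriv (by simp)
  · simpa using hasDerivAt_const x (0 : ℂ)

end Lax

theorem differentiable_lx : Differentiable ℂ lx := by
  rw [differentiable_pi]
  intro i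
  fin_cases i <;> simp [lx] <;> fun_prop

theorem differentiable_zt : Differentiable ℂ zt := by
  rw [differentiable_pi]
  exact fun i => ((differentiable_pi.1 differentiable_lx i).pow 2).neg

theorem hasDerivAt_mulVec {M : ℝ → Mat3} {M' : Mat3} {w : ℝ → V3} {w' : V3} {x : ℝ}
    (hM : ∀ i j, HasDerivAt (fun y => M y i j) (M' i j) x) (hw : HasDerivAt w w' x) :
    HasDerivAt (fun y => M y *ᵥ w y) (M' *ᵥ w x + M x *ᵥ w') x := by
  rw [hasDerivAt_pi]
  intro i
  have hw' := hasDerivAt_pi.1 hw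
  have := (((hM i 0).mul (hw' 0)).add ((hM i 1).mul (hw' 1))).add ((hM i 2).mul (hw' 2))
  refine (this.congr_of_eventuallyEq (Eventually.of_forall fun y => ?_)).congr_deriv ?_
  · simp [mulVec_three]
  · simp only [Pi.add_apply, mulVec_three]
    ring

theorem continuousOn_mulVec {X : Type*} [TopologicalSpace X] {s : Set X} {M : X → Mat3}
    {w : X → V3} (hM : ContinuousOn M s) (hw : ContinuousOn w s) :
    ContinuousOn (fun y => M y *ᵥ w y) s := by
  have h4 : Continuous fun z : Mat3 × V3 => z.1 *ᵥ z.2 :=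
    Continuous.matrix_mulVec continuous_fst continuous_snd
  exact h4.comp_continuousOn (hM.prodMk hw)

/-! ### Joint solvability of the two parts of the Lax pair -/

section LaxFlow

variable {q r : ℝ → ℝ → ℂ}

/-- The `t`-part of the Lax pair at `x = 0`, for vanishing Dirichlet data. -/
noncomputable def bPot (q r : ℝ → ℝ → ℂ) (t : ℝ) : Mat3 := fieldV2 q r 0 (clip t) 0

/-- The `x`-part of the Lax pair at `t = 0`. -/
noncomputable def iPot (q r : ℝ → ℝ → ℂ) (t x : ℝ) : Mat3 := fieldV1 q r (clip x) (clip t)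

/-- The Dirichlet data vanish. -/
def ZeroDirichlet (q r : ℝ → ℝ → ℂ) : Prop := ∀ t, 0 ≤ t → q 0 t = 0 ∧ r 0 t = 0

/-- The coefficient of `k` in `V₂` involves only `q` and `r`, which vanish at `x = 0`. This is the
source of the evenness of `S` in `k`. -/
theorem fieldV2_zero (hd : ZeroDirichlet q r) {t : ℝ} (ht : 0 ≤ t) (k : ℂ) :
    fieldV2 q r 0 t k = bPot q r t := by
  simp [bPot, fieldV2, laxV2, clip_of_nonneg ht, (hd t ht).1, (hd t ht).2]

theorem IsHalfLineSolution.continuousOn_fieldV2 (h : IsHalfLineSolution q r) (k : ℂ) :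
    ContinuousOn (fun p : ℝ × ℝ => fieldV2 q r p.1 p.2 k) quarter :=
  continuousOn_laxV2 h.q2.continuousOn h.r2.continuousOn h.q2.one.pdx_continuousOn
    h.r2.one.pdx_continuousOn

theorem IsHalfLineSolution.continuous_bPot (h : IsHalfLineSolution q r) :
    Continuous (bPot q r) :=
  (h.continuousOn_fieldV2 0).comp_continuous (f := fun t : ℝ => ((0 : ℝ), clip t))
    (continuous_const.prodMk continuous_clip) fun t => ⟨self_mem_Ici, clip_nonneg t⟩

/-- Solve the `t`-equation along `x = 0`, then the `x`-equation from each point of that axis.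
Compatibility shows that the `t`-equation remains true for `x > 0`. At each stage `k` enters only
through the diagonal, so the result is entire in `k`. -/
theorem exists_lax_flow (h : IsHalfLineSolution q r) (hd : ZeroDirichlet q r) (v : V3) :
    ∃ Ψ : ℂ → ℝ → ℝ → V3, (∀ k, Continuous fun p : ℝ × ℝ => Ψ k p.1 p.2) ∧
      (∀ k, Ψ k 0 0 = v) ∧
      (∀ k x t, 0 ≤ x → 0 ≤ t → HasDerivAt (fun y => Ψ k y t)
        ((Matrix.diagonal (lx k) + fieldV1 q r x t) *ᵥ Ψ k x t) x) ∧
      (∀ k x t, 0 ≤ x → 0 ≤ t → HasDerivAt (fun τ => Ψ k x τ)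
        ((Matrix.diagonal (zt k) + fieldV2 q r x t k) *ᵥ Ψ k x t) t) ∧
      ∀ x t, 0 ≤ x → 0 ≤ t → Differentiable ℂ fun k => Ψ k x t := by
  obtain ⟨T, hTc, hT0, hTd⟩ := exists_linear_solution (P := ℂ)
    (A := fun k t => Matrix.diagonal (zt k) + bPot q r t) (F := fun _ _ => 0) (e := fun _ => v)
    (((differentiable_zt.continuous.comp continuous_fst).matrix_diagonal).add
      (h.continuous_bPot.comp continuous_snd)) continuous_const continuous_const
  have hV : Continuous fun p : ℝ × ℝ => laxV1 (text q p.1 p.2) (text r p.1 p.2) :=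
    continuous_laxV1 h.q2.one.continuous_text h.r2.one.continuous_text
  obtain ⟨Y, hYc, hY0, hYd⟩ := exists_linear_solution (P := ℂ × ℝ)
    (A := fun p x => Matrix.diagonal (lx p.1) + laxV1 (text q x p.2) (text r x p.2))
    (F := fun _ _ => 0) (e := fun p => T p.1 p.2)
    (((differentiable_lx.continuous.comp (continuous_fst.comp continuous_fst)).matrix_diagonal).add
      (hV.comp (continuous_snd.prodMk (continuous_snd.comp continuous_fst)))) continuous_const hTc
  simp only [add_zero] at hYd hTd
  have hYd' : ∀ k x t, 0 ≤ x → 0 ≤ t → HasDerivAt (fun y => Y (k, t) y)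
      ((Matrix.diagonal (lx k) + fieldV1 q r x t) *ᵥ Y (k, t) x) x := by
    intro k x t hx ht
    have := hYd (k, t) x
    simpa only [fieldV1, h.q2.one.text_eq hx ht, h.r2.one.text_eq hx ht] using this
  refine ⟨fun k x t => Y (k, t) x, fun k => hYc.comp (by fun_prop :
    Continuous fun p : ℝ × ℝ => ((k, p.2), p.1)), fun k => (hY0 (k, 0)).trans (hT0 k), hYd',
    fun k x t hx ht => ?_, fun x t hx ht => ?_⟩
  -- Here the parameter is `t`. The candidate derivative `(Z + V₂)Y` satisfies the variational
  -- equation in `x` exactly because of the zero curvature identity.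
  · refine hasDerivAt_param (𝕜 := ℝ)
      (A := fun t x => Matrix.diagonal (lx k) + laxV1 (text q x t) (text r x t))
      (D := fun τ x => laxV1 (textSlope q t τ x) (textSlope r t τ x)) (e := T k)
      (Y := fun t x => Y (k, t) x) (p₀ := t)
      (e' := (Matrix.diagonal (zt k) + fieldV2 q r 0 t k) *ᵥ Y (k, t) 0)
      (R₀ := fun x => (Matrix.diagonal (zt k) + fieldV2 q r x t k) *ᵥ Y (k, t) x) ?_ ?_ ?_ ?_ ?_ ?_
      ?_ rfl ?_ ?_ x hx
    · exact continuous_const.add (hV.comp (by fun_prop : Continuous fun x : ℝ => (x, t)))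
    · exact continuous_laxV1 (h.q2.one.continuous_textSlope t) (h.r2.one.continuous_textSlope t)
    · intro τ y _
      simp only [add_sub_add_left_eq_sub]
      have h1 := h.q2.one.text_sub t τ y
      have h2 := h.r2.one.text_sub t τ y
      ext i j
      fin_cases i <;> fin_cases j <;> simp [laxV1] <;>
        first | simpa using h1 | simpa using h2
    · exact hYc.comp (by fun_prop : Continuous fun p : ℝ × ℝ => ((k, p.1), p.2))
    · exact fun τ => hY0 (k, τ)
    · exact fun τ y _ => hYd (k, τ) y
    · rw [hY0, fieldV2_zero hd ht]
      exact hTd k t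
    · have h1 : ContinuousOn (fun y => fieldV2 q r y t k) (Ici 0) :=
        (h.continuousOn_fieldV2 k).comp (f := fun y : ℝ => (y, t)) (by fun_prop)
          fun y hy => ⟨hy, ht⟩
      have h2 : Continuous fun y => Y (k, t) y :=
        hYc.comp (by fun_prop : Continuous fun y : ℝ => ((k, t), y))
      have h3 : ContinuousOn (fun y => Matrix.diagonal (zt k) + fieldV2 q r y t k) (Ici 0) :=
        ContinuousOn.add continuousOn_const h1
      exact continuousOn_mulVec h3 h2.continuousOn
    · intro y hy
      have hnb : Ici (0 : ℝ) ∈ 𝓝 y := Ici_mem_nhds hy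
      have d1 := (h.q2.one.hasDeriv_x hy.le ht).hasDerivAt hnb
      have d2 := (h.r2.one.hasDeriv_x hy.le ht).hasDerivAt hnb
      have d3 := (h.q2.pdx.hasDeriv_x hy.le ht).hasDerivAt hnb
      have d4 := (h.r2.pdx.hasDeriv_x hy.le ht).hasDerivAt hnb
      have hM : ∀ i j, HasDerivAt
          (fun y => (Matrix.diagonal (zt k) + fieldV2 q r y t k : Mat3) i j)
          (laxV2x (q y t) (r y t) (pdx q y t) (pdx r y t) (pdx (pdx q) y t) (pdx (pdx r) y t) k i j)
          y := fun i j => (hasDerivAt_laxV2 (k := k) d1 d2 d3 d4 i j).const_add _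
      have d5 := hasDerivAt_mulVec hM (hYd' k y t hy.le ht)
      refine d5.congr_deriv ?_
      have zc := zero_curvature (k := k) (h.eq_q' hy.le ht) (h.eq_r' hy.le ht)
      simp only [textSlope_self hy.le ht, h.q2.one.text_eq hy.le ht, h.r2.one.text_eq hy.le ht]
      simp only [fieldV1, fieldV2, Matrix.mulVec_mulVec, ← Matrix.add_mulVec]
      rw [zc]
  · have hT : Differentiable ℂ fun k => T k t :=
      differentiable_linear_solution differentiable_zt h.continuous_bPot hTc
        (fun k t _ => hTd k t) (by simp only [hT0]; fun_prop) ht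
    exact differentiable_linear_solution differentiable_lx
      (V := fun x => laxV1 (text q x t) (text r x t))
      (hV.comp (by fun_prop : Continuous fun x : ℝ => (x, t))) (Y := fun k x => Y (k, t) x)
      (hYc.comp (by fun_prop : Continuous fun p : ℂ × ℝ => ((p.1, t), p.2)))
      (fun k x _ => hYd (k, t) x) (by simp only [hY0]; exact hT) hx

end LaxFlow

/-! ### Decay and integrability of the Lax potentials -/

section Potentials

variable {q r : ℝ → ℝ → ℂ}

theorem mnorm_laxV1 (a b : ℂ) : mnorm (laxV1 a b) = 3 * (‖a‖ + ‖b‖) := by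
  simp [mnorm, laxV1, Fin.sum_univ_three]
  ring

theorem DecaysInX.integrableOn {f : ℝ → ℝ → ℂ} (hd : DecaysInX f)
    (hf : ContinuousOn (fun p : ℝ × ℝ => f p.1 p.2) quarter) {t : ℝ} (ht : 0 ≤ t) :
    IntegrableOn (fun x => f x t) (Ioi 0) := by
  obtain ⟨C, hC⟩ := hd t
  have hC0 : 0 ≤ C := by
    have := hC 0 t le_rfl ht le_rfl
    exact le_trans (by positivity) this
  refine Integrable.mono' ((integrable_inv_one_add_sq.const_mul C).integrableOn (s := Ioi 0)) ?_ ?_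
  · refine ContinuousOn.aestronglyMeasurable ?_ measurableSet_Ioi
    exact hf.comp (f := fun x : ℝ => (x, t)) (by fun_prop) fun x hx => ⟨le_of_lt (mem_Ioi.1 hx), ht⟩
  · filter_upwards [ae_restrict_mem measurableSet_Ioi] with x hx
    have hx' : (0 : ℝ) < x := hx
    have := hC x t hx'.le ht le_rfl
    rw [← div_eq_mul_inv, le_div_iff₀ (by positivity)]
    refine le_trans (mul_le_mul_of_nonneg_left ?_ (norm_nonneg _)) this
    nlinarith

theorem IsHalfLineSolution.isPot_iPot (h : IsHalfLineSolution q r) {t : ℝ} (ht : 0 ≤ t) :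
    IsPot (iPot q r t) where
  cont := by
    refine continuous_laxV1 ?_ ?_
    · exact (continuous_clip_clip h.q2.continuousOn).comp
        (by fun_prop : Continuous fun x : ℝ => (x, t))
    · exact (continuous_clip_clip h.r2.continuousOn).comp
        (by fun_prop : Continuous fun x : ℝ => (x, t))
  int := by
    have h1 := (h.decay_q.1.integrableOn h.q2.continuousOn ht).norm
    have h2 := (h.decay_r.1.integrableOn h.r2.continuousOn ht).norm
    refine IntegrableOn.congr_fun ((h1.add h2).const_mul 3) (fun x hx => ?_) measurableSet_Ioi
    simp [iPot, fieldV1, mnorm_laxV1, clip_of_nonneg (le_of_lt (mem_Ioi.1 hx)), clip_of_nonneg ht]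

theorem IsHalfLineSolution.isPot_bPot (h : IsHalfLineSolution q r) (hd : ZeroDirichlet q r) :
    IsPot (bPot q r) where
  cont := h.continuous_bPot
  int := by
    have h1 := h.neumann_q.norm
    have h2 := h.neumann_r.norm
    refine IntegrableOn.congr_fun ((h1.add h2).const_mul (3 * ‖I / (Real.sqrt 3 : ℂ)‖))
      (fun t ht => ?_) measurableSet_Ioi
    have ht' : (0 : ℝ) ≤ t := le_of_lt ht
    simp [bPot, fieldV2, laxV2, mnorm, Fin.sum_univ_three, clip_of_nonneg ht', (hd t ht').1,
      (hd t ht').2]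
    ring

theorem laxV1_trace (a b : ℂ) : laxV1 a b 0 0 + laxV1 a b 1 1 + laxV1 a b 2 2 = 0 := by
  simp [laxV1]

theorem bPot_trace (t : ℝ) : bPot q r t 0 0 + bPot q r t 1 1 + bPot q r t 2 2 = 0 := by
  simp [bPot, fieldV2, laxV2]

theorem iPot_trace (t x : ℝ) : iPot q r t x 0 0 + iPot q r t x 1 1 + iPot q r t x 2 2 = 0 :=
  laxV1_trace _ _

theorem iPot_eq {x t : ℝ} (hx : 0 ≤ x) (ht : 0 ≤ t) : iPot q r t x = fieldV1 q r x t := by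
  simp [iPot, clip_of_nonneg hx, clip_of_nonneg ht]

theorem DecaysInX.eventually_lt {f : ℝ → ℝ → ℂ} (hd : DecaysInX f) (T : ℝ) {δ : ℝ} (hδ : 0 < δ) :
    ∃ X, 0 ≤ X ∧ ∀ x t, X ≤ x → 0 ≤ t → t ≤ T → ‖f x t‖ < δ := by
  obtain ⟨C, hC⟩ := hd T
  refine ⟨max 0 (C / δ), le_max_left _ _, fun x t hx ht htT => ?_⟩
  have hx0 : 0 ≤ x := (le_max_left _ _).trans hx
  have hx1 : C / δ ≤ x := (le_max_right _ _).trans hx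
  rw [div_le_iff₀ hδ] at hx1
  have h1 := hC x t hx0 ht htT
  by_contra! h2
  have h3 : δ * (1 + x) ^ 2 ≤ ‖f x t‖ * (1 + x) ^ 2 := by gcongr
  nlinarith [mul_nonneg hδ.le hx0, mul_nonneg hδ.le (mul_nonneg hx0 hx0)]

theorem IsHalfLineSolution.fieldV2_small (h : IsHalfLineSolution q r) (k : ℂ) (T : ℝ) {ε : ℝ}
    (hε : 0 < ε) :
    ∃ X, 0 ≤ X ∧ ∀ x t, X ≤ x → 0 ≤ t → t ≤ T → mnorm (fieldV2 q r x t k) < ε := by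
  have hc : Continuous fun p : ℂ × ℂ × ℂ × ℂ =>
      mnorm (laxV2 p.1 p.2.1 p.2.2.1 p.2.2.2 k) := by
    refine continuous_mnorm.comp (continuousOn_univ.1 ?_)
    exact continuousOn_laxV2 (by fun_prop) (by fun_prop) (by fun_prop) (by fun_prop)
  have h0 : mnorm (laxV2 0 0 0 0 k) = 0 := by
    simp [mnorm, laxV2]
  have h1 := (Metric.continuous_iff.1 hc) (0, 0, 0, 0) ε hε
  obtain ⟨δ, hδ, hδ'⟩ := h1
  obtain ⟨X₁, hX₁, H₁⟩ := h.decay_q.1.eventually_lt T hδ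
  obtain ⟨X₂, -, H₂⟩ := h.decay_r.1.eventually_lt T hδ
  obtain ⟨X₃, -, H₃⟩ := h.decay_q.2.1.eventually_lt T hδ
  obtain ⟨X₄, -, H₄⟩ := h.decay_r.2.1.eventually_lt T hδ
  refine ⟨max (max X₁ X₂) (max X₃ X₄), hX₁.trans ((le_max_left _ _).trans (le_max_left _ _)),
    fun x t hx ht htT => ?_⟩
  simp only [max_le_iff] at hx
  have := hδ' (q x t, r x t, pdx q x t, pdx r x t) (by
    simp only [Prod.dist_eq, dist_zero_right, max_lt_iff]
    exact ⟨H₁ x t hx.1.1 ht htT, H₂ x t hx.1.2 ht htT, H₃ x t hx.2.1 ht htT,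
      H₄ x t hx.2.2 ht htT⟩)
  rw [Real.dist_eq, h0, sub_zero, abs_of_nonneg (mnorm_nonneg _)] at this
  exact this

theorem IsHalfLineSolution.fieldV2_bounded (h : IsHalfLineSolution q r) (k : ℂ) (T : ℝ) :
    ∃ K, 0 ≤ K ∧ ∀ x t, 0 ≤ x → 0 ≤ t → t ≤ T → mnorm (fieldV2 q r x t k) ≤ K := by
  obtain ⟨X, -, hX⟩ := h.fieldV2_small k T one_pos
  have hc : ContinuousOn (fun p : ℝ × ℝ => mnorm (fieldV2 q r p.1 p.2 k)) (Icc 0 X ×ˢ Icc 0 T) :=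
    continuous_mnorm.comp_continuousOn ((h.continuousOn_fieldV2 k).mono
      (prod_mono Icc_subset_Ici_self Icc_subset_Ici_self))
  obtain ⟨C, hC⟩ := ((isCompact_Icc.prod isCompact_Icc).image_of_continuousOn hc).bddAbove
  refine ⟨max 1 C, zero_le_one.trans (le_max_left _ _), fun x t hx ht htT => ?_⟩
  rcases le_total X x with h1 | h1
  · exact (hX x t h1 ht htT).le.trans (le_max_left _ _)
  · exact (hC ⟨(x, t), ⟨⟨hx, h1⟩, ht, htT⟩, rfl⟩).trans (le_max_right _ _)

end Potentials

/-! ### Columns of the Lax pair -/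

/-- `w` solves the `j`-th column of the Lax pair on the closed quarter plane. -/
structure IsLaxCol (q r : ℝ → ℝ → ℂ) (k : ℂ) (j : Fin 3) (w : ℝ → ℝ → V3) : Prop where
  cont : ContinuousOn (fun p : ℝ × ℝ => w p.1 p.2) (Ici 0 ×ˢ Ici 0)
  lax_x : ∀ x t : ℝ, 0 ≤ x → 0 ≤ t → ∀ i : Fin 3,
    HasDerivWithinAt (fun y => w y t i)
      ((lx k i - lx k j) * w x t i + (fieldV1 q r x t).mulVec (w x t) i) (Ici 0) x
  lax_t : ∀ x t : ℝ, 0 ≤ x → 0 ≤ t → ∀ i : Fin 3,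
    HasDerivWithinAt (fun τ => w x τ i)
      ((zt k i - zt k j) * w x t i + (fieldV2 q r x t k).mulVec (w x t) i) (Ici 0) t

theorem IsEigenColumn.isLaxCol {q r : ℝ → ℝ → ℂ} {n : Fin 12} {k : ℂ} {j : Fin 3}
    {w : ℝ → ℝ → V3} (h : IsEigenColumn q r n j k w) : IsLaxCol q r k j w :=
  ⟨h.cont, h.lax_x, h.lax_t⟩

section LaxCol

variable {q r : ℝ → ℝ → ℂ} {k : ℂ} {j : Fin 3} {w w' : ℝ → ℝ → V3}

theorem IsLaxCol.isSol_x (hw : IsLaxCol q r k j w) {t : ℝ} (ht : 0 ≤ t) :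
    IsSol (lx k) (lx k j) (iPot q r t) fun x => w x t := fun x hx i => by
  rw [iPot_eq hx ht]
  exact hw.lax_x x t hx ht i

theorem IsLaxCol.isSol_t (hw : IsLaxCol q r k j w) (hd : ZeroDirichlet q r) :
    IsSol (zt k) (zt k j) (bPot q r) fun t => w 0 t := fun t ht i => by
  rw [← fieldV2_zero hd ht k]
  exact hw.lax_t 0 t le_rfl ht i

theorem IsLaxCol.eq (h : IsHalfLineSolution q r) (hd : ZeroDirichlet q r)
    (hw : IsLaxCol q r k j w) (hw' : IsLaxCol q r k j w') (h0 : w 0 0 = w' 0 0) {x t : ℝ}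
    (hx : 0 ≤ x) (ht : 0 ≤ t) : w x t = w' x t :=
  (hw.isSol_x ht).eq_of_zero (h.isPot_iPot ht) (hw'.isSol_x ht)
    ((hw.isSol_t hd).eq_of_zero (h.isPot_bPot hd) (hw'.isSol_t hd) h0 ht) hx

/-- `V₂` is bounded on the strip `0 ≤ t ≤ T`, so the growth factor in time is uniform in `x`. -/
theorem IsLaxCol.norm_le (h : IsHalfLineSolution q r) (hw : IsLaxCol q r k j w) (T : ℝ) :
    ∃ B, 0 ≤ B ∧ ∀ x t, 0 ≤ x → 0 ≤ t → t ≤ T → ‖w x t‖ ≤ B * ‖w x 0‖ := by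
  obtain ⟨K, hK0, hK⟩ := h.fieldV2_bounded k T
  set L := mnorm (Matrix.diagonal fun i => zt k i - zt k j) with hL
  have hL0 : 0 ≤ L := mnorm_nonneg _
  refine ⟨Real.exp ((L + K) * |T|), (Real.exp_pos _).le, fun x t hx ht htT => ?_⟩
  have hder : ∀ s, 0 ≤ s → HasDerivWithinAt (fun τ => w x τ)
      ((Matrix.diagonal fun i => zt k i - zt k j) *ᵥ w x s + fieldV2 q r x s k *ᵥ w x s)
      (Ici 0) s := fun s hs => by
    rw [hasDerivWithinAt_pi]
    intro i
    refine (hw.lax_t x s hx hs i).congr_deriv ?_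
    rw [Pi.add_apply, Matrix.mulVec_diagonal]
  have := norm_le_gronwallBound_of_norm_deriv_right_le (f := fun τ => w x τ) (δ := ‖w x 0‖)
    (K := L + K) (ε := 0) (a := 0) (b := t)
    (fun s hs => ((hder s hs.1).continuousWithinAt).mono Icc_subset_Ici_self)
    (fun s hs => (hder s hs.1).mono (Ici_subset_Ici.2 hs.1)) le_rfl
    (fun s hs => by
      rw [add_zero, add_mul]
      refine (norm_add_le _ _).trans (add_le_add (norm_mulVec_le _ _)
        ((norm_mulVec_le _ _).trans ?_))
      exact mul_le_mul_of_nonneg_right (hK x s hx hs.1 (hs.2.le.trans htT)) (norm_nonneg _))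
    t ⟨ht, le_rfl⟩
  rw [gronwallBound_ε0, sub_zero, mul_comm] at this
  refine this.trans (mul_le_mul_of_nonneg_right (Real.exp_le_exp.2 ?_) (norm_nonneg _))
  exact mul_le_mul_of_nonneg_left (htT.trans (le_abs_self T)) (by positivity)

theorem IsLaxCol.bddHalf (h : IsHalfLineSolution q r) (hw : IsLaxCol q r k j w)
    (hb : BddHalf fun x => w x 0) {t : ℝ} (ht : 0 ≤ t) : BddHalf fun x => w x t := by
  obtain ⟨B, hB0, hB⟩ := hw.norm_le h t
  obtain ⟨C, hC⟩ := hb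
  exact ⟨B * C, fun x hx => (hB x t hx ht le_rfl).trans
    (mul_le_mul_of_nonneg_left (hC x hx) hB0)⟩

/-- Far out in `x` the matrix `V₂` is uniformly small on `[0,t]`, so the time evolution becomes
diagonal. Limits in `x` need then be imposed at `t = 0` only. -/
theorem IsLaxCol.tendsto_sub (h : IsHalfLineSolution q r) (hw : IsLaxCol q r k j w)
    (hb : BddHalf fun x => w x 0) {t : ℝ} (ht : 0 ≤ t) (i : Fin 3) :
    Tendsto (fun x => w x t i - exp ((zt k i - zt k j) * (t : ℂ)) * w x 0 i) atTop (𝓝 0) := by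
  obtain ⟨B, hB0, hB⟩ := hw.norm_le h t
  obtain ⟨C, hC⟩ := hb
  have hC0 : 0 ≤ C := (norm_nonneg _).trans (hC 0 le_rfl)
  set ν := zt k i - zt k j with hν
  set E := Real.exp (|ν.re| * t) with hE
  have hE0 : 0 < E := Real.exp_pos _
  rw [Metric.tendsto_atTop]
  intro ε hε
  -- The summand `1` keeps `D` positive and makes the final bound `ε (D-1)/D` strictly smaller than
  -- `ε`.
  set D := E * (B * C) * t + 1 with hD
  have hD0 : 0 < D := by positivity
  obtain ⟨X, hX0, hX⟩ := h.fieldV2_small k t (div_pos hε hD0)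
  refine ⟨X, fun x hx => ?_⟩
  have hx0 : 0 ≤ x := hX0.trans hx
  have hg : ContinuousOn (fun τ => (fieldV2 q r x τ k *ᵥ w x τ) i) (Ici 0) := by
    have h1 : ContinuousOn (fun τ => fieldV2 q r x τ k) (Ici 0) :=
      (h.continuousOn_fieldV2 k).comp (f := fun τ : ℝ => (x, τ)) (by fun_prop)
        fun y hy => ⟨hx0, hy⟩
    have h2 : ContinuousOn (fun τ => w x τ) (Ici 0) :=
      hw.cont.comp (f := fun τ : ℝ => (x, τ)) (by fun_prop) fun y hy => ⟨hx0, hy⟩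
    exact (continuous_apply i).comp_continuousOn (continuousOn_mulVec h1 h2)
  have h1 := scalar_duhamel (f := fun τ => w x τ i) (fun τ hτ => hw.lax_t x τ hx0 hτ i) hg le_rfl ht
  rw [sub_zero] at h1
  rw [dist_zero_right, h1, add_sub_cancel_left]
  have h2 : ‖∫ τ in (0 : ℝ)..t, exp (ν * ((t - τ : ℝ) : ℂ)) * (fieldV2 q r x τ k *ᵥ w x τ) i‖
      ≤ E * (ε / D * (B * C)) * |t - 0| := by
    refine intervalIntegral.norm_integral_le_of_norm_le_const fun τ hτ => ?_
    rw [uIoc_of_le ht] at hτ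
    rw [norm_mul]
    refine mul_le_mul ?_ ?_ (norm_nonneg _) hE0.le
    · rw [norm_exp_mul_ofReal]
      refine Real.exp_le_exp.2 ?_
      refine (mul_le_mul_of_nonneg_right (le_abs_self _) (by linarith [hτ.2])).trans ?_
      exact mul_le_mul_of_nonneg_left (by linarith [hτ.1]) (abs_nonneg _)
    · refine (norm_mulVec_apply_le _ _ _).trans ?_
      refine mul_le_mul (hX x τ hx hτ.1.le hτ.2).le ?_ (norm_nonneg _) (by positivity)
      exact (hB x τ hx0 hτ.1.le hτ.2).trans (mul_le_mul_of_nonneg_left (hC x hx0) hB0)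
  refine h2.trans_lt ?_
  rw [sub_zero, abs_of_nonneg ht]
  have h3 : E * (ε / D * (B * C)) * t = ε * ((D - 1) / D) := by
    rw [hD]; field_simp; ring
  rw [h3]
  have h4 : (D - 1) / D < 1 := by rw [div_lt_one hD0]; linarith
  nlinarith

end LaxCol

/-! ### Eigenfunctions in terms of their asymptotics -/

/-- The weak form of the inequalities defining the sector `D_n`. -/
def WeakSector (n : Fin 12) (k : ℂ) : Prop := ∀ i j : Fin 3,
  (lRank n i < lRank n j → (lx k i).re ≤ (lx k j).re) ∧
  (zRank n i < zRank n j → (zt k i).re ≤ (zt k j).re)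

theorem continuous_lx_re (i : Fin 3) : Continuous fun k => (lx k i).re :=
  Complex.continuous_re.comp ((continuous_apply i).comp differentiable_lx.continuous)

theorem continuous_zt_re (i : Fin 3) : Continuous fun k => (zt k i).re :=
  Complex.continuous_re.comp ((continuous_apply i).comp differentiable_zt.continuous)

theorem weakSector_of_mem_closure {n : Fin 12} {k : ℂ} (hk : k ∈ closure (sector n)) :
    WeakSector n k := by
  have h1 : IsClosed {k | WeakSector n k} := by
    simp only [WeakSector, Set.ofPred_forall, Set.ofPred_and]
    refine isClosed_iInter fun i => isClosed_iInter fun j => IsClosed.inter ?_ ?_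
    · exact isClosed_iInter fun _ => isClosed_le (continuous_lx_re i) (continuous_lx_re j)
    · exact isClosed_iInter fun _ => isClosed_le (continuous_zt_re i) (continuous_zt_re j)
  exact closure_minimal (fun k hk i j => ⟨fun h => ((hk i j).1 h).le, fun h => ((hk i j).2 h).le⟩)
    h1 hk

theorem lRank_injective (n : Fin 12) : Function.Injective (lRank n) := by
  revert n; decide

theorem zRank_injective (n : Fin 12) : Function.Injective (zRank n) := by
  revert n; decide

theorem WeakSector.l_le {n : Fin 12} {k : ℂ} (h : WeakSector n k) {i j : Fin 3}
    (hij : lRank n i ≤ lRank n j) : (lx k i).re ≤ (lx k j).re := by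
  rcases hij.lt_or_eq with h1 | h1
  · exact (h i j).1 h1
  · rw [lRank_injective n h1]

theorem WeakSector.z_le {n : Fin 12} {k : ℂ} (h : WeakSector n k) {i j : Fin 3}
    (hij : zRank n i ≤ zRank n j) : (zt k i).re ≤ (zt k j).re := by
  rcases hij.lt_or_eq with h1 | h1
  · exact (h i j).2 h1
  · rw [zRank_injective n h1]

/-- The asymptotic and initial conditions which single out the `j`-th column of `M_n`. -/
structure EigenCond (n : Fin 12) (j : Fin 3) (w : ℝ → ℝ → V3) : Prop where
  bdd_x : BddHalf fun x => w x 0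
  lim_x : ∀ i, ¬ lRank n i < lRank n j → Tendsto (fun x => w x 0 i) atTop (𝓝 (e3 j i))
  bdd_t : BddHalf fun t => w 0 t
  lim_t : ∀ i, lRank n i < lRank n j → zRank n j ≤ zRank n i →
    Tendsto (fun t => w 0 t i) atTop (𝓝 0)
  zero : ∀ i, lRank n i < lRank n j → zRank n i < zRank n j → w 0 0 i = 0

section Eigen

variable {q r : ℝ → ℝ → ℂ} {n : Fin 12} {k : ℂ} {j : Fin 3} {w : ℝ → ℝ → V3}

theorem theta_zero_t (i j : Fin 3) (x : ℝ) (k : ℂ) :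
    theta i j x 0 k = (lx k i - lx k j) * (x : ℂ) := by simp [theta]

theorem theta_zero_x (i j : Fin 3) (t : ℝ) (k : ℂ) :
    theta i j 0 t k = (zt k i - zt k j) * (t : ℂ) := by simp [theta]

theorem IsLaxCol.integrable_x (h : IsHalfLineSolution q r) (hw : IsLaxCol q r k j w)
    {t : ℝ} (ht : 0 ≤ t) (hb : BddHalf fun x => w x t) (i : Fin 3) :
    IntegrableOn (fun y => (fieldV1 q r y t *ᵥ w y t) i) (Ioi 0) := by
  obtain ⟨C, hC⟩ := hb
  refine IntegrableOn.congr_fun ((hw.isSol_x ht).integrableOn_mulVec (h.isPot_iPot ht) hC i)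
    (fun y hy => ?_) measurableSet_Ioi
  simp only [iPot_eq (le_of_lt (mem_Ioi.1 hy)) ht]

theorem IsLaxCol.continuousOn_x (h : IsHalfLineSolution q r) (hw : IsLaxCol q r k j w)
    {t : ℝ} (ht : 0 ≤ t) (i : Fin 3) :
    ContinuousOn (fun y => (fieldV1 q r y t *ᵥ w y t) i) (Ici 0) :=
  ((hw.isSol_x ht).continuousOn_mulVec (h.isPot_iPot ht) i).congr fun y hy => by
    simp only [iPot_eq hy ht]

theorem IsLaxCol.integrable_t (h : IsHalfLineSolution q r) (hd : ZeroDirichlet q r)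
    (hw : IsLaxCol q r k j w) (hb : BddHalf fun t => w 0 t) (i : Fin 3) :
    IntegrableOn (fun τ => (fieldV2 q r 0 τ k *ᵥ w 0 τ) i) (Ioi 0) := by
  obtain ⟨C, hC⟩ := hb
  refine IntegrableOn.congr_fun ((hw.isSol_t hd).integrableOn_mulVec (h.isPot_bPot hd) hC i)
    (fun y hy => ?_) measurableSet_Ioi
  simp only [fieldV2_zero hd (le_of_lt (mem_Ioi.1 hy))]

theorem IsLaxCol.continuousOn_t (h : IsHalfLineSolution q r) (hd : ZeroDirichlet q r)
    (hw : IsLaxCol q r k j w) (i : Fin 3) :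
    ContinuousOn (fun τ => (fieldV2 q r 0 τ k *ᵥ w 0 τ) i) (Ici 0) :=
  ((hw.isSol_t hd).continuousOn_mulVec (h.isPot_bPot hd) i).congr fun y hy => by
    simp only [fieldV2_zero hd hy]

/-- Restrict the integral equation to the axis `t = 0` for the contour `γ₃`, to the axis `x = 0` for
`γ₁`, and to the corner for `γ₂`. -/
theorem IsEigenColumn.eigenCond (h : IsHalfLineSolution q r) (hd : ZeroDirichlet q r)
    (hk : WeakSector n k) (hw : IsEigenColumn q r n j k w) : EigenCond n j w where
  bdd_x := hw.bounded_x 0 le_rfl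
  lim_x := fun i hi => by
    refine scalar_tendsto_of_eq (ν := lx k i - lx k j)
      (hw.isLaxCol.integrable_x h le_rfl (hw.bounded_x 0 le_rfl) i) ?_ fun x hx => ?_
    · rw [Complex.sub_re]
      linarith [hk.l_le (not_lt.1 hi)]
    · have := hw.integral_eq x 0 hx le_rfl i
      rw [gammaInt, if_neg hi, gammaThree] at this
      simp only [theta_zero_t] at this
      rw [this, sub_eq_add_neg]
      rfl
  bdd_t := hw.bounded_t
  lim_t := fun i hi hz => by
    refine scalar_tendsto_of_eq (ν := zt k i - zt k j)
      (hw.isLaxCol.integrable_t h hd hw.bounded_t i) ?_ fun t ht => ?_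
    · rw [Complex.sub_re]
      linarith [hk.z_le hz]
    · have := hw.integral_eq 0 t le_rfl ht i
      have hij : i ≠ j := by rintro rfl; exact lt_irrefl _ hi
      rw [gammaInt, if_pos hi, if_pos hz, gammaOne, if_neg hij] at this
      simp only [theta_zero_x, intervalIntegral.integral_same, add_zero, zero_add] at this
      rw [this, zero_sub]
  zero := fun i hi hz => by
    have := hw.integral_eq 0 0 le_rfl le_rfl i
    have hij : i ≠ j := by rintro rfl; exact lt_irrefl _ hi
    rw [gammaInt, if_pos hi, if_neg (not_le.2 hz), gammaTwo, if_neg hij] at this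
    simpa using this

/-- Duhamel's formula along the edges of each contour reproduces the integrals; the conditions on
the axes supply the missing boundary terms. -/
theorem IsLaxCol.isEigenColumn (h : IsHalfLineSolution q r) (hd : ZeroDirichlet q r)
    (hk : WeakSector n k) (hw : IsLaxCol q r k j w) (hc : EigenCond n j w) :
    IsEigenColumn q r n j k w where
  cont := hw.cont
  bounded_x := fun t ht => hw.bddHalf h hc.bdd_x ht
  bounded_t := hc.bdd_t
  lax_x := hw.lax_x
  lax_t := hw.lax_t
  integral_eq := fun x t hx ht i => by
    have hxd := scalar_duhamel (f := fun y => w y t i) (fun y hy => hw.lax_x y t hy ht i)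
      (hw.continuousOn_x h ht i) le_rfl hx
    rw [sub_zero] at hxd
    have hθ : ∀ s : ℝ, exp (theta i j x s k)
        = exp ((lx k i - lx k j) * (x : ℂ)) * exp ((zt k i - zt k j) * (s : ℂ)) := fun s => by
      rw [theta, Complex.exp_add]
    by_cases hi : lRank n i < lRank n j
    · have hij : i ≠ j := by rintro rfl; exact lt_irrefl _ hi
      rw [gammaInt, if_pos hi, if_neg hij, zero_add]
      by_cases hz : zRank n j ≤ zRank n i
      · rw [if_pos hz, gammaOne, hxd]
        have h1 := scalar_eq_of_tendsto (f := fun τ => w 0 τ i) (c := 0)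
          (fun τ hτ => hw.lax_t 0 τ le_rfl hτ i) (hw.continuousOn_t h hd i)
          (hw.integrable_t h hd hc.bdd_t i)
          (by rw [Complex.sub_re]; linarith [hk.z_le hz]) (Or.inr rfl) (hc.lim_t i hi hz) ht
        simp only [theta_zero_t, hθ]
        rw [h1, zero_sub, mul_neg, ← integral_const_mul]
        simp only [mul_assoc]
      · rw [if_neg hz, gammaTwo, hxd]
        have h1 := scalar_duhamel (f := fun τ => w 0 τ i)
          (fun τ hτ => hw.lax_t 0 τ le_rfl hτ i) (hw.continuousOn_t h hd i) le_rfl ht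
        rw [hc.zero i hi (not_le.1 hz), mul_zero, zero_add] at h1
        simp only [theta_zero_t, hθ]
        rw [h1, ← intervalIntegral.integral_const_mul]
        simp only [mul_assoc]
    · rw [gammaInt, if_neg hi, gammaThree, ← sub_eq_add_neg]
      simp only [theta_zero_t]
      refine scalar_eq_of_tendsto (f := fun y => w y t i) (c := if i = j then 1 else 0)
        (fun y hy => hw.lax_x y t hy ht i) (hw.continuousOn_x h ht i)
        (hw.integrable_x h ht (hw.bddHalf h hc.bdd_x ht) i) ?_ ?_ ?_ hx
      · rw [Complex.sub_re]
        linarith [hk.l_le (not_lt.1 hi)]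
      · by_cases hij : i = j
        · left; rw [hij, sub_self]
        · right; rw [if_neg hij]
      -- The limit at time `t` is the limit at time `0` multiplied by `e^{(z_i - z_j)t}`. This
      -- leaves it unchanged, since the limit is `0` unless `i = j`.
      · have h1 := (hw.tendsto_sub h hc.bdd_x ht i).add
          ((hc.lim_x i hi).const_mul (exp ((zt k i - zt k j) * (t : ℂ))))
        simp only [sub_add_cancel, zero_add] at h1
        by_cases hij : i = j
        · subst hij
          simpa [e3] using h1
        · simpa [e3, hij] using h1

end Eigen

/-! ### Solutions of the Lax pair with prescribed value at the corner -/

section Corner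

variable {q r : ℝ → ℝ → ℂ} {k : ℂ} {j : Fin 3} {w w' : ℝ → ℝ → V3}

theorem IsHalfLineSolution.zeroDirichlet (h : IsHalfLineSolution q r)
    (hdir : ∀ t : ℝ, 0 < t → q 0 t = 0 ∧ r 0 t = 0) : ZeroDirichlet q r := by
  have key : ∀ f : ℝ → ℝ → ℂ, ContinuousOn (fun p : ℝ × ℝ => f p.1 p.2) quarter →
      (∀ t : ℝ, 0 < t → f 0 t = 0) → ∀ t : ℝ, 0 ≤ t → f 0 t = 0 := fun f hf h0 => by
    have h1 : ContinuousOn (fun t => f 0 t) (Ici 0) :=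
      hf.comp (f := fun t : ℝ => ((0 : ℝ), t)) (by fun_prop) fun t ht => ⟨self_mem_Ici, ht⟩
    have h2 : EqOn (fun t => f 0 t) 0 (Ioi (0 : ℝ)) := fun t ht => h0 t ht
    have h3 := h2.of_subset_closure h1 continuousOn_const Ioi_subset_Ici_self
      (by rw [closure_Ioi])
    exact fun t ht => h3 ht
  exact fun t ht => ⟨key q h.q2.continuousOn (fun t ht => (hdir t ht).1) t ht,
    key r h.r2.continuousOn (fun t ht => (hdir t ht).2) t ht⟩

theorem IsLaxCol.smul (hw : IsLaxCol q r k j w) (c : ℂ) :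
    IsLaxCol q r k j fun x t => c • w x t where
  cont := hw.cont.const_smul c
  lax_x := fun x t hx ht i => by
    refine ((hw.lax_x x t hx ht i).const_mul c).congr_deriv ?_
    simp only [Matrix.mulVec_smul, Pi.smul_apply, smul_eq_mul]
    ring
  lax_t := fun x t hx ht i => by
    refine ((hw.lax_t x t hx ht i).const_mul c).congr_deriv ?_
    simp only [Matrix.mulVec_smul, Pi.smul_apply, smul_eq_mul]
    ring

theorem IsLaxCol.add (hw : IsLaxCol q r k j w) (hw' : IsLaxCol q r k j w') :
    IsLaxCol q r k j fun x t => w x t + w' x t where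
  cont := hw.cont.add hw'.cont
  lax_x := fun x t hx ht i => by
    refine ((hw.lax_x x t hx ht i).add (hw'.lax_x x t hx ht i)).congr_deriv ?_
    simp only [Matrix.mulVec_add, Pi.add_apply]
    ring
  lax_t := fun x t hx ht i => by
    refine ((hw.lax_t x t hx ht i).add (hw'.lax_t x t hx ht i)).congr_deriv ?_
    simp only [Matrix.mulVec_add, Pi.add_apply]
    ring

/-- Passing from the `j`-th to the `m`-th column of the Lax pair. -/
theorem IsLaxCol.exp_theta (hw : IsLaxCol q r k j w) (m : Fin 3) :
    IsLaxCol q r k m fun x t => exp (theta j m x t k) • w x t where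
  cont := by
    have h1 : Continuous fun p : ℝ × ℝ => exp (theta j m p.1 p.2 k) := by
      unfold theta
      fun_prop
    exact h1.continuousOn.smul hw.cont
  lax_x := fun x t hx ht i => by
    have h1 : HasDerivWithinAt (fun y : ℝ => exp (theta j m y t k))
        ((lx k j - lx k m) * exp (theta j m x t k)) (Ici 0) x := by
      have h2 : HasDerivAt (fun y : ℝ => theta j m y t k) (lx k j - lx k m) x := by
        have := ((Complex.ofRealCLM.hasDerivAt (x := x)).const_mul (lx k j - lx k m)).add_const
          ((zt k j - zt k m) * (t : ℂ))
        simpa [theta] using this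
      exact (h2.cexp.congr_deriv (mul_comm _ _)).hasDerivWithinAt
    refine (h1.mul (hw.lax_x x t hx ht i)).congr_deriv ?_
    simp only [Matrix.mulVec_smul, Pi.smul_apply, smul_eq_mul]
    ring
  lax_t := fun x t hx ht i => by
    have h1 : HasDerivWithinAt (fun y : ℝ => exp (theta j m x y k))
        ((zt k j - zt k m) * exp (theta j m x t k)) (Ici 0) t := by
      have h2 : HasDerivAt (fun y : ℝ => theta j m x y k) (zt k j - zt k m) t := by
        have := ((Complex.ofRealCLM.hasDerivAt (x := t)).const_mul (zt k j - zt k m)).const_add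
          ((lx k j - lx k m) * (x : ℂ))
        simpa [theta] using this
      exact (h2.cexp.congr_deriv (mul_comm _ _)).hasDerivWithinAt
    refine (h1.mul (hw.lax_t x t hx ht i)).congr_deriv ?_
    simp only [Matrix.mulVec_smul, Pi.smul_apply, smul_eq_mul]
    ring

/-- Solutions of the `j`-th column of the Lax pair with constant initial values, holomorphic in the
spectral parameter. -/
theorem exists_isLaxCol_param (h : IsHalfLineSolution q r) (hd : ZeroDirichlet q r) (j : Fin 3)
    (v : V3) : ∃ Ψ : ℂ → ℝ → ℝ → V3, (∀ k, IsLaxCol q r k j (Ψ k)) ∧ (∀ k, Ψ k 0 0 = v) ∧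
      ∀ x t, 0 ≤ x → 0 ≤ t → Differentiable ℂ fun k => Ψ k x t := by
  obtain ⟨Ψ, hc, h0, hx, ht, hk⟩ := exists_lax_flow h hd v
  refine ⟨fun k x t => exp (-(lx k j * x + zt k j * t)) • Ψ k x t, fun k => ⟨?_, ?_, ?_⟩,
    fun k => by simp [h0], fun x t hx ht => ?_⟩
  · have h1 : Continuous fun p : ℝ × ℝ => exp (-(lx k j * p.1 + zt k j * p.2)) := by fun_prop
    exact (h1.smul (hc k)).continuousOn
  · intro x t hx0 ht0 i
    have h1 : HasDerivWithinAt (fun y : ℝ => exp (-(lx k j * y + zt k j * t)))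
        (-lx k j * exp (-(lx k j * x + zt k j * t))) (Ici 0) x := by
      have h2 : HasDerivAt (fun y : ℝ => -(lx k j * y + zt k j * t)) (-lx k j) x := by
        exact (((Complex.ofRealCLM.hasDerivAt (x := x)).const_mul (lx k j)).add_const
          (zt k j * (t : ℂ))).fun_neg.congr_deriv (by simp)
      exact (h2.cexp.congr_deriv (mul_comm _ _)).hasDerivWithinAt
    refine (h1.mul (hasDerivAt_pi.1 (hx k x t hx0 ht0) i).hasDerivWithinAt).congr_deriv ?_
    simp only [Matrix.mulVec_smul, Matrix.add_mulVec, Pi.add_apply, Matrix.mulVec_diagonal,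
      Pi.smul_apply, smul_eq_mul]
    ring
  · intro x t hx0 ht0 i
    have h1 : HasDerivWithinAt (fun y : ℝ => exp (-(lx k j * x + zt k j * y)))
        (-zt k j * exp (-(lx k j * x + zt k j * t))) (Ici 0) t := by
      have h2 : HasDerivAt (fun y : ℝ => -(lx k j * x + zt k j * y)) (-zt k j) t := by
        exact (((Complex.ofRealCLM.hasDerivAt (x := t)).const_mul (zt k j)).const_add
          (lx k j * (x : ℂ))).fun_neg.congr_deriv (by simp)
      exact (h2.cexp.congr_deriv (mul_comm _ _)).hasDerivWithinAt
    refine (h1.mul (hasDerivAt_pi.1 (ht k x t hx0 ht0) i).hasDerivWithinAt).congr_deriv ?_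
    simp only [Matrix.mulVec_smul, Matrix.add_mulVec, Pi.add_apply, Matrix.mulVec_diagonal,
      Pi.smul_apply, smul_eq_mul]
    ring
  · have h1 := differentiable_pi.1 differentiable_lx j
    have h2 := differentiable_pi.1 differentiable_zt j
    have h3 : Differentiable ℂ fun k => exp (-(lx k j * x + zt k j * t)) := by fun_prop
    exact h3.smul (hk x t hx ht)

theorem exists_isLaxCol (h : IsHalfLineSolution q r) (hd : ZeroDirichlet q r) (k : ℂ) (j : Fin 3)
    (v : V3) : ∃ w, IsLaxCol q r k j w ∧ w 0 0 = v := by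
  obtain ⟨Ψ, h1, h2, -⟩ := exists_isLaxCol_param h hd j v
  exact ⟨Ψ k, h1 k, h2 k⟩

/-- Every solution is the combination of the fundamental ones. -/
theorem IsLaxCol.eq_sum (h : IsHalfLineSolution q r) (hd : ZeroDirichlet q r)
    {Ψ : Fin 3 → ℝ → ℝ → V3} (hΨ : ∀ m, IsLaxCol q r k j (Ψ m)) (hΨ0 : ∀ m, Ψ m 0 0 = e3 m)
    (hw : IsLaxCol q r k j w) {x t : ℝ} (hx : 0 ≤ x) (ht : 0 ≤ t) :
    w x t = w 0 0 0 • Ψ 0 x t + w 0 0 1 • Ψ 1 x t + w 0 0 2 • Ψ 2 x t := by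
  refine hw.eq h hd ((((hΨ 0).smul _).add ((hΨ 1).smul _)).add ((hΨ 2).smul _)) ?_ hx ht
  rw [hΨ0, hΨ0, hΨ0]
  ext i
  fin_cases i <;> simp [e3]

end Corner

/-! ### The spectral functions as vectors -/

/-- The columns of `s`. -/
noncomputable abbrev sCol (q r : ℝ → ℝ → ℂ) (k : ℂ) (j : Fin 3) : V3 :=
  vvec (lx k) (iPot q r 0) j

/-- The columns of `s^A`. -/
noncomputable abbrev sAdj (q r : ℝ → ℝ → ℂ) (k : ℂ) (j : Fin 3) : V3 :=
  avec (lx k) (iPot q r 0) j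

/-- The columns of `S`. -/
noncomputable abbrev bCol (q r : ℝ → ℝ → ℂ) (k : ℂ) (j : Fin 3) : V3 :=
  vvec (zt k) (bPot q r) j

/-- The columns of `S^A`. -/
noncomputable abbrev bAdj (q r : ℝ → ℝ → ℂ) (k : ℂ) (j : Fin 3) : V3 :=
  avec (zt k) (bPot q r) j

section Spectral

variable {q r : ℝ → ℝ → ℂ} {q₀ r₀ : ℝ → ℂ}

theorem sMat_apply (hinit : ∀ x : ℝ, 0 < x → q x 0 = q₀ x ∧ r x 0 = r₀ x) (k : ℂ) (i j : Fin 3) :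
    sMat q₀ r₀ k i j = sCol q r k j i := by
  rw [sMat, sCol, vvec, volterraMatrix_congr (U' := iPot q r 0)]
  intro x hx
  rw [iPot_eq hx.le le_rfl, fieldV1, (hinit x hx).1, (hinit x hx).2]

theorem sCof_apply (hinit : ∀ x : ℝ, 0 < x → q x 0 = q₀ x ∧ r x 0 = r₀ x) (k : ℂ) (i j : Fin 3) :
    sCof q₀ r₀ k i j = sAdj q r k j i := by
  rw [sCof, sAdj, avec, vvec, volterraMatrix_congr (U' := adjPot (iPot q r 0))]
  intro x hx
  rw [adjPot, iPot_eq hx.le le_rfl, fieldV1, (hinit x hx).1, (hinit x hx).2]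

theorem bMat_apply (hd : ZeroDirichlet q r) (k : ℂ) (i j : Fin 3) :
    bMat q r k i j = bCol q r k j i := by
  rw [bMat, bCol, vvec, volterraMatrix_congr (U' := bPot q r)]
  exact fun t ht => fieldV2_zero hd ht.le k

theorem bCof_apply (hd : ZeroDirichlet q r) (k : ℂ) (i j : Fin 3) :
    bCof q r k i j = bAdj q r k j i := by
  rw [bCof, bAdj, avec, vvec, volterraMatrix_congr (U' := adjPot (bPot q r))]
  exact fun t ht => by rw [adjPot, fieldV2_zero hd ht.le k]

end Spectral

/-! ### The global relation -/

section Global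

variable {q r : ℝ → ℝ → ℂ} {k : ℂ} {a b : Fin 3} {w : ℝ → ℝ → V3}

/-- The normalization at `x = ∞` is preserved by the time evolution: the components other than `a`
tend to `0`, and the `a`-th has time exponent zero. -/
theorem IsLaxCol.isVcol_x (h : IsHalfLineSolution q r) (ha : ∀ i, (lx k a).re ≤ (lx k i).re)
    (hw : IsLaxCol q r k a w) (h0 : w 0 0 = sCol q r k a) {t : ℝ} (ht : 0 ≤ t) :
    IsVcol (lx k) (iPot q r t) a fun x => w x t := by
  have hv : Tendsto (fun x => w x 0) atTop (𝓝 (e3 a)) := by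
    have := (hw.isSol_x le_rfl).tendsto_of_eq_vvec (h.isPot_iPot le_rfl) ha (γ := 1)
      (by rw [one_smul]; exact h0)
    rwa [one_smul] at this
  have hb : BddHalf fun x => w x 0 := bounded_of_tendsto (hw.isSol_x le_rfl).continuousOn hv
  refine ⟨hw.isSol_x ht, tendsto_pi_nhds.2 fun i => ?_⟩
  have h1 := (hw.tendsto_sub h hb ht i).add
    ((tendsto_apply hv i).const_mul (exp ((zt k i - zt k a) * (t : ℂ))))
  simp only [sub_add_cancel, zero_add] at h1
  by_cases hij : i = a
  · subst hij
    simpa [e3] using h1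
  · simpa [e3, hij] using h1

theorem IsHalfLineSolution.mass_iPot_le (h : IsHalfLineSolution q r) :
    ∃ C, ∀ t, 0 ≤ t → mass (iPot q r t) ≤ C * (1 + t) := by
  obtain ⟨C, hC⟩ := h.growth
  refine ⟨3 * C, fun t ht => ?_⟩
  have h1 : mass (iPot q r t) = 3 * ∫ x in Ioi (0 : ℝ), (‖q x t‖ + ‖r x t‖) := by
    rw [mass, ← integral_const_mul]
    refine setIntegral_congr_fun measurableSet_Ioi fun x hx => ?_
    rw [iPot_eq (le_of_lt (mem_Ioi.1 hx)) ht, fieldV1, mnorm_laxV1]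
  rw [h1, mul_assoc]
  exact mul_le_mul_of_nonneg_left (hC t ht) (by norm_num)

/-- At each time the column is a Volterra column in `x`, bounded by the exponential of the mass of
the potential. The rate `C` does not depend on `k`, which is what makes large `|k|` decisive. -/
theorem IsLaxCol.growth (h : IsHalfLineSolution q r) {C : ℝ}
    (hC : ∀ t, 0 ≤ t → mass (iPot q r t) ≤ C * (1 + t)) (ha : ∀ i, (lx k a).re ≤ (lx k i).re)
    (hw : IsLaxCol q r k a w) (h0 : w 0 0 = sCol q r k a) {t : ℝ} (ht : 0 ≤ t) :
    ‖w 0 t‖ ≤ Real.exp (C * (1 + t)) :=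
  ((hw.isVcol_x h ha h0 ht).norm_le (h.isPot_iPot ht) ha le_rfl).trans
    (Real.exp_le_exp.2 (hC t ht))

theorem eq_zero_of_exp_bound {z K C g : ℝ} (hz : 0 ≤ z) (hg : C < g)
    (h : ∀ T : ℝ, 0 ≤ T → z ≤ K * Real.exp (-(g * T)) * Real.exp (C * (1 + T))) : z = 0 := by
  have h1 : Tendsto (fun T : ℝ => K * Real.exp C * Real.exp (-((g - C) * T))) atTop (𝓝 0) := by
    have := (Real.tendsto_exp_neg_atTop_nhds_zero.comp
      (tendsto_id.const_mul_atTop (sub_pos.2 hg))).const_mul (K * Real.exp C)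
    simpa using this
  refine le_antisymm (ge_of_tendsto h1 ?_) hz
  filter_upwards [eventually_ge_atTop 0] with T hT
  refine (h T hT).trans_eq ?_
  rw [mul_assoc, mul_assoc, ← Real.exp_add, ← Real.exp_add]
  congr 2
  ring

theorem norm_dot_le (v u : V3) : ‖v ⬝ᵥ u‖ ≤ 3 * (‖v‖ * ‖u‖) := by
  rw [dot_three]
  have h1 : ∀ i, ‖v i * u i‖ ≤ ‖v‖ * ‖u‖ := fun i => by
    rw [norm_mul]
    exact mul_le_mul (norm_le_pi_norm _ _) (norm_le_pi_norm _ _) (norm_nonneg _) (norm_nonneg _)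
  have h2 := norm_add₃_le (a := v 0 * u 0) (b := v 1 * u 1) (c := v 2 * u 2)
  linarith [h1 0, h1 1, h1 2]

theorem norm_cross_le (v u : V3) : ‖v ⨯₃ u‖ ≤ 2 * (‖v‖ * ‖u‖) := by
  have h1 : ∀ i j, ‖v i * u j‖ ≤ ‖v‖ * ‖u‖ := fun i j => by
    rw [norm_mul]
    exact mul_le_mul (norm_le_pi_norm _ _) (norm_le_pi_norm _ _) (norm_nonneg _) (norm_nonneg _)
  refine (pi_norm_le_iff_of_nonneg (by positivity)).2 fun i => ?_
  rw [cross_apply]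
  fin_cases i
  · exact (norm_sub_le _ _).trans (by linarith [h1 1 2, h1 2 1])
  · exact (norm_sub_le _ _).trans (by linarith [h1 0 2, h1 2 0])
  · exact (norm_sub_le _ _).trans (by linarith [h1 1 0, h1 0 1])

/-- Along `x = 0` the modulus of the pairing with the bounded adjoint column grows exactly at the
rate `Re(z_b - z_a)`, while `IsLaxCol.growth` permits only the rate `C`. -/
theorem bAdj_dot_sCol_of_growth (h : IsHalfLineSolution q r) (hd : ZeroDirichlet q r) {C : ℝ}
    (hC : ∀ t, 0 ≤ t → mass (iPot q r t) ≤ C * (1 + t)) (ha : ∀ i, (lx k a).re ≤ (lx k i).re)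
    (hb : ∀ i, (zt k i).re ≤ (zt k b).re) (hgap : C < (zt k b).re - (zt k a).re) :
    bAdj q r k b ⬝ᵥ sCol q r k a = 0 := by
  obtain ⟨w, hw, hw0⟩ := exists_isLaxCol h hd k a (sCol q r k a)
  have hU := h.isPot_bPot hd
  obtain ⟨y, hy, hy0⟩ := exists_adj_isVcol hU hb
  have hyb : ∀ t, 0 ≤ t → ‖y t‖ ≤ Real.exp (mass (adjPot (bPot q r))) := fun t ht =>
    hy.norm_le hU.adj (fun i => by simpa using hb i) ht
  rw [← norm_eq_zero]
  refine eq_zero_of_exp_bound (K := 3 * Real.exp (mass (adjPot (bPot q r)))) (norm_nonneg _) hgap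
    fun T hT => ?_
  have h1 := (hw.isSol_t hd).pairing hy.1 le_rfl hT
  rw [hy0, hw0, sub_zero] at h1
  have h2 := norm_dot_le (y T) (w 0 T)
  rw [h1, norm_mul, norm_exp_mul_ofReal] at h2
  have h3 := hw.growth h hC ha hw0 hT
  have h4 : (-(zt k a + -zt k b)).re = (zt k b).re - (zt k a).re := by
    simp only [neg_re, add_re]; ring
  rw [h4] at h2
  have h5 : ‖y T‖ * ‖w 0 T‖ ≤ Real.exp (mass (adjPot (bPot q r))) * Real.exp (C * (1 + T)) :=
    mul_le_mul (hyb T hT) h3 (norm_nonneg _) (Real.exp_pos _).le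
  set g := (zt k b).re - (zt k a).re
  have h6 : Real.exp (-(g * T)) * Real.exp (g * T) = 1 := by
    rw [← Real.exp_add, neg_add_cancel, Real.exp_zero]
  have h7 := mul_le_mul_of_nonneg_left (h2.trans (mul_le_mul_of_nonneg_left h5 (by norm_num)))
    (Real.exp_pos (-(g * T))).le
  rw [← mul_assoc, h6, one_mul] at h7
  linarith

/-- If `z_a` is smallest, the cross product measures all other modes at once. It solves the adjoint
system and, without vanishing, would have to outgrow the rate `C`. -/
theorem bCol_cross_sCol_of_growth (h : IsHalfLineSolution q r) (hd : ZeroDirichlet q r) {C g : ℝ}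
    (hC : ∀ t, 0 ≤ t → mass (iPot q r t) ≤ C * (1 + t)) (ha : ∀ i, (lx k a).re ≤ (lx k i).re)
    (hz : ∀ i, (zt k a).re ≤ (zt k i).re) (hg0 : 0 ≤ g)
    (hz' : ∀ i, i ≠ a → (zt k a).re + g ≤ (zt k i).re)
    (hgap : C < g) : sCol q r k a ⨯₃ bCol q r k a = 0 := by
  obtain ⟨w, hw, hw0⟩ := exists_isLaxCol h hd k a (sCol q r k a)
  have hU := h.isPot_bPot hd
  obtain ⟨u, hu, hu0⟩ := exists_isVcol hU (zt k) hz
  have hub : ∀ t, 0 ≤ t → ‖u t‖ ≤ Real.exp (mass (bPot q r)) := fun t ht =>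
    hu.norm_le hU hz ht
  have hP := (hw.isSol_t hd).cross (zt_sum k) bPot_trace hu.1
  -- the cross product decays backward at rate `g`
  have hQ : IsSol (fun i => -zt k i) (zt k a + zt k a + (g : ℂ)) (adjPot (bPot q r))
      fun t => exp (-(g : ℂ) * (t : ℂ)) • (w 0 t ⨯₃ u t) := fun t ht i => by
    have h1 : HasDerivWithinAt (fun y : ℝ => exp (-(g : ℂ) * (y : ℂ)))
        (-(g : ℂ) * exp (-(g : ℂ) * (t : ℂ))) (Ici 0) t := by
      have h2 : HasDerivAt (fun y : ℝ => -(g : ℂ) * (y : ℂ)) (-(g : ℂ)) t := by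
        have := (Complex.ofRealCLM.hasDerivAt (x := t)).const_mul (-(g : ℂ))
        simpa using this
      exact (h2.cexp.congr_deriv (mul_comm _ _)).hasDerivWithinAt
    refine (h1.mul (hP t ht i)).congr_deriv ?_
    simp only [Matrix.mulVec_smul, Pi.smul_apply, smul_eq_mul]
    ring
  -- As the `z_j` sum to zero, each `-z_i` is the sum of the other two, so `Re(-z_i) ≥ 2 Re z_a + g`
  -- follows from the gap.
  have hsum : (zt k 0).re + (zt k 1).re + (zt k 2).re = 0 := by
    have := congrArg Complex.re (zt_sum k)
    simpa using this
  have hre : ∀ i, (zt k a + zt k a + (g : ℂ)).re ≤ (-zt k i).re := fun i => by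
    simp only [add_re, ofReal_re, neg_re]
    have h0 := hz' 0
    have h1 := hz' 1
    have h2 := hz' 2
    fin_cases a <;> fin_cases i <;> simp at h0 h1 h2 ⊢ <;> linarith
  rw [← norm_eq_zero, ← hw0, bCol, ← hu0]
  refine eq_zero_of_exp_bound
    (K := 2 * Real.exp (mass (bPot q r)) * Real.exp (mass (adjPot (bPot q r)))) (norm_nonneg _) hgap
    fun T hT => ?_
  have h1 := hQ.norm_le_backward hU.adj hre le_rfl hT
  simp only [ofReal_zero, mul_zero, Complex.exp_zero, one_smul] at h1
  rw [norm_smul, norm_exp_mul_ofReal, neg_re, ofReal_re] at h1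
  refine h1.trans ?_
  have h2 := norm_cross_le (w 0 T) (u T)
  have h3 := hw.growth h hC ha hw0 hT
  have h4 : ‖w 0 T‖ * ‖u T‖ ≤ Real.exp (C * (1 + T)) * Real.exp (mass (bPot q r)) :=
    mul_le_mul h3 (hub T hT) (norm_nonneg _) (Real.exp_pos _).le
  have h5 : Real.exp (∫ y in (0 : ℝ)..T, mnorm (adjPot (bPot q r) y))
      ≤ Real.exp (mass (adjPot (bPot q r))) := Real.exp_le_exp.2 (hU.adj.integral_le le_rfl hT)
  have h6 : Real.exp (-g * T) * ‖w 0 T ⨯₃ u T‖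
      ≤ Real.exp (-g * T) * (2 * (Real.exp (C * (1 + T)) * Real.exp (mass (bPot q r)))) :=
    mul_le_mul_of_nonneg_left (h2.trans (mul_le_mul_of_nonneg_left h4 (by norm_num)))
      (Real.exp_pos _).le
  refine (mul_le_mul h6 h5 (Real.exp_pos _).le (by positivity)).trans_eq ?_
  rw [neg_mul]
  ring

/-! ### From large `|k|` to closed sectors: scaling, holomorphy and continuation along rays -/

theorem lx_real_mul (ρ : ℝ) (k : ℂ) (i : Fin 3) : lx (ρ * k) i = ρ * lx k i := by
  fin_cases i <;> simp [lx] <;> ring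

theorem zt_real_mul (ρ : ℝ) (k : ℂ) (i : Fin 3) : zt (ρ * k) i = ((ρ ^ 2 : ℝ) : ℂ) * zt k i := by
  simp only [zt, lx_real_mul]
  push_cast
  ring

/-- A holomorphic function on an open cone which vanishes far out on every ray vanishes. -/
theorem eqOn_zero_of_ray {O : Set ℂ} (hO : IsOpen O) (hcone : ∀ k ∈ O, ∀ ρ : ℝ, 0 < ρ → ρ * k ∈ O)
    {f : ℂ → ℂ} (hf : DifferentiableOn ℂ f O)
    (h0 : ∀ k ∈ O, ∃ R : ℝ, ∀ ρ : ℝ, R < ρ → f (ρ * k) = 0) : EqOn f 0 O := by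
  intro k hk
  obtain ⟨R, hR⟩ := h0 k hk
  set φ : ℝ → ℂ := fun ρ => ρ * k with hφ
  have hφc : Continuous φ := by fun_prop
  have hray : IsPreconnected (φ '' Ioi 0) := isPreconnected_Ioi.image _ hφc.continuousOn
  have han : AnalyticOnNhd ℂ f (φ '' Ioi 0) := (hf.analyticOnNhd hO).mono (by
    rintro _ ⟨ρ, hρ, rfl⟩
    exact hcone k hk ρ hρ)
  set ρ₀ : ℝ := max R 0 + 1 with hρ₀
  have h1 : φ ρ₀ ∈ φ '' Ioi 0 := ⟨ρ₀, by rw [mem_Ioi, hρ₀]; positivity, rfl⟩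
  -- If the cone contains `0`, the ray is a single point and the value there is itself a value far
  -- out.
  by_cases hk0 : k = 0
  · have := hR (R + 1) (by linarith)
    rw [hk0, mul_zero] at this
    rw [hk0]; exact this
  have h2 : ∃ᶠ z in 𝓝[≠] φ ρ₀, f z = 0 := by
    have h3 : Tendsto φ (𝓝[>] ρ₀) (𝓝[≠] φ ρ₀) := by
      refine tendsto_nhdsWithin_iff.2 ⟨(hφc.tendsto ρ₀).mono_left nhdsWithin_le_nhds, ?_⟩
      filter_upwards [self_mem_nhdsWithin] with ρ hρ he
      have h5 : (ρ : ℂ) = ρ₀ := mul_right_cancel₀ hk0 he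
      exact (ne_of_gt (mem_Ioi.1 hρ)) (by exact_mod_cast h5)
    refine h3.frequently (Eventually.frequently ?_)
    filter_upwards [self_mem_nhdsWithin] with ρ hρ
    refine hR ρ (lt_of_le_of_lt ?_ (mem_Ioi.1 hρ))
    rw [hρ₀]; linarith [le_max_left R 0]
  have h3 := han.eqOn_zero_of_preconnected_of_frequently_eq_zero hray h1 h2
  have h4 := h3 ⟨1, mem_Ioi.2 one_pos, rfl⟩
  simpa [hφ] using h4

theorem differentiableOn_dot {f g : ℂ → V3} {O : Set ℂ} (hf : DifferentiableOn ℂ f O)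
    (hg : DifferentiableOn ℂ g O) : DifferentiableOn ℂ (fun k => f k ⬝ᵥ g k) O := by
  have h1 := fun i => (differentiableOn_pi.1 hf i).mul (differentiableOn_pi.1 hg i)
  exact (((h1 0).add (h1 1)).add (h1 2)).congr fun k _ => dot_three _ _

theorem continuousOn_dot {f g : ℂ → V3} {O : Set ℂ} (hf : ContinuousOn f O)
    (hg : ContinuousOn g O) : ContinuousOn (fun k => f k ⬝ᵥ g k) O := by
  have h1 := fun i => (continuousOn_pi.1 hf i).mul (continuousOn_pi.1 hg i)
  exact (((h1 0).add (h1 1)).add (h1 2)).congr fun k _ => dot_three _ _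

theorem differentiableOn_cross {f g : ℂ → V3} {O : Set ℂ} (hf : DifferentiableOn ℂ f O)
    (hg : DifferentiableOn ℂ g O) : DifferentiableOn ℂ (fun k => f k ⨯₃ g k) O := by
  have h1 := fun i j => (differentiableOn_pi.1 hf i).mul (differentiableOn_pi.1 hg j)
  refine differentiableOn_pi.2 fun i => ?_
  simp only [cross_apply]
  fin_cases i
  · exact (h1 1 2).sub (h1 2 1)
  · exact (h1 2 0).sub (h1 0 2)
  · exact (h1 0 1).sub (h1 1 0)

theorem continuousOn_cross {f g : ℂ → V3} {O : Set ℂ} (hf : ContinuousOn f O)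
    (hg : ContinuousOn g O) : ContinuousOn (fun k => f k ⨯₃ g k) O := by
  have h1 := fun i j => (continuousOn_pi.1 hf i).mul (continuousOn_pi.1 hg j)
  refine continuousOn_pi.2 fun i => ?_
  simp only [cross_apply]
  fin_cases i
  · exact (h1 1 2).sub (h1 2 1)
  · exact (h1 2 0).sub (h1 0 2)
  · exact (h1 0 1).sub (h1 1 0)

theorem differentiable_neg_zt : Differentiable ℂ fun k i => -zt k i :=
  differentiable_pi.2 fun i => (differentiable_pi.1 differentiable_zt i).neg

theorem differentiable_neg_lx : Differentiable ℂ fun k i => -lx k i :=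
  differentiable_pi.2 fun i => (differentiable_pi.1 differentiable_lx i).neg

theorem isOpen_sector (n : Fin 12) : IsOpen (sector n) := by
  simp only [sector, Set.ofPred_forall, Set.ofPred_and]
  refine isOpen_iInter_of_finite fun i => isOpen_iInter_of_finite fun j => IsOpen.inter ?_ ?_
  · exact isOpen_iInter_of_finite fun _ => isOpen_lt (continuous_lx_re i) (continuous_lx_re j)
  · exact isOpen_iInter_of_finite fun _ => isOpen_lt (continuous_zt_re i) (continuous_zt_re j)

theorem real_mul_mem_sector {n : Fin 12} {k : ℂ} (hk : k ∈ sector n) {ρ : ℝ} (hρ : 0 < ρ) :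
    ρ * k ∈ sector n := fun i j => by
  simp only [lx_real_mul, zt_real_mul, re_ofReal_mul]
  exact ⟨fun h => mul_lt_mul_of_pos_left ((hk i j).1 h) hρ,
    fun h => mul_lt_mul_of_pos_left ((hk i j).2 h) (by positivity)⟩

/-- Under `k ↦ ρk` the gaps between the `Re z_i` scale by `ρ²`, while the growth rate `C` stays
fixed. -/
theorem exists_forall_lt_sq_mul {C g : ℝ} (hg : 0 < g) :
    ∃ R : ℝ, ∀ ρ : ℝ, R < ρ → 0 < ρ ∧ C < ρ ^ 2 * g := by
  refine ⟨max 1 (C / g), fun ρ hρ => ?_⟩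
  have h1 := (le_max_left _ _).trans_lt hρ
  have h2 := (le_max_right _ _).trans_lt hρ
  rw [div_lt_iff₀ hg] at h2
  have h3 : ρ * g ≤ ρ ^ 2 * g := mul_le_mul_of_nonneg_right (by nlinarith) hg.le
  exact ⟨by linarith, h2.trans_le h3⟩

theorem eqOn_closure_sector {n : Fin 12} {f : ℂ → ℂ} (hf : EqOn f 0 (sector n))
    (hc : ContinuousOn f (closure (sector n))) : EqOn f 0 (closure (sector n)) :=
  hf.of_subset_closure hc continuousOn_const subset_closure le_rfl

/-- Global relation for the dominant time exponent. The growth estimate applies far out on each ray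
of the open sector; both vectors are holomorphic in the sector and continuous on its closure. -/
theorem bAdj_dot_sCol (h : IsHalfLineSolution q r) (hd : ZeroDirichlet q r) {n : Fin 12}
    (ha : ∀ i, lRank n a ≤ lRank n i) (hb : ∀ i, zRank n i ≤ zRank n b)
    (hab : zRank n a < zRank n b) (hk : k ∈ closure (sector n)) :
    bAdj q r k b ⬝ᵥ sCol q r k a = 0 := by
  have hU := h.isPot_bPot hd
  have hU' := h.isPot_iPot (t := 0) le_rfl
  have hle : ∀ k ∈ closure (sector n), ∀ i, (lx k a).re ≤ (lx k i).re := fun k hk i =>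
    (weakSector_of_mem_closure hk).l_le (ha i)
  have hze : ∀ k ∈ closure (sector n), ∀ i, (zt k i).re ≤ (zt k b).re := fun k hk i =>
    (weakSector_of_mem_closure hk).z_le (hb i)
  obtain ⟨C, hC⟩ := h.mass_iPot_le
  refine eqOn_closure_sector (f := fun k => bAdj q r k b ⬝ᵥ sCol q r k a)
    (eqOn_zero_of_ray (isOpen_sector n) (fun k hk ρ => real_mul_mem_sector hk) ?_ ?_) ?_ hk
  · exact differentiableOn_dot (differentiableOn_vvec hU.adj differentiable_neg_zt b
      (isOpen_sector n) fun k hk i => by simpa using hze k (subset_closure hk) i)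
      (differentiableOn_vvec hU' differentiable_lx a (isOpen_sector n) fun k hk i =>
        hle k (subset_closure hk) i)
  · intro k hk
    obtain ⟨R, hR⟩ := exists_forall_lt_sq_mul (C := C) (sub_pos.2 ((hk a b).2 hab))
    refine ⟨R, fun ρ hρ => ?_⟩
    obtain ⟨hρ0, h1⟩ := hR ρ hρ
    have hk' := subset_closure (real_mul_mem_sector hk hρ0)
    refine bAdj_dot_sCol_of_growth h hd hC (hle _ hk') (hze _ hk') ?_
    simp only [zt_real_mul, re_ofReal_mul]
    linarith
  · exact continuousOn_dot ((continuousOn_vvec hU.adj differentiable_neg_zt b).mono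
      fun k hk i => by simpa using hze k hk i)
      ((continuousOn_vvec hU' differentiable_lx a).mono fun k hk i => hle k hk i)

/-- Global relation when `z_a` has the smallest real part, by the same continuation applied to each
component of the cross product. -/
theorem sCol_cross_bCol (h : IsHalfLineSolution q r) (hd : ZeroDirichlet q r) {n : Fin 12}
    (ha : ∀ i, lRank n a ≤ lRank n i) (hb : ∀ i, zRank n a ≤ zRank n i)
    (hk : k ∈ closure (sector n)) : sCol q r k a ⨯₃ bCol q r k a = 0 := by
  have hU := h.isPot_bPot hd
  have hU' := h.isPot_iPot (t := 0) le_rfl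
  have hle : ∀ k ∈ closure (sector n), ∀ i, (lx k a).re ≤ (lx k i).re := fun k hk i =>
    (weakSector_of_mem_closure hk).l_le (ha i)
  have hze : ∀ k ∈ closure (sector n), ∀ i, (zt k a).re ≤ (zt k i).re := fun k hk i =>
    (weakSector_of_mem_closure hk).z_le (hb i)
  obtain ⟨C, hC⟩ := h.mass_iPot_le
  funext m
  refine eqOn_closure_sector (f := fun k => (sCol q r k a ⨯₃ bCol q r k a) m)
    (eqOn_zero_of_ray (isOpen_sector n) (fun k hk ρ => real_mul_mem_sector hk) ?_ ?_) ?_ hk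
  · exact differentiableOn_pi.1 (differentiableOn_cross
      (differentiableOn_vvec hU' differentiable_lx a (isOpen_sector n) fun k hk i =>
        hle k (subset_closure hk) i) (differentiableOn_vvec hU differentiable_zt a
      (isOpen_sector n) fun k hk i => hze k (subset_closure hk) i)) m
  · intro k hk
    -- The smallest of the two gaps is taken; the index `a` itself receives the harmless value `1`.
    have hgap : ∃ g : ℝ, 0 < g ∧ ∀ i, i ≠ a → (zt k a).re + g ≤ (zt k i).re := by
      have h1 : ∀ i, i ≠ a → (zt k a).re < (zt k i).re := fun i hi =>
        (hk a i).2 (lt_of_le_of_ne (hb i) fun he => hi (zRank_injective n he).symm)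
      have h2 : ∀ i, ∃ g : ℝ, 0 < g ∧ (i ≠ a → (zt k a).re + g ≤ (zt k i).re) := fun i => by
        by_cases hi : i = a
        · exact ⟨1, one_pos, fun h => absurd hi h⟩
        · exact ⟨(zt k i).re - (zt k a).re, sub_pos.2 (h1 i hi), fun _ => by linarith⟩
      choose g hg0 hg using h2
      refine ⟨min (g 0) (min (g 1) (g 2)), by simp [hg0], fun i hi => ?_⟩
      refine le_trans ?_ (hg i hi)
      fin_cases i <;> simp
    obtain ⟨g, hg0, hg⟩ := hgap
    obtain ⟨R, hR⟩ := exists_forall_lt_sq_mul (C := C) hg0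
    refine ⟨R, fun ρ hρ => ?_⟩
    obtain ⟨hρ0, h1⟩ := hR ρ hρ
    have hk' := subset_closure (real_mul_mem_sector hk hρ0)
    have := bCol_cross_sCol_of_growth h hd hC (hle _ hk') (hze _ hk') (g := ρ ^ 2 * g)
      (by positivity) (fun i hi => by
        simp only [zt_real_mul, re_ofReal_mul]
        rw [← mul_add]
        exact mul_le_mul_of_nonneg_left (hg i hi) (by positivity)) h1
    exact congrFun this m
  · exact continuousOn_pi.1 (continuousOn_cross
      ((continuousOn_vvec hU' differentiable_lx a).mono fun k hk i => hle k hk i)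
      ((continuousOn_vvec hU differentiable_zt a).mono fun k hk i => hze k hk i)) m

end Global

/-! ### The values of the eigenfunctions at the corner -/

section Conditions

variable {q r : ℝ → ℝ → ℂ} {n : Fin 12} {k : ℂ} {a b c : Fin 3} {ε : ℂ} {w : ℝ → ℝ → V3}

theorem isEigenColumn_iff (h : IsHalfLineSolution q r) (hd : ZeroDirichlet q r)
    (hk : WeakSector n k) {j : Fin 3} :
    IsEigenColumn q r n j k w ↔ IsLaxCol q r k j w ∧ EigenCond n j w :=
  ⟨fun hw => ⟨hw.isLaxCol, hw.eigenCond h hd hk⟩, fun hw => hw.1.isEigenColumn h hd hk hw.2⟩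

theorem EigenCond.corner_of_min (h : IsHalfLineSolution q r) (hk : WeakSector n k)
    (ha : ∀ i, lRank n a ≤ lRank n i) (hw : IsLaxCol q r k a w) (hc : EigenCond n a w) :
    w 0 0 = sCol q r k a := by
  refine IsVcol.zero_eq_vvec (w := fun x => w x 0) (h.isPot_iPot le_rfl)
    ⟨hw.isSol_x le_rfl, ?_⟩ fun i => hk.l_le (ha i)
  exact tendsto_pi_nhds.2 fun i => hc.lim_x i (not_lt.2 (ha i))

theorem IsLaxCol.eigenCond_of_min (h : IsHalfLineSolution q r) (hk : WeakSector n k)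
    (ha : ∀ i, lRank n a ≤ lRank n i) (hw : IsLaxCol q r k a w) (h0 : w 0 0 = sCol q r k a)
    (hb : BddHalf fun t => w 0 t) : EigenCond n a w := by
  have hv := hw.isVcol_x h (fun i => hk.l_le (ha i)) h0 le_rfl
  exact ⟨hv.bddHalf, fun i _ => tendsto_apply hv.2 i, hb, fun i hi => absurd hi (not_lt.2 (ha i)),
    fun i hi => absurd hi (not_lt.2 (ha i))⟩

theorem Tri.lRank_a_lt_c (T : Tri a b c ε) (ha : ∀ i, lRank n a ≤ lRank n i) :
    lRank n a < lRank n c :=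
  lt_of_le_of_ne (ha c) fun he => T.ac (lRank_injective n he)

/-- The contour `γ₂` kills the component `a` at the corner. Two components of the cross product
identity then determine the others up to the factor `s_{aa}`. -/
theorem EigenCond.corner_of_mid (h : IsHalfLineSolution q r) (hk : WeakSector n k)
    (T : Tri a b c ε) (ha : ∀ i, lRank n a ≤ lRank n i) (hb : ∀ i, lRank n i ≤ lRank n b)
    (hz : zRank n a < zRank n c) (hw : IsLaxCol q r k c w) (hc : EigenCond n c w) :
    w 0 0 a = 0 ∧ w 0 0 c * sCol q r k a a = sAdj q r k b b ∧
      w 0 0 b * sCol q r k a a = -sAdj q r k b c := by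
  have hv := hc.zero a (T.lRank_a_lt_c ha) hz
  have h1 := hc.lim_x b (not_lt.2 (hb c))
  have h2 := hc.lim_x c (lt_irrefl _)
  have h3 := (hw.isSol_x le_rfl).cross_vvec_eq (h.isPot_iPot le_rfl) (lx_sum k) (iPot_trace 0) T
    (fun i => hk.l_le (ha i)) (fun i => hk.l_le (hb i)) hc.bdd_x
    (by simpa [e3, T.bc] using h1) (by simpa [e3] using h2)
  have hb' := congrFun h3 b
  have hc' := congrFun h3 c
  have hsq := T.sq
  rw [T.cross_b, Pi.smul_apply, smul_eq_mul, hv] at hb'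
  rw [T.cross_c, Pi.smul_apply, smul_eq_mul, hv] at hc'
  refine ⟨hv, ?_, ?_⟩
  · linear_combination ε * hb' + (sAdj q r k b b - w 0 0 c * sCol q r k a a) * hsq
  · linear_combination -ε * hc' + (-sAdj q r k b c - w 0 0 b * sCol q r k a a) * hsq

/-- The remaining component of the cross product identity follows from the orthogonality of the
columns of `s^A` and `s`, after cancelling `s_{aa} ≠ 0`. Since `z_c` is dominant, boundedness in
time is automatic. -/
theorem IsLaxCol.eigenCond_of_mid (h : IsHalfLineSolution q r) (hd : ZeroDirichlet q r)
    (hk : WeakSector n k) (T : Tri a b c ε) (ha : ∀ i, lRank n a ≤ lRank n i)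
    (hb : ∀ i, lRank n i ≤ lRank n b) (hz : ∀ i, zRank n i ≤ zRank n c)
    (hw : IsLaxCol q r k c w) (hs : sCol q r k a a ≠ 0) (h0a : w 0 0 a = 0)
    (h0c : w 0 0 c * sCol q r k a a = sAdj q r k b b)
    (h0b : w 0 0 b * sCol q r k a a = -sAdj q r k b c) : EigenCond n c w := by
  have hU := h.isPot_iPot (t := 0) le_rfl
  have hdot := avec_dot_vvec hU (fun i => hk.l_le (ha i)) (fun i => hk.l_le (hb i)) T.ab
  rw [T.dot] at hdot
  have hcr : w 0 0 ⨯₃ sCol q r k a = ε • sAdj q r k b := by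
    funext i
    rw [Pi.smul_apply, smul_eq_mul]
    rcases T.cover i with rfl | rfl | rfl
    · rw [T.cross_a]
      refine mul_right_cancel₀ hs ?_
      linear_combination (-ε * sCol q r k i b) * h0c + (ε * sCol q r k i c) * h0b - ε * hdot
    · rw [T.cross_b, h0a]
      linear_combination ε * h0c
    · rw [T.cross_c, h0a]
      linear_combination -ε * h0b
  obtain ⟨h1, h2, h3⟩ := (hw.isSol_x le_rfl).asymptotics_of_cross hU (lx_sum k) (iPot_trace 0) T
    (fun i => hk.l_le (ha i)) (fun i => hk.l_le (hb i)) hcr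
  have hlt : ∀ i, lRank n i < lRank n c → i = a := fun i hi => by
    rcases T.cover i with rfl | rfl | rfl
    · rfl
    · exact absurd hi (not_lt.2 (hb c))
    · exact absurd hi (lt_irrefl _)
  refine ⟨h1, fun i hi => ?_, (hw.isSol_t hd).bddHalf_of_max (h.isPot_bPot hd) fun i =>
    hk.z_le (hz i), fun i hi hz' => ?_, fun i hi _ => by rw [hlt i hi, h0a]⟩
  · rcases T.cover i with rfl | rfl | rfl
    · exact absurd (T.lRank_a_lt_c ha) hi
    · simpa [e3, T.bc] using h2
    · simpa [e3] using h3
  · exact absurd ((hlt i hi).symm.trans (zRank_injective n (le_antisymm (hz i) hz'))) T.ac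

theorem EigenCond.sAdj_dot_corner (h : IsHalfLineSolution q r) (hk : WeakSector n k)
    (hb : ∀ i, lRank n i ≤ lRank n b) (hw : IsLaxCol q r k b w) (hc : EigenCond n b w) :
    sAdj q r k b ⬝ᵥ w 0 0 = 1 := by
  have h1 := (hw.isSol_x le_rfl).tendsto_of_max (h.isPot_iPot le_rfl) fun i => hk.l_le (hb i)
  have h2 := hc.lim_x b (lt_irrefl _)
  have := tendsto_nhds_unique h1 h2
  simpa [e3] using this

theorem lRank_lt_of_max (hb : ∀ i, lRank n i ≤ lRank n b) {i : Fin 3} (hi : i ≠ b) :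
    lRank n i < lRank n b :=
  lt_of_le_of_ne (hb i) fun he => hi (lRank_injective n he)

/-- Every component but `b` decays along the `t`-axis, and with `z_b` smallest only multiples of the
column of `S` do this. -/
theorem EigenCond.corner_of_max_min (h : IsHalfLineSolution q r) (hd : ZeroDirichlet q r)
    (hk : WeakSector n k) (hb : ∀ i, lRank n i ≤ lRank n b) (hz : ∀ i, zRank n b ≤ zRank n i)
    (hw : IsLaxCol q r k b w) (hc : EigenCond n b w) : ∃ γ : ℂ, w 0 0 = γ • bCol q r k b :=
  (hw.isSol_t hd).exists_eq_smul_vvec (h.isPot_bPot hd) (fun i => hk.z_le (hz i)) hc.bdd_t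
    fun i hi => hc.lim_t i (lRank_lt_of_max hb hi) (hz i)

theorem IsLaxCol.lim_x_of_max (h : IsHalfLineSolution q r) (hk : WeakSector n k)
    (hb : ∀ i, lRank n i ≤ lRank n b) (hw : IsLaxCol q r k b w)
    (h1 : sAdj q r k b ⬝ᵥ w 0 0 = 1) (i : Fin 3) (hi : ¬ lRank n i < lRank n b) :
    Tendsto (fun x => w x 0 i) atTop (𝓝 (e3 b i)) := by
  have hib : i = b := by
    by_contra hne
    exact hi (lRank_lt_of_max hb hne)
  rw [hib]
  have h2 := (hw.isSol_x le_rfl).tendsto_of_max (h.isPot_iPot le_rfl) fun i => hk.l_le (hb i)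
  rw [h1] at h2
  simpa [e3] using h2

theorem IsLaxCol.eigenCond_of_max_min (h : IsHalfLineSolution q r) (hd : ZeroDirichlet q r)
    (hk : WeakSector n k) (hb : ∀ i, lRank n i ≤ lRank n b) (hz : ∀ i, zRank n b ≤ zRank n i)
    (hw : IsLaxCol q r k b w) (h1 : sAdj q r k b ⬝ᵥ w 0 0 = 1) {γ : ℂ}
    (h2 : w 0 0 = γ • bCol q r k b) : EigenCond n b w := by
  have ht := (hw.isSol_t hd).tendsto_of_eq_vvec (h.isPot_bPot hd) (fun i => hk.z_le (hz i)) h2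
  refine ⟨(hw.isSol_x le_rfl).bddHalf_of_max (h.isPot_iPot le_rfl) fun i => hk.l_le (hb i),
    hw.lim_x_of_max h hk hb h1, bounded_of_tendsto (hw.isSol_t hd).continuousOn ht,
    fun i hi _ => ?_, fun i _ hi => absurd hi (not_lt.2 (hz i))⟩
  have hib : i ≠ b := by rintro rfl; exact lt_irrefl _ hi
  have := tendsto_apply ht i
  simpa [e3, hib] using this

theorem EigenCond.corner_of_max_mid (h : IsHalfLineSolution q r) (hd : ZeroDirichlet q r)
    (hk : WeakSector n k) (T : Tri a b c ε) (hb : ∀ i, lRank n i ≤ lRank n b)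
    (hz : ∀ i, zRank n i ≤ zRank n c) (hz' : zRank n a < zRank n b)
    (hw : IsLaxCol q r k b w) (hc : EigenCond n b w) :
    w 0 0 a = 0 ∧ bAdj q r k c ⬝ᵥ w 0 0 = 0 :=
  ⟨hc.zero a (lRank_lt_of_max hb T.ab) hz',
    (hw.isSol_t hd).dot_avec_eq_zero (h.isPot_bPot hd) (fun i => hk.z_le (hz i)) hc.bdd_t
      (hc.lim_t c (lRank_lt_of_max hb T.bc.symm) (hz b)) (hk.z_le (hz b))⟩

theorem IsLaxCol.eigenCond_of_max_mid (h : IsHalfLineSolution q r) (hd : ZeroDirichlet q r)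
    (hk : WeakSector n k) (T : Tri a b c ε) (hb : ∀ i, lRank n i ≤ lRank n b)
    (hz : ∀ i, zRank n i ≤ zRank n c) (hz' : zRank n a < zRank n b)
    (hw : IsLaxCol q r k b w) (h1 : sAdj q r k b ⬝ᵥ w 0 0 = 1) (h2 : w 0 0 a = 0)
    (h3 : bAdj q r k c ⬝ᵥ w 0 0 = 0) : EigenCond n b w := by
  obtain ⟨ht, ht'⟩ := (hw.isSol_t hd).bddHalf_and_tendsto_of_dot (h.isPot_bPot hd)
    (fun i => hk.z_le (hz i)) (fun i hi => by
      rcases T.cover i with rfl | rfl | rfl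
      · exact hk.z_le hz'.le
      · exact le_rfl
      · exact absurd rfl hi) h3
  have hzbc : zRank n b < zRank n c :=
    lt_of_le_of_ne (hz b) fun he => T.bc (zRank_injective n he)
  refine ⟨(hw.isSol_x le_rfl).bddHalf_of_max (h.isPot_iPot le_rfl) fun i => hk.l_le (hb i),
    hw.lim_x_of_max h hk hb h1, ht, fun i hi hzi => ?_, fun i hi hzi => ?_⟩
  · rcases T.cover i with rfl | rfl | rfl
    · exact absurd hz' (not_lt.2 hzi)
    · exact absurd hi (lt_irrefl _)
    · exact ht'
  · rcases T.cover i with rfl | rfl | rfl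
    · exact h2
    · exact absurd hi (lt_irrefl _)
    · exact absurd hzi (not_lt.2 hzbc.le)

end Conditions

/-! ### The spectral matrices `S_n` -/

/-- The `j`-th column of `M_n` exists and takes the value `v` at the corner. -/
def IsSpecCol (q r : ℝ → ℝ → ℂ) (n : Fin 12) (j : Fin 3) (k : ℂ) (v : V3) : Prop :=
  (∃ w, IsEigenColumn q r n j k w) ∧ ∀ w, IsEigenColumn q r n j k w → w 0 0 = v

theorem IsSpecCol.isEigenColumn {q r : ℝ → ℝ → ℂ} {n : Fin 12} {j : Fin 3} {k : ℂ} {v : V3}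
    (hv : IsSpecCol q r n j k v) : IsEigenColumn q r n j k (eigenCol q r n j k) :=
  solutionOf_spec hv.1

theorem IsSpecCol.corner {q r : ℝ → ℝ → ℂ} {n : Fin 12} {j : Fin 3} {k : ℂ} {v : V3}
    (hv : IsSpecCol q r n j k v) : eigenCol q r n j k 0 0 = v :=
  hv.2 _ hv.isEigenColumn

theorem IsSpecCol.isLaxCol {q r : ℝ → ℝ → ℂ} {n : Fin 12} {j : Fin 3} {k : ℂ} {v : V3}
    (hv : IsSpecCol q r n j k v) : IsLaxCol q r k j (eigenCol q r n j k) :=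
  hv.isEigenColumn.isLaxCol

section SpecCol

variable {q r : ℝ → ℝ → ℂ} {n : Fin 12} {k : ℂ} {a b c : Fin 3} {ε : ℂ}

theorem isSpecCol_of_cond (h : IsHalfLineSolution q r) (hd : ZeroDirichlet q r)
    (hk : WeakSector n k) {j : Fin 3} {v : V3}
    (h1 : ∀ w, IsLaxCol q r k j w → w 0 0 = v → EigenCond n j w)
    (h2 : ∀ w, IsLaxCol q r k j w → EigenCond n j w → w 0 0 = v) : IsSpecCol q r n j k v := by
  obtain ⟨w, hw, hw0⟩ := exists_isLaxCol h hd k j v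
  exact ⟨⟨w, (isEigenColumn_iff h hd hk).2 ⟨hw, h1 w hw hw0⟩⟩, fun w' hw' =>
    h2 w' hw'.isLaxCol (hw'.eigenCond h hd hk)⟩

/-- The subdominant column, when it has the second largest growth rate in time. -/
theorem isSpecCol_min_of_dot (h : IsHalfLineSolution q r) (hd : ZeroDirichlet q r)
    (hk : k ∈ closure (sector n)) (ha : ∀ i, lRank n a ≤ lRank n i)
    (hb : ∀ i, zRank n i ≤ zRank n b) (hab : ∀ i, i ≠ b → zRank n i ≤ zRank n a) (hne : a ≠ b) :
    IsSpecCol q r n a k (sCol q r k a) := by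
  have hk' := weakSector_of_mem_closure hk
  refine isSpecCol_of_cond h hd hk' (fun w hw h0 => ?_) fun w hw hc => hc.corner_of_min h hk' ha hw
  refine hw.eigenCond_of_min h hk' ha h0 ?_
  refine ((hw.isSol_t hd).bddHalf_and_tendsto_of_dot (h.isPot_bPot hd)
    (fun i => hk'.z_le (hb i)) (fun i hi => hk'.z_le (hab i hi)) ?_).1
  rw [h0]
  exact bAdj_dot_sCol h hd ha hb
    (lt_of_le_of_ne (hb a) fun he => hne (zRank_injective n he)) hk

theorem eq_smul_of_cross_eq_zero {u v : V3} (hv : v ≠ 0) (h : u ⨯₃ v = 0) : ∃ γ : ℂ, u = γ • v := by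
  have h0 := congrFun h 0
  have h1 := congrFun h 1
  have h2 := congrFun h 2
  simp [cross_apply] at h0 h1 h2
  obtain ⟨i, hi⟩ : ∃ i, v i ≠ 0 := by
    by_contra! hall
    exact hv (funext hall)
  refine ⟨u i / v i, ?_⟩
  ext m
  rw [Pi.smul_apply, smul_eq_mul]
  field_simp
  fin_cases i <;> fin_cases m <;> simp <;> grind

/-- The subdominant column, when it has the smallest growth rate in time. -/
theorem isSpecCol_min_of_cross (h : IsHalfLineSolution q r) (hd : ZeroDirichlet q r)
    (hk : k ∈ closure (sector n)) (ha : ∀ i, lRank n a ≤ lRank n i)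
    (hz : ∀ i, zRank n a ≤ zRank n i) : IsSpecCol q r n a k (sCol q r k a) := by
  have hk' := weakSector_of_mem_closure hk
  have hU := h.isPot_bPot hd
  refine isSpecCol_of_cond h hd hk' (fun w hw h0 => ?_) fun w hw hc => hc.corner_of_min h hk' ha hw
  refine hw.eigenCond_of_min h hk' ha h0 ?_
  obtain ⟨γ, hγ⟩ := eq_smul_of_cross_eq_zero (vvec_ne_zero hU fun i => hk'.z_le (hz i))
    (sCol_cross_bCol h hd ha hz hk)
  exact bounded_of_tendsto (hw.isSol_t hd).continuousOn
    ((hw.isSol_t hd).tendsto_of_eq_vvec hU (fun i => hk'.z_le (hz i)) (h0.trans hγ))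

theorem isSpecCol_mid (h : IsHalfLineSolution q r) (hd : ZeroDirichlet q r)
    (hk : WeakSector n k) (T : Tri a b c ε) (ha : ∀ i, lRank n a ≤ lRank n i)
    (hb : ∀ i, lRank n i ≤ lRank n b) (hz : ∀ i, zRank n i ≤ zRank n c)
    (hs : sCol q r k a a ≠ 0) {v : V3} (h0a : v a = 0)
    (h0c : v c * sCol q r k a a = sAdj q r k b b)
    (h0b : v b * sCol q r k a a = -sAdj q r k b c) : IsSpecCol q r n c k v := by
  refine isSpecCol_of_cond h hd hk (fun w hw h0 => ?_) fun w hw hc => ?_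
  · rw [← h0] at h0a h0b h0c
    exact hw.eigenCond_of_mid h hd hk T ha hb hz hs h0a h0c h0b
  · obtain ⟨h1, h2, h3⟩ := hc.corner_of_mid h hk T ha hb
      (lt_of_le_of_ne (hz a) fun he => T.ac (zRank_injective n he)) hw
    funext i
    rcases T.cover i with rfl | rfl | rfl
    · rw [h1, h0a]
    · exact mul_right_cancel₀ hs (h3.trans h0b.symm)
    · exact mul_right_cancel₀ hs (h2.trans h0c.symm)

theorem isSpecCol_max_min (h : IsHalfLineSolution q r) (hd : ZeroDirichlet q r)
    (hk : WeakSector n k) (hb : ∀ i, lRank n i ≤ lRank n b) (hz : ∀ i, zRank n b ≤ zRank n i)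
    {γ : ℂ} (hγ : γ * (sAdj q r k b ⬝ᵥ bCol q r k b) = 1) :
    IsSpecCol q r n b k (γ • bCol q r k b) := by
  refine isSpecCol_of_cond h hd hk (fun w hw h0 => ?_) fun w hw hc => ?_
  · refine hw.eigenCond_of_max_min h hd hk hb hz ?_ h0
    rw [h0, dotProduct_smul, smul_eq_mul, hγ]
  · obtain ⟨γ', hγ'⟩ := hc.corner_of_max_min h hd hk hb hz hw
    have h1 := hc.sAdj_dot_corner h hk hb hw
    rw [hγ', dotProduct_smul, smul_eq_mul] at h1
    have h2 : sAdj q r k b ⬝ᵥ bCol q r k b ≠ 0 := right_ne_zero_of_mul_eq_one hγ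
    rw [hγ', mul_right_cancel₀ h2 (h1.trans hγ.symm)]

/-- With the component `a` equal to zero, two linear equations remain for the components `b` and
`c`. Their determinant is the expression assumed nonzero in `hW`, whence uniqueness. -/
theorem isSpecCol_max_mid (h : IsHalfLineSolution q r) (hd : ZeroDirichlet q r)
    (hk : WeakSector n k) (T : Tri a b c ε) (hb : ∀ i, lRank n i ≤ lRank n b)
    (hz : ∀ i, zRank n i ≤ zRank n c) (hz' : zRank n a < zRank n b) {v : V3}
    (hW : sAdj q r k b b * bAdj q r k c c - sAdj q r k b c * bAdj q r k c b ≠ 0)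
    (h1 : sAdj q r k b ⬝ᵥ v = 1) (h2 : v a = 0) (h3 : bAdj q r k c ⬝ᵥ v = 0) :
    IsSpecCol q r n b k v := by
  refine isSpecCol_of_cond h hd hk (fun w hw h0 => ?_) fun w hw hc => ?_
  · rw [← h0] at h1 h2 h3
    exact hw.eigenCond_of_max_mid h hd hk T hb hz hz' h1 h2 h3
  · obtain ⟨h4, h5⟩ := hc.corner_of_max_mid h hd hk T hb hz hz' hw
    have h6 := hc.sAdj_dot_corner h hk hb hw
    rw [T.dot] at h1 h3 h5 h6
    rw [h2] at h1 h3
    rw [h4] at h5 h6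
    funext i
    rcases T.cover i with rfl | rfl | rfl
    · rw [h4, h2]
    · refine mul_left_cancel₀ hW ?_
      linear_combination (bAdj q r k c c) * (h6 - h1) - (sAdj q r k i c) * (h5 - h3)
    · refine mul_left_cancel₀ hW ?_
      linear_combination -(bAdj q r k i b) * (h6 - h1) + (sAdj q r k b b) * (h5 - h3)

end SpecCol

/-! ### The `ℤ₃` symmetry -/

section Symmetry

variable {q r : ℝ → ℝ → ℂ} {n : Fin 12} {k : ℂ} {j : Fin 3}

/-- Cyclic rotation of the components of a vector. -/
def rot (v : V3) : V3 := fun i => v (i + 2)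

theorem om_cube : om ^ 3 = 1 := by linear_combination (om - 1) * om_rel

theorem om_mul_sq_mul (k : ℂ) : om * (om ^ 2 * k) = k := by linear_combination k * om_cube

theorem rot_add_one (v : V3) (i : Fin 3) : rot v (i + 1) = v i := by
  fin_cases i <;> rfl

theorem norm_rot (v : V3) : ‖rot v‖ = ‖v‖ := by
  refine le_antisymm ((pi_norm_le_iff_of_nonneg (norm_nonneg _)).2 fun i => norm_le_pi_norm v _)
    ((pi_norm_le_iff_of_nonneg (norm_nonneg _)).2 fun i => ?_)
  rw [← rot_add_one v i]
  exact norm_le_pi_norm (rot v) _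

theorem continuous_rot : Continuous rot := continuous_pi fun i => continuous_apply (i + 2)

theorem lx_om_mul (k : ℂ) (i : Fin 3) : lx (om * k) i = lx k (i + 2) := by
  fin_cases i
  · rfl
  · simp [lx]
    linear_combination k * om_cube
  · simp [lx]
    ring

theorem zt_om_mul (k : ℂ) (i : Fin 3) : zt (om * k) i = zt k (i + 2) := by
  simp only [zt, lx_om_mul]

theorem add_one_add_two (j : Fin 3) : j + 1 + 2 = j := by
  fin_cases j <;> rfl

theorem theta_om_mul (i j : Fin 3) (x t : ℝ) (k : ℂ) :
    theta i j x t (om * k) = theta (i + 2) (j + 2) x t k := by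
  simp only [theta, lx_om_mul, zt_om_mul]

theorem laxV1_mulVec_rot (a b : ℂ) (v : V3) (i : Fin 3) :
    (laxV1 a b *ᵥ rot v) i = (laxV1 a b *ᵥ v) (i + 2) := by
  fin_cases i <;> simp [mulVec_three, laxV1, rot] <;> ring

theorem laxV2_mulVec_rot (a b a' b' k : ℂ) (v : V3) (i : Fin 3) :
    (laxV2 a b a' b' (om * k) *ᵥ rot v) i = (laxV2 a b a' b' k *ᵥ v) (i + 2) := by
  have h3 := om_cube
  fin_cases i <;> simp [mulVec_three, laxV2, rot] <;> grind

theorem lRank_add_four (n : Fin 12) (i : Fin 3) : lRank (n + 4) i = lRank n (i + 2) := by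
  revert n i; decide

theorem zRank_add_four (n : Fin 12) (i : Fin 3) : zRank (n + 4) i = zRank n (i + 2) := by
  revert n i; decide

theorem gammaInt_rot (w : ℝ → ℝ → V3) (i : Fin 3) (x t : ℝ) :
    gammaInt q r (n + 4) (om * k) (fun x t => rot (w x t)) i (j + 1) x t
      = gammaInt q r n k w (i + 2) j x t := by
  simp only [gammaInt, gammaOne, gammaTwo, gammaThree, lRank_add_four, zRank_add_four,
    theta_om_mul, add_one_add_two, fieldV1, fieldV2, laxV1_mulVec_rot, laxV2_mulVec_rot]

/-- Replacing `k` by `ωk` shifts the `l_i` and the `z_i` cyclically, `V₁` and `V₂` are equivariant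
under that shift, and the order tables of `D_{n+4}` are the shifted tables of `D_n`. -/
theorem IsEigenColumn.rotate {w : ℝ → ℝ → V3} (hw : IsEigenColumn q r n j k w) :
    IsEigenColumn q r (n + 4) (j + 1) (om * k) fun x t => rot (w x t) where
  cont := continuous_rot.comp_continuousOn hw.cont
  bounded_x := by simpa only [norm_rot] using hw.bounded_x
  bounded_t := by simpa only [norm_rot] using hw.bounded_t
  lax_x := fun x t hx ht i => by
    simp only [lx_om_mul, add_one_add_two, fieldV1, laxV1_mulVec_rot]
    exact hw.lax_x x t hx ht (i + 2)
  lax_t := fun x t hx ht i => by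
    simp only [zt_om_mul, add_one_add_two, fieldV2, laxV2_mulVec_rot]
    exact hw.lax_t x t hx ht (i + 2)
  integral_eq := fun x t hx ht i => by
    rw [gammaInt_rot]
    have h1 : (if i = j + 1 then (1 : ℂ) else 0) = if i + 2 = j then 1 else 0 := by
      clear * -
      refine if_congr ?_ rfl rfl
      revert i j
      decide
    rw [h1]
    exact hw.integral_eq x t hx ht (i + 2)

theorem add_four_three (n : Fin 12) : n + 4 + 4 + 4 = n := by revert n; decide

theorem add_one_three (j : Fin 3) : j + 1 + 1 + 1 = j := by revert j; decide

theorem rot_rot_rot (v : V3) : rot (rot (rot v)) = v := by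
  funext i
  fin_cases i <;> rfl

/-- The inverse of a rotation is its square, since three rotations return every index and `k`
itself. -/
theorem IsEigenColumn.of_rot {w : ℝ → ℝ → V3}
    (hw : IsEigenColumn q r (n + 4) (j + 1) (om * k) w) :
    IsEigenColumn q r n j k fun x t => rot (rot (w x t)) := by
  have h1 := hw.rotate.rotate
  rwa [add_four_three, add_one_three, show om * (om * (om * k)) = k by
    linear_combination k * om_cube] at h1

/-- The value at the corner of the `j`-th column of `M_n` is unique. -/
def CornerUnique (q r : ℝ → ℝ → ℂ) (n : Fin 12) (j : Fin 3) (k : ℂ) : Prop :=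
  ∀ w w', IsEigenColumn q r n j k w → IsEigenColumn q r n j k w' → w 0 0 = w' 0 0

theorem IsSpecCol.cornerUnique {v : V3} (hv : IsSpecCol q r n j k v) : CornerUnique q r n j k :=
  fun _ _ hw hw' => (hv.2 _ hw).trans (hv.2 _ hw').symm

theorem CornerUnique.rotate (hu : CornerUnique q r n j k) :
    CornerUnique q r (n + 4) (j + 1) (om * k) := fun w w' hw hw' => by
  have h1 := congrArg rot (hu _ _ hw.of_rot hw'.of_rot)
  simpa only [rot_rot_rot] using h1

/-- `eigenCol` is a choice, so uniqueness at the corner is needed to compare the two sides. If no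
column exists on one side, none exists on the other, and both take the default value `0`. -/
theorem eigenCol_rot (hu : CornerUnique q r n j k) :
    eigenCol q r (n + 4) (j + 1) (om * k) 0 0 = rot (eigenCol q r n j k 0 0) := by
  by_cases he : ∃ w, IsEigenColumn q r n j k w
  · have h1 : IsEigenColumn q r n j k (eigenCol q r n j k) := solutionOf_spec he
    have h2 : IsEigenColumn q r (n + 4) (j + 1) (om * k) (eigenCol q r (n + 4) (j + 1) (om * k)) :=
      solutionOf_spec ⟨_, h1.rotate⟩
    exact hu.rotate _ _ h2 h1.rotate
  · have h1 : ¬ ∃ w, IsEigenColumn q r (n + 4) (j + 1) (om * k) w := fun ⟨w, hw⟩ =>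
      he ⟨_, hw.of_rot⟩
    have h2 : eigenCol q r n j k = 0 := dif_neg he
    have h3 : eigenCol q r (n + 4) (j + 1) (om * k) = 0 := dif_neg h1
    rw [h2, h3]
    rfl

theorem specS_rot (hu : ∀ j, CornerUnique q r n j k) :
    specS q r n k = (specS q r (n + 4) (om * k)).submatrix (Equiv.addRight 1) (Equiv.addRight 1) := by
  ext i j
  simp only [specS, Matrix.submatrix_apply, Matrix.of_apply, Equiv.coe_addRight, eigenCol_rot (hu j),
    rot_add_one]

theorem cycA_mul_inv (X : Mat3) :
    cycA * X * cycA⁻¹ = X.submatrix (Equiv.addRight 1) (Equiv.addRight 1) := by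
  have h1 : cycA⁻¹ = !![0, 0, 1; 1, 0, 0; 0, 1, 0] := by
    refine Matrix.inv_eq_right_inv ?_
    ext i j
    fin_cases i <;> fin_cases j <;> simp [cycA, Matrix.mul_apply, Fin.sum_univ_three]
  have h2 : cycA * X = !![X 1 0, X 1 1, X 1 2; X 2 0, X 2 1, X 2 2; X 0 0, X 0 1, X 0 2] := by
    ext i j
    fin_cases i <;> fin_cases j <;> simp [cycA, Matrix.mul_apply, Fin.sum_univ_three]
  rw [h1, h2]
  ext i j
  fin_cases i <;> fin_cases j <;> simp [Matrix.mul_apply, Fin.sum_univ_three]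

theorem jump_rot {m : Fin 12} (hm : ∀ j, CornerUnique q r m j k)
    (hn : ∀ j, CornerUnique q r n j k) (x t : ℝ) :
    jump q r m n x t k = cycA * jump q r (m + 4) (n + 4) x t (om * k) * cycA⁻¹ := by
  rw [cycA_mul_inv]
  ext i j
  simp only [jump, Matrix.submatrix_apply, Matrix.of_apply, theta_om_mul, Equiv.coe_addRight,
    add_one_add_two]
  rw [specS_rot hm, specS_rot hn, Matrix.inv_submatrix_equiv, Matrix.submatrix_mul_equiv]
  rfl

theorem om_mul_mem_sector : om * k ∈ sector (n + 4) ↔ k ∈ sector n := by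
  simp only [sector, mem_ofPred_eq, lx_om_mul, zt_om_mul, lRank_add_four, zRank_add_four]
  refine ⟨fun h i j => ?_, fun h i j => h (i + 2) (j + 2)⟩
  simpa only [add_one_add_two] using h (i + 1) (j + 1)

theorem sq_mul_mem_frontier (hk : k ∈ frontier (sector (n + 4))) :
    om ^ 2 * k ∈ frontier (sector n) := by
  rw [(isOpen_sector _).frontier_eq] at hk ⊢
  have key : ∀ k, k ∈ sector (n + 4) ↔ om ^ 2 * k ∈ sector n := fun k => by
    rw [← om_mul_mem_sector (n := n), om_mul_sq_mul]
  refine ⟨map_mem_closure (f := fun k => om ^ 2 * k) (by fun_prop) hk.1 fun k hk => (key k).1 hk,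
    fun h => hk.2 ((key k).2 h)⟩

/-- Adjacent sectors are disjoint because some pair of `Re z_i` changes order between them. A common
point of the closures therefore lies in neither open sector. -/
theorem mem_frontier_left (hk : k ∈ closure (sector n) ∩ closure (sector (n + 1))) :
    k ∈ frontier (sector n) ∧ k ∈ frontier (sector (n + 1)) := by
  have hrk : ∃ i j, zRank n i < zRank n j ∧ zRank (n + 1) j < zRank (n + 1) i := by
    clear hk
    revert n
    decide
  have hdis : Disjoint (sector n) (sector (n + 1)) := by
    rw [Set.disjoint_left]
    intro k h1 h2
    obtain ⟨i, j, h3, h4⟩ := hrk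
    exact lt_asymm ((h1 i j).2 h3) ((h2 j i).2 h4)
  rw [(isOpen_sector _).frontier_eq, (isOpen_sector _).frontier_eq]
  exact ⟨⟨hk.1, fun h => (hdis.closure_right (isOpen_sector n)).le_bot ⟨h, hk.2⟩⟩,
    ⟨hk.2, fun h => (hdis.closure_left (isOpen_sector (n + 1))).le_bot ⟨hk.1, h⟩⟩⟩

/-- The sectors `D₁, …, D₄` represent all orbits of `n ↦ n + 4`. -/
theorem cornerUnique_of_frontier
    (h0 : ∀ n : Fin 12, n = 1 ∨ n = 2 ∨ n = 3 ∨ n = 4 →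
      ∀ k ∈ frontier (sector n), ∀ j, CornerUnique q r n j k) (n : Fin 12) :
    ∀ k ∈ frontier (sector n), ∀ j, CornerUnique q r n j k := by
  have step : ∀ n : Fin 12, (∀ k ∈ frontier (sector n), ∀ j, CornerUnique q r n j k) →
      ∀ k ∈ frontier (sector (n + 4)), ∀ j, CornerUnique q r (n + 4) j k := by
    intro n hn k hk j
    have h1 := (hn _ (sq_mul_mem_frontier hk) (j + 2)).rotate
    rwa [om_mul_sq_mul, show j + 2 + 1 = j by clear * -; revert j; decide] at h1
  have hn : ∃ m : Fin 12, (m = 1 ∨ m = 2 ∨ m = 3 ∨ m = 4) ∧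
      (n = m ∨ n = m + 4 ∨ n = m + 4 + 4) := by
    revert n; decide
  obtain ⟨m, hm, rfl | rfl | rfl⟩ := hn
  · exact h0 _ hm
  · exact step _ (h0 _ hm)
  · exact step _ (step _ (h0 _ hm))

theorem sCol_rot (h : IsHalfLineSolution q r) (ha : ∀ i, (lx k j).re ≤ (lx k i).re) :
    sCol q r (om * k) (j + 1) = rot (sCol q r k j) := by
  have hU := h.isPot_iPot (t := 0) le_rfl
  obtain ⟨w, hw, hw0⟩ := exists_isVcol hU (lx k) ha
  have h1 : IsVcol (lx (om * k)) (iPot q r 0) (j + 1) fun x => rot (w x) := by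
    refine ⟨fun x hx i => ?_, ?_⟩
    · simp only [lx_om_mul, add_one_add_two, iPot, fieldV1, laxV1_mulVec_rot]
      exact hw.1 x hx (i + 2)
    · have h2 : e3 (j + 1) = rot (e3 j) := by
        funext i
        fin_cases i <;> fin_cases j <;> rfl
      rw [h2]
      exact (continuous_rot.tendsto _).comp hw.2
  have h2 := h1.zero_eq_vvec hU fun i => by
    rw [lx_om_mul, lx_om_mul, add_one_add_two]
    exact ha _
  rw [sCol, ← h2, hw0]

end Symmetry

/-! ### Explicit columns in the sectors `D₁, …, D₄` -/

section Upper

variable {q r : ℝ → ℝ → ℂ} {n : Fin 12} {k κ : ℂ} {b c : Fin 3} {ε : ℂ}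

theorem lx_neg (k : ℂ) (i : Fin 3) : lx (-k) i = -lx k i := by
  fin_cases i <;> simp [lx]

theorem zt_neg (k : ℂ) : zt (-k) = zt k := by
  funext i
  simp [zt, lx_neg]

theorem bCol_neg (k : ℂ) (j : Fin 3) : bCol q r (-k) j = bCol q r k j := by
  rw [bCol, zt_neg]

theorem bAdj_neg (k : ℂ) (j : Fin 3) : bAdj q r (-k) j = bAdj q r k j := by
  rw [bAdj, zt_neg]

/-- Passing from `k` to `-k` reverses the order of the `Re l_i`, while that of the `Re z_i` is
unchanged by `zRank_add_six`. Hence the dominant `l_b` becomes subdominant at `-k`. -/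
theorem lRank_add_six (n : Fin 12) (i j : Fin 3) :
    lRank (n + 6) i < lRank (n + 6) j ↔ lRank n j < lRank n i := by
  revert n i j; decide

theorem zRank_add_six (n : Fin 12) : zRank (n + 6) = zRank n := by
  funext i; revert n i; decide

theorem neg_mem_sector (hk : k ∈ sector n) : -k ∈ sector (n + 6) := fun i j => by
  rw [zt_neg, zRank_add_six, lRank_add_six, lx_neg, lx_neg, neg_re, neg_re, neg_lt_neg_iff]
  exact ⟨(hk j i).1, (hk i j).2⟩

theorem neg_mem_closure_sector (hk : k ∈ closure (sector n)) : -k ∈ closure (sector (n + 6)) :=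
  map_mem_closure continuous_neg hk fun _ => neg_mem_sector

/-- The sectors in which `l₃` is subdominant and `z_c` is dominant, where `l_b` is the dominant
and `l_c` the intermediate exponent. -/
structure UpperSector (n : Fin 12) (b c : Fin 3) (ε : ℂ) : Prop where
  cases : (b = 0 ∧ c = 1 ∧ ε = 1) ∨ (b = 1 ∧ c = 0 ∧ ε = -1)
  min : ∀ i, lRank n 2 ≤ lRank n i
  max : ∀ i, lRank n i ≤ lRank n b
  zmax : ∀ i, zRank n i ≤ zRank n c

theorem UpperSector.tri (U : UpperSector n b c ε) : Tri 2 b c ε := by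
  obtain ⟨rfl, rfl, rfl⟩ | ⟨rfl, rfl, rfl⟩ := U.cases
  · exact tri_201
  · exact tri_210

theorem UpperSector.min_neg (U : UpperSector n b c ε) (i : Fin 3) :
    lRank (n + 6) b ≤ lRank (n + 6) i := by
  rw [← not_lt, lRank_add_six, not_lt]
  exact U.max i

/-- The numerator of the intermediate column. -/
noncomputable def midVec (q r : ℝ → ℝ → ℂ) (b : Fin 3) (ε k : ℂ) : V3 :=
  ![-ε * sAdj q r k b 1, ε * sAdj q r k b 0, 0]

/-- The function `𝒲₁` (for `b = 0`) or `𝒲₄` (for `b = 1`). -/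
noncomputable def hatW (q r : ℝ → ℝ → ℂ) (b : Fin 3) (k : ℂ) : ℂ :=
  sAdj q r k b ⬝ᵥ sCol q r (-k) b

/-- The function `W₁` (for `b = 0`) or `W₄` (for `b = 1`). -/
noncomputable def outerW (q r : ℝ → ℝ → ℂ) (b : Fin 3) (k : ℂ) : ℂ :=
  sAdj q r k b ⬝ᵥ bCol q r k b

/-- The function `W₂` (for `(b,c) = (0,1)`) or `W₃` (for `(b,c) = (1,0)`). -/
noncomputable def innerW (q r : ℝ → ℝ → ℂ) (b c : Fin 3) (k : ℂ) : ℂ :=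
  sAdj q r k b b * bAdj q r k c c - sAdj q r k b c * bAdj q r k c b

/-- The numerator of the dominant column in the inner sectors. -/
noncomputable def innerVec (q r : ℝ → ℝ → ℂ) (b : Fin 3) (k : ℂ) : V3 :=
  sCol q r (-k) b - (sCol q r (-k) b 2 / sCol q r k 2 2) • sCol q r k 2

theorem UpperSector.sAdj_dot_sCol (h : IsHalfLineSolution q r) (U : UpperSector n b c ε)
    (hk : k ∈ closure (sector n)) : sAdj q r k b ⬝ᵥ sCol q r k 2 = 0 := by
  have hk' := weakSector_of_mem_closure hk
  exact avec_dot_vvec (h.isPot_iPot le_rfl) (fun i => hk'.l_le (U.min i))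
    (fun i => hk'.l_le (U.max i)) U.tri.ab

theorem UpperSector.isSpecCol_mid (h : IsHalfLineSolution q r) (hd : ZeroDirichlet q r)
    (U : UpperSector n b c ε) (hk : k ∈ closure (sector n)) (hs : sCol q r k 2 2 ≠ 0) :
    IsSpecCol q r n c k ((sCol q r k 2 2)⁻¹ • midVec q r b ε k) := by
  refine _root_.isSpecCol_mid h hd (weakSector_of_mem_closure hk) U.tri U.min U.max U.zmax hs
    ?_ ?_ ?_
  all_goals
    obtain ⟨rfl, rfl, rfl⟩ | ⟨rfl, rfl, rfl⟩ := U.cases <;> simp [midVec] <;> field_simp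

theorem UpperSector.isSpecCol_min (h : IsHalfLineSolution q r) (hd : ZeroDirichlet q r)
    (U : UpperSector n b c ε) (hk : k ∈ closure (sector n)) :
    IsSpecCol q r n 2 k (sCol q r k 2) := by
  -- Since `z_c` is the largest, `z₃` is either smallest or second largest; each case has its own
  -- form of the global relation.
  by_cases hz : ∀ i, zRank n 2 ≤ zRank n i
  · exact isSpecCol_min_of_cross h hd hk U.min hz
  · refine isSpecCol_min_of_dot h hd hk U.min U.zmax (fun i hi => ?_) U.tri.ac
    have h1 := U.zmax
    have h2 := U.cases
    clear hk U
    push Not at hz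
    obtain ⟨m, hm⟩ := hz
    have h3 : (b = 0 ∧ c = 1) ∨ (b = 1 ∧ c = 0) := h2.imp (fun h => ⟨h.1, h.2.1⟩)
      fun h => ⟨h.1, h.2.1⟩
    clear h2
    revert n b c i m
    decide

/-- The global relation at `-k`, where `l_b` is subdominant and `z_b` is still smallest, combined
with `S(-k) = S(k)`. -/
theorem UpperSector.exists_hat_eq (h : IsHalfLineSolution q r) (hd : ZeroDirichlet q r)
    (U : UpperSector n b c ε) (hz : ∀ i, zRank n b ≤ zRank n i) (hk : k ∈ closure (sector n)) :
    ∃ γ : ℂ, γ ≠ 0 ∧ sCol q r (-k) b = γ • bCol q r k b := by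
  have hk' := neg_mem_closure_sector hk
  have hw := weakSector_of_mem_closure hk'
  have h1 := sCol_cross_bCol h hd U.min_neg (by simpa only [zRank_add_six] using hz) hk'
  rw [bCol_neg] at h1
  have hb : bCol q r k b ≠ 0 := vvec_ne_zero (h.isPot_bPot hd) fun i =>
    (weakSector_of_mem_closure hk).z_le (hz i)
  obtain ⟨γ, hγ⟩ := eq_smul_of_cross_eq_zero hb h1
  refine ⟨γ, fun h0 => ?_, hγ⟩
  rw [h0, zero_smul] at hγ
  exact vvec_ne_zero (h.isPot_iPot le_rfl) (fun i => hw.l_le (U.min_neg i)) hγ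

theorem UpperSector.isSpecCol_outer (h : IsHalfLineSolution q r) (hd : ZeroDirichlet q r)
    (U : UpperSector n b c ε) (hz : ∀ i, zRank n b ≤ zRank n i) (hk : k ∈ closure (sector n))
    (hW : hatW q r b k ≠ 0) :
    IsSpecCol q r n b k ((hatW q r b k)⁻¹ • sCol q r (-k) b) := by
  obtain ⟨γ, -, hγ⟩ := U.exists_hat_eq h hd hz hk
  rw [hγ, smul_smul]
  refine isSpecCol_max_min h hd (weakSector_of_mem_closure hk) U.max hz ?_
  rw [mul_assoc, ← smul_eq_mul γ, ← dotProduct_smul, ← hγ]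
  exact inv_mul_cancel₀ hW

/-- The global relation at `-k` in its pairing form, again using that `S^A` is even in `k`. -/
theorem UpperSector.bAdj_dot_hat (h : IsHalfLineSolution q r) (hd : ZeroDirichlet q r)
    (U : UpperSector n b c ε) (hk : k ∈ closure (sector n)) :
    bAdj q r k c ⬝ᵥ sCol q r (-k) b = 0 := by
  have h1 := bAdj_dot_sCol h hd (a := b) (b := c) U.min_neg
    (by simpa only [zRank_add_six] using U.zmax)
    (by
      rw [zRank_add_six]
      exact lt_of_le_of_ne (U.zmax b) fun he => U.tri.bc (zRank_injective n he))
    (neg_mem_closure_sector hk)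
  rwa [bAdj_neg] at h1

theorem UpperSector.bAdj_dot_sCol (h : IsHalfLineSolution q r) (hd : ZeroDirichlet q r)
    (U : UpperSector n b c ε) (hk : k ∈ closure (sector n)) :
    bAdj q r k c ⬝ᵥ sCol q r k 2 = 0 :=
  _root_.bAdj_dot_sCol h hd U.min U.zmax
    (lt_of_le_of_ne (U.zmax 2) fun he => U.tri.ac (zRank_injective n he)) hk

theorem innerVec_two (hs : sCol q r k 2 2 ≠ 0) : innerVec q r b k 2 = 0 := by
  simp [innerVec]
  field_simp
  ring

theorem UpperSector.sAdj_dot_innerVec (h : IsHalfLineSolution q r)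
    (U : UpperSector n b c ε) (hk : k ∈ closure (sector n)) :
    sAdj q r k b ⬝ᵥ innerVec q r b k = hatW q r b k := by
  rw [innerVec, dotProduct_sub, dotProduct_smul, U.sAdj_dot_sCol h hk, smul_zero, sub_zero, hatW]

theorem UpperSector.bAdj_dot_innerVec (h : IsHalfLineSolution q r) (hd : ZeroDirichlet q r)
    (U : UpperSector n b c ε) (hk : k ∈ closure (sector n)) :
    bAdj q r k c ⬝ᵥ innerVec q r b k = 0 := by
  rw [innerVec, dotProduct_sub, dotProduct_smul, U.bAdj_dot_sCol h hd hk, U.bAdj_dot_hat h hd hk,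
    smul_zero, sub_zero]

/-- Subtracting a multiple of `s₃` from `ŝ_b` removes the third component. It changes neither
pairing, because `s₃` is orthogonal to both adjoint columns involved. -/
theorem UpperSector.isSpecCol_inner (h : IsHalfLineSolution q r) (hd : ZeroDirichlet q r)
    (U : UpperSector n b c ε) (hz : ∀ i, zRank n 2 ≤ zRank n i) (hk : k ∈ closure (sector n))
    (hs : sCol q r k 2 2 ≠ 0) (hW : innerW q r b c k ≠ 0) (hW' : hatW q r b k ≠ 0) :
    IsSpecCol q r n b k ((hatW q r b k)⁻¹ • innerVec q r b k) := by
  refine isSpecCol_max_mid h hd (weakSector_of_mem_closure hk) U.tri U.max U.zmax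
    (lt_of_le_of_ne (hz b) fun he => U.tri.ab (zRank_injective n he)) hW ?_ ?_ ?_
  · rw [dotProduct_smul, U.sAdj_dot_innerVec h hk, smul_eq_mul, inv_mul_cancel₀ hW']
  · rw [Pi.smul_apply, innerVec_two hs, smul_zero]
  · rw [dotProduct_smul, U.bAdj_dot_innerVec h hd hk, smul_zero]

/-- If `innerW` vanished but `hatW` did not, the linear equations for `innerVec` would make the
components `b` and `c` of the column of `S^A` zero. Orthogonality to `s₃` would then kill the third
one, contradicting that the column is nonzero. -/
theorem UpperSector.hatW_eq_zero (h : IsHalfLineSolution q r) (hd : ZeroDirichlet q r)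
    (U : UpperSector n b c ε) (hk : k ∈ closure (sector n)) (hs : sCol q r k 2 2 ≠ 0)
    (hW : innerW q r b c k = 0) : hatW q r b k = 0 := by
  have h1 := U.sAdj_dot_innerVec h hk
  have h2 := U.bAdj_dot_innerVec h hd hk
  have h3 := U.bAdj_dot_sCol h hd hk
  have hne : bAdj q r k c ≠ 0 := avec_ne_zero (h.isPot_bPot hd) fun i =>
    (weakSector_of_mem_closure hk).z_le (U.zmax i)
  rw [U.tri.dot, innerVec_two hs] at h1 h2
  rw [U.tri.dot] at h3
  rw [innerW] at hW
  by_contra h0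
  have hb : bAdj q r k c b = 0 := by
    refine (mul_eq_zero.1 (?_ : bAdj q r k c b * hatW q r b k = 0)).resolve_right h0
    rw [← h1]
    linear_combination -(innerVec q r b k c) * hW + sAdj q r k b b * h2
  have hc : bAdj q r k c c = 0 := by
    refine (mul_eq_zero.1 (?_ : bAdj q r k c c * hatW q r b k = 0)).resolve_right h0
    rw [← h1]
    linear_combination (innerVec q r b k b) * hW + sAdj q r k b c * h2
  rw [hb, hc, zero_mul, zero_mul, add_zero, add_zero] at h3
  refine hne (funext fun i => ?_)
  rcases U.tri.cover i with rfl | rfl | rfl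
  · exact (mul_eq_zero.1 h3).resolve_right hs
  · exact hb
  · exact hc

/-! ### Holomorphy of the spectral functions in the sectors -/

theorem differentiableAt_component {f : ℂ → V3} (hf : DifferentiableAt ℂ f k) (i : Fin 3) :
    DifferentiableAt ℂ (fun k => f k i) k := differentiableAt_pi.1 hf i

theorem UpperSector.differentiableAt_sCol (h : IsHalfLineSolution q r) (U : UpperSector n b c ε)
    (hk : k ∈ sector n) : DifferentiableAt ℂ (fun k => sCol q r k 2) k :=
  (differentiableOn_vvec (h.isPot_iPot le_rfl) differentiable_lx 2 (isOpen_sector n)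
    fun _ hk i => (weakSector_of_mem_closure (subset_closure hk)).l_le (U.min i)).differentiableAt
      ((isOpen_sector n).mem_nhds hk)

theorem UpperSector.differentiableAt_sAdj (h : IsHalfLineSolution q r) (U : UpperSector n b c ε)
    (hk : k ∈ sector n) : DifferentiableAt ℂ (fun k => sAdj q r k b) k :=
  (differentiableOn_vvec (h.isPot_iPot (t := 0) le_rfl).adj differentiable_neg_lx b
    (isOpen_sector n) fun _ hk i => by
      simpa using (weakSector_of_mem_closure (subset_closure hk)).l_le (U.max i)).differentiableAt
      ((isOpen_sector n).mem_nhds hk)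

theorem UpperSector.differentiableAt_hat (h : IsHalfLineSolution q r) (U : UpperSector n b c ε)
    (hk : k ∈ sector n) : DifferentiableAt ℂ (fun k => sCol q r (-k) b) k := by
  have h1 : DifferentiableAt ℂ (fun k => sCol q r k b) (-k) :=
    (differentiableOn_vvec (h.isPot_iPot le_rfl) differentiable_lx b (isOpen_sector (n + 6))
      fun _ hk i => (weakSector_of_mem_closure (subset_closure hk)).l_le
        (U.min_neg i)).differentiableAt ((isOpen_sector _).mem_nhds (neg_mem_sector hk))
  exact h1.comp k differentiableAt_id.neg

theorem UpperSector.differentiableAt_bAdj (h : IsHalfLineSolution q r) (hd : ZeroDirichlet q r)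
    (U : UpperSector n b c ε) (hk : k ∈ sector n) :
    DifferentiableAt ℂ (fun k => bAdj q r k c) k :=
  (differentiableOn_vvec (h.isPot_bPot hd).adj differentiable_neg_zt c
    (isOpen_sector n) fun _ hk i => by
      simpa using (weakSector_of_mem_closure (subset_closure hk)).z_le (U.zmax i)).differentiableAt
      ((isOpen_sector n).mem_nhds hk)

theorem differentiableAt_bCol (h : IsHalfLineSolution q r) (hd : ZeroDirichlet q r)
    (hz : ∀ i, zRank n b ≤ zRank n i) (hk : k ∈ sector n) :
    DifferentiableAt ℂ (fun k => bCol q r k b) k :=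
  (differentiableOn_vvec (h.isPot_bPot hd) differentiable_zt b (isOpen_sector n)
    fun _ hk i => (weakSector_of_mem_closure (subset_closure hk)).z_le (hz i)).differentiableAt
      ((isOpen_sector n).mem_nhds hk)

theorem differentiableAt_dot {f g : ℂ → V3} (hf : DifferentiableAt ℂ f k)
    (hg : DifferentiableAt ℂ g k) : DifferentiableAt ℂ (fun k => f k ⬝ᵥ g k) k := by
  have h1 := fun i => (differentiableAt_component hf i).mul (differentiableAt_component hg i)
  simp only [dot_three]
  exact ((h1 0).add (h1 1)).add (h1 2)

theorem UpperSector.differentiableAt_hatW (h : IsHalfLineSolution q r) (U : UpperSector n b c ε)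
    (hk : k ∈ sector n) : DifferentiableAt ℂ (hatW q r b) k :=
  differentiableAt_dot (U.differentiableAt_sAdj h hk) (U.differentiableAt_hat h hk)

theorem UpperSector.differentiableAt_midVec (h : IsHalfLineSolution q r) (U : UpperSector n b c ε)
    (hk : k ∈ sector n) : DifferentiableAt ℂ (midVec q r b ε) k := by
  have h1 := fun i => differentiableAt_component (U.differentiableAt_sAdj h hk) i
  refine differentiableAt_pi.2 fun i => ?_
  fin_cases i
  · exact (h1 1).const_mul _
  · exact (h1 0).const_mul _
  · exact differentiableAt_const _

theorem UpperSector.differentiableAt_innerVec (h : IsHalfLineSolution q r)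
    (U : UpperSector n b c ε) (hk : k ∈ sector n) (hs : sCol q r k 2 2 ≠ 0) :
    DifferentiableAt ℂ (innerVec q r b) k := by
  have h1 := U.differentiableAt_hat h hk
  have h2 := U.differentiableAt_sCol h hk
  exact h1.sub (((differentiableAt_component h1 2).div (differentiableAt_component h2 2) hs).smul h2)

/-! ### Residues -/

/-- Near `κ` the column is `1/f` times a combination of solutions entire in `k`, with coefficients
the components of `g`. At `κ` the residue is again a Lax solution, so its corner value identifies it
for all `x`, `t`. -/
theorem hasSimpleResidue_eigenCol (h : IsHalfLineSolution q r) (hd : ZeroDirichlet q r)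
    {j : Fin 3} {f : ℂ → ℂ} {g : ℂ → V3} {u : ℝ → ℝ → V3}
    (hf : ∀ᶠ k in 𝓝 κ, DifferentiableAt ℂ f k) (hg : ∀ᶠ k in 𝓝 κ, DifferentiableAt ℂ g k)
    (hf0 : f κ = 0) (hf' : deriv f κ ≠ 0)
    (hv : ∀ᶠ k in 𝓝[≠] κ, f k ≠ 0 → IsSpecCol q r n j k ((f k)⁻¹ • g k))
    (hu : IsLaxCol q r κ j u) (hu0 : u 0 0 = (deriv f κ)⁻¹ • g κ) {x t : ℝ} (hx : 0 ≤ x)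
    (ht : 0 ≤ t) (i : Fin 3) :
    HasSimpleResidue (fun k => eigenCol q r n j k x t i) κ (u x t i) := by
  choose Ψ hΨ hΨ0 hΨd using fun m : Fin 3 => exists_isLaxCol_param h hd j (e3 m)
  have hfκ := hf.self_of_nhds
  have hgκ := hg.self_of_nhds
  have hne : ∀ᶠ k in 𝓝[≠] κ, f k ≠ 0 := by
    have := hfκ.hasDerivAt.eventually_ne hf' (c := 0)
    exact this
  set F : ℂ → ℂ := fun k => g k 0 * Ψ 0 k x t i + g k 1 * Ψ 1 k x t i + g k 2 * Ψ 2 k x t i with hF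
  have hFd : ∀ k, DifferentiableAt ℂ g k → DifferentiableAt ℂ F k := fun k hk => by
    have h1 := fun m => (differentiableAt_component hk m).mul
      (differentiableAt_component (hΨd m x t hx ht k) i)
    exact ((h1 0).add (h1 1)).add (h1 2)
  have heq : ∀ᶠ k in 𝓝[≠] κ, eigenCol q r n j k x t i = (f k)⁻¹ * F k := by
    filter_upwards [hv, hne] with k hk hk0
    have h1 := (hk hk0).isLaxCol.eq_sum h hd (fun m => hΨ m k) (fun m => hΨ0 m k) hx ht
    rw [(hk hk0).corner] at h1
    rw [h1]
    simp only [Pi.add_apply, Pi.smul_apply, smul_eq_mul, hF]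
    ring
  have huF : u x t i = (deriv f κ)⁻¹ * F κ := by
    have h1 := hu.eq_sum h hd (fun m => hΨ m κ) (fun m => hΨ0 m κ) hx ht
    rw [h1, hu0]
    simp only [Pi.add_apply, Pi.smul_apply, smul_eq_mul, hF]
    ring
  constructor
  · have h1 := eventually_eventually_nhdsWithin.2 heq
    filter_upwards [h1, hne, self_mem_nhdsWithin, hf.filter_mono nhdsWithin_le_nhds,
      hg.filter_mono nhdsWithin_le_nhds] with k hk hk0 hkκ hkf hkg
    rw [IsOpen.nhdsWithin_eq isOpen_compl_singleton hkκ] at hk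
    exact ((hkf.inv hk0).mul (hFd k hkg)).congr_of_eventuallyEq hk
  · rw [huF]
    have h1 : Tendsto (fun k => (k - κ)⁻¹ * f k) (𝓝[≠] κ) (𝓝 (deriv f κ)) := by
      have := hfκ.hasDerivAt.tendsto_slope
      refine this.congr fun k => ?_
      rw [slope_def_field, hf0, sub_zero]
      ring
    have h2 := (h1.inv₀ hf').mul ((hFd κ hgκ).continuousAt.tendsto.mono_left
      (nhdsWithin_le_nhds (s := {κ}ᶜ)))
    refine h2.congr' ?_
    filter_upwards [heq] with k hk
    rw [hk, mul_inv, inv_inv]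
    ring

theorem UpperSector.eventually_mem (hκ : κ ∈ sector n) : ∀ᶠ k in 𝓝 κ, k ∈ sector n :=
  (isOpen_sector n).mem_nhds hκ

theorem UpperSector.residue_mid (h : IsHalfLineSolution q r) (hd : ZeroDirichlet q r)
    (U : UpperSector n b c ε) (hκ : κ ∈ sector n)
    (hz : IsSimpleZero (fun k => sCol q r k 2 2) κ) (hs : sCol q r κ 2 0 ≠ 0) {x t : ℝ}
    (hx : 0 ≤ x) (ht : 0 ≤ t) (i : Fin 3) :
    HasSimpleResidue (fun k => eigenCol q r n c k x t i) κ
      (midVec q r b ε κ 0 / (sCol q r κ 2 0 * deriv (fun k => sCol q r k 2 2) κ)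
        * exp (theta 2 c x t κ) * eigenCol q r n 2 κ x t i) := by
  have hS := U.isSpecCol_min h hd (subset_closure hκ)
  have hdot := U.sAdj_dot_sCol h (subset_closure hκ)
  have hs33 : sCol q r κ 2 2 = 0 := hz.1
  have := hasSimpleResidue_eigenCol h hd (n := n) (j := c) (f := fun k => sCol q r k 2 2)
    (g := midVec q r b ε)
    (u := fun x t => (midVec q r b ε κ 0 / (sCol q r κ 2 0 * deriv (fun k => sCol q r k 2 2) κ))
      • exp (theta 2 c x t κ) • eigenCol q r n 2 κ x t)
    ((UpperSector.eventually_mem hκ).mono fun k hk =>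
      differentiableAt_component (U.differentiableAt_sCol h hk) 2)
    ((UpperSector.eventually_mem hκ).mono fun k hk => U.differentiableAt_midVec h hk)
    hz.1 hz.2
    (((UpperSector.eventually_mem hκ).filter_mono nhdsWithin_le_nhds).mono fun k hk h0 =>
      U.isSpecCol_mid h hd (subset_closure hk) h0)
    ((hS.isLaxCol.exp_theta c).smul _) ?_ hx ht i
  · refine this.imp_right fun h => ?_
    simpa only [Pi.smul_apply, smul_eq_mul, mul_assoc] using h
  -- Because `s₃₃` vanishes at `κ`, orthogonality of `s₃` and the column of `s^A` makes the
  -- intermediate numerator proportional to `s₃`.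
  · simp only [theta, ofReal_zero, mul_zero, add_zero, Complex.exp_zero, one_smul, hS.corner]
    rw [dot_three, hs33] at hdot
    have hz2 := hz.2
    ext m
    simp only [Pi.smul_apply, smul_eq_mul]
    field_simp
    fin_cases m
    · simp [midVec]
      ring
    · simp [midVec]
      linear_combination -ε * hdot
    · simp [midVec, hs33]

theorem UpperSector.residue_outer (h : IsHalfLineSolution q r) (hd : ZeroDirichlet q r)
    (U : UpperSector n b c ε) (hzb : ∀ i, zRank n b ≤ zRank n i) (hκ : κ ∈ sector n)
    (hz : IsSimpleZero (outerW q r b) κ) (hs : sCol q r κ 2 2 ≠ 0)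
    (hm : ε * sAdj q r κ b 2 ≠ 0) :
    deriv (hatW q r b) κ ≠ 0 ∧ ∀ x t : ℝ, 0 ≤ x → 0 ≤ t → ∀ i,
    HasSimpleResidue (fun k => eigenCol q r n b k x t i) κ
      (1 / deriv (hatW q r b) κ *
        ((sCol q r (-κ) b 0 * sCol q r κ 2 1 - sCol q r (-κ) b 1 * sCol q r κ 2 0)
            / (ε * sAdj q r κ b 2) * exp (theta c b x t κ) * eigenCol q r n c κ x t i
          + sCol q r (-κ) b 2 / sCol q r κ 2 2 * exp (theta 2 b x t κ)
            * eigenCol q r n 2 κ x t i)) := by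
  have hcl := subset_closure hκ
  have hd0 : hatW q r b κ = 0 := by
    obtain ⟨γ, -, hγ⟩ := U.exists_hat_eq h hd hzb hcl
    rw [hatW, hγ, dotProduct_smul]
    have := hz.1
    rw [outerW] at this
    rw [this, smul_zero]
  have hder : deriv (hatW q r b) κ ≠ 0 := by
    obtain ⟨γ, hγ0, hγ⟩ := U.exists_hat_eq h hd hzb hcl
    have hb : bCol q r κ b ≠ 0 := vvec_ne_zero (h.isPot_bPot hd) fun i =>
      (weakSector_of_mem_closure hcl).z_le (hzb i)
    obtain ⟨i, hi⟩ : ∃ i, bCol q r κ b i ≠ 0 := by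
      by_contra! hall
      exact hb (funext hall)
    -- Parallelism of `ŝ_b` and `S_b` is stated without the factor `γ`, so the product rule at `κ`
    -- applies without regularity of `γ`. It transfers the simplicity of the zero from `outerW` to
    -- `hatW`.
    have hprod : (fun k => hatW q r b k * bCol q r k b i)
        =ᶠ[𝓝 κ] fun k => sCol q r (-k) b i * outerW q r b k := by
      filter_upwards [UpperSector.eventually_mem hκ] with k hk
      obtain ⟨γ, -, hγ⟩ := U.exists_hat_eq h hd hzb (subset_closure hk)
      rw [hatW, outerW, hγ, dotProduct_smul, Pi.smul_apply, smul_eq_mul, smul_eq_mul]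
      ring
    have h1 := (U.differentiableAt_hatW h hκ).hasDerivAt.mul
      (differentiableAt_component (differentiableAt_bCol h hd hzb hκ) i).hasDerivAt
    have hoW : DifferentiableAt ℂ (outerW q r b) κ :=
      differentiableAt_dot (U.differentiableAt_sAdj h hκ) (differentiableAt_bCol h hd hzb hκ)
    have h2 := (differentiableAt_component (U.differentiableAt_hat h hκ) i).hasDerivAt.mul
      hoW.hasDerivAt
    have h3 := (h1.congr_of_eventuallyEq hprod.symm).unique h2
    rw [hd0, hz.1, zero_mul, mul_zero, add_zero, zero_add] at h3
    intro h0
    rw [h0, zero_mul] at h3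
    have h4 := mul_eq_zero.1 h3.symm
    rcases h4 with h4 | h4
    · rw [hγ, Pi.smul_apply, smul_eq_mul] at h4
      exact (mul_ne_zero hγ0 hi) h4
    · exact hz.2 h4
  refine ⟨hder, fun x t hx ht i => ?_⟩
  have hS := U.isSpecCol_min h hd hcl
  have hM := U.isSpecCol_mid h hd hcl hs
  have hdot := U.sAdj_dot_sCol h hcl
  have hdot' := hd0
  have := hasSimpleResidue_eigenCol h hd (n := n) (j := b) (f := hatW q r b)
    (g := fun k => sCol q r (-k) b)
    (u := fun x t => (1 / deriv (hatW q r b) κ) •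
      (((sCol q r (-κ) b 0 * sCol q r κ 2 1 - sCol q r (-κ) b 1 * sCol q r κ 2 0)
            / (ε * sAdj q r κ b 2)) • exp (theta c b x t κ) • eigenCol q r n c κ x t
          + (sCol q r (-κ) b 2 / sCol q r κ 2 2) • exp (theta 2 b x t κ)
            • eigenCol q r n 2 κ x t))
    ((UpperSector.eventually_mem hκ).mono fun k hk => U.differentiableAt_hatW h hk)
    ((UpperSector.eventually_mem hκ).mono fun k hk => U.differentiableAt_hat h hk)
    hd0 hder
    (((UpperSector.eventually_mem hκ).filter_mono nhdsWithin_le_nhds).mono fun k hk h0 =>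
      U.isSpecCol_outer h hd hzb (subset_closure hk) h0)
    ((((hM.isLaxCol.exp_theta b).smul _).add ((hS.isLaxCol.exp_theta b).smul _)).smul _)
    ?_ hx ht i
  · refine this.imp_right fun h => ?_
    simpa only [Pi.smul_apply, Pi.add_apply, smul_eq_mul, mul_assoc] using h
  · simp only [theta, ofReal_zero, mul_zero, add_zero, Complex.exp_zero, one_smul, hS.corner,
      hM.corner, one_div]
    congr 1
    rw [hatW, dot_three] at hdot'
    rw [dot_three] at hdot
    have hε := left_ne_zero_of_mul hm
    have hA := right_ne_zero_of_mul hm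
    ext m
    simp only [Pi.smul_apply, Pi.add_apply, smul_eq_mul]
    field_simp
    fin_cases m
    · simp [midVec]
      linear_combination (ε * sCol q r κ 2 0) * hdot' - (ε * sCol q r (-κ) b 0) * hdot
    · simp [midVec]
      linear_combination (ε * sCol q r κ 2 1) * hdot' - (ε * sCol q r (-κ) b 1) * hdot
    · simp [midVec]
      try ring

theorem UpperSector.residue_inner (h : IsHalfLineSolution q r) (hd : ZeroDirichlet q r)
    (U : UpperSector n b c ε) (hz2 : ∀ i, zRank n 2 ≤ zRank n i) (hκ : κ ∈ sector n)
    (hz : IsSimpleZero (innerW q r b c) κ) (hs : sCol q r κ 2 2 ≠ 0)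
    (hm : midVec q r b ε κ 0 ≠ 0) (hder : deriv (hatW q r b) κ ≠ 0) {x t : ℝ}
    (hx : 0 ≤ x) (ht : 0 ≤ t) (i : Fin 3) :
    HasSimpleResidue (fun k => eigenCol q r n b k x t i) κ
      ((sCol q r (-κ) b 0 * sCol q r κ 2 2 - sCol q r (-κ) b 2 * sCol q r κ 2 0)
        / (deriv (hatW q r b) κ * midVec q r b ε κ 0)
        * exp (theta c b x t κ) * eigenCol q r n c κ x t i) := by
  have hcl := subset_closure hκ
  have hd0 := U.hatW_eq_zero h hd hcl hs hz.1
  have hM := U.isSpecCol_mid h hd hcl hs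
  have hsn : ∀ᶠ k in 𝓝 κ, sCol q r k 2 2 ≠ 0 :=
    (differentiableAt_component (U.differentiableAt_sCol h hκ) 2).continuousAt.eventually_ne hs
  have hiW : ∀ᶠ k in 𝓝[≠] κ, innerW q r b c k ≠ 0 := by
    have h1 := fun i => differentiableAt_component (U.differentiableAt_sAdj h hκ) i
    have h2 := fun i => differentiableAt_component (U.differentiableAt_bAdj h hd hκ) i
    have h3 : DifferentiableAt ℂ (innerW q r b c) κ :=
      ((h1 b).mul (h2 c)).sub ((h1 c).mul (h2 b))
    exact h3.hasDerivAt.eventually_ne hz.2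
  have := hasSimpleResidue_eigenCol h hd (n := n) (j := b) (f := hatW q r b)
    (g := innerVec q r b)
    (u := fun x t => ((sCol q r (-κ) b 0 * sCol q r κ 2 2 - sCol q r (-κ) b 2 * sCol q r κ 2 0)
        / (deriv (hatW q r b) κ * midVec q r b ε κ 0))
        • exp (theta c b x t κ) • eigenCol q r n c κ x t)
    ((UpperSector.eventually_mem hκ).mono fun k hk => U.differentiableAt_hatW h hk)
    (by
      filter_upwards [UpperSector.eventually_mem hκ, hsn] with k hk hk0
      exact U.differentiableAt_innerVec h hk hk0)
    hd0 hder
    (by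
      filter_upwards [(UpperSector.eventually_mem hκ).filter_mono nhdsWithin_le_nhds,
        hsn.filter_mono nhdsWithin_le_nhds, hiW] with k hk hk0 hkW h0
      exact U.isSpecCol_inner h hd hz2 (subset_closure hk) hk0 hkW h0)
    ((hM.isLaxCol.exp_theta b).smul _) ?_ hx ht i
  · refine this.imp_right fun h => ?_
    simpa only [Pi.smul_apply, smul_eq_mul, mul_assoc] using h
  -- At `κ` both `innerVec` and `midVec` have zero third component and are orthogonal to the same
  -- column of `s^A`, hence they are proportional.
  · simp only [theta, ofReal_zero, mul_zero, add_zero, Complex.exp_zero, one_smul, hM.corner]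
    have h1 := U.sAdj_dot_innerVec h hcl
    rw [dot_three, hd0, innerVec_two hs] at h1
    have hε : ε ≠ 0 := by
      rintro rfl
      simp [midVec] at hm
    have hA : sAdj q r κ b 1 ≠ 0 := by
      intro h0
      simp [midVec, h0] at hm
    ext m
    simp only [Pi.smul_apply, smul_eq_mul]
    fin_cases m
    · simp [midVec, innerVec]
      field_simp
    · simp [midVec, innerVec] at h1 ⊢
      field_simp at h1 ⊢
      linear_combination -h1
    · have h2 := innerVec_two (b := b) hs
      simp [midVec]
      exact Or.inr h2

end Upper

/-! ### Jump matrices -/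

section Jumps

variable {q r : ℝ → ℝ → ℂ} {n : Fin 12} {k : ℂ} {b c : Fin 3} {ε : ℂ}

theorem upperSector_one : UpperSector 1 0 1 1 :=
  ⟨Or.inl ⟨rfl, rfl, rfl⟩, by decide, by decide, by decide⟩

theorem upperSector_two : UpperSector 2 0 1 1 :=
  ⟨Or.inl ⟨rfl, rfl, rfl⟩, by decide, by decide, by decide⟩

theorem upperSector_three : UpperSector 3 1 0 (-1) :=
  ⟨Or.inr ⟨rfl, rfl, rfl⟩, by decide, by decide, by decide⟩

theorem upperSector_four : UpperSector 4 1 0 (-1) :=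
  ⟨Or.inr ⟨rfl, rfl, rfl⟩, by decide, by decide, by decide⟩

theorem UpperSector.isSpecCol_outer' (h : IsHalfLineSolution q r) (hd : ZeroDirichlet q r)
    (U : UpperSector n b c ε) (hz : ∀ i, zRank n b ≤ zRank n i) (hk : k ∈ closure (sector n))
    (hW : outerW q r b k ≠ 0) :
    IsSpecCol q r n b k ((outerW q r b k)⁻¹ • bCol q r k b) :=
  isSpecCol_max_min h hd (weakSector_of_mem_closure hk) U.max hz (inv_mul_cancel₀ hW)

/-- Cramer's rule in terms of `S^A`. This form requires only `innerW ≠ 0`, so it yields uniqueness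
on the boundary without a condition on `hatW`. -/
theorem UpperSector.isSpecCol_inner' (h : IsHalfLineSolution q r) (hd : ZeroDirichlet q r)
    (U : UpperSector n b c ε) (hz : ∀ i, zRank n 2 ≤ zRank n i) (hk : k ∈ closure (sector n))
    (hW : innerW q r b c k ≠ 0) :
    ∃ v, IsSpecCol q r n b k v := by
  have hT := U.tri
  refine ⟨fun i => if i = b then bAdj q r k c c / innerW q r b c k else
    if i = c then -bAdj q r k c b / innerW q r b c k else 0, ?_⟩
  refine isSpecCol_max_mid h hd (weakSector_of_mem_closure hk) hT U.max U.zmax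
    (lt_of_le_of_ne (hz b) fun he => hT.ab (zRank_injective n he)) hW ?_ ?_ ?_
  · rw [hT.dot, if_neg hT.ab, if_neg hT.ac, if_pos rfl, if_neg hT.bc.symm, if_pos rfl]
    field_simp
    rw [innerW]
    ring
  · rw [if_neg hT.ab, if_neg hT.ac]
  · rw [hT.dot, if_neg hT.ab, if_neg hT.ac, if_pos rfl, if_neg hT.bc.symm, if_pos rfl]
    ring

theorem UpperSector.cornerUnique (h : IsHalfLineSolution q r) (hd : ZeroDirichlet q r)
    (U : UpperSector n b c ε) (hk : k ∈ closure (sector n)) (hs : sCol q r k 2 2 ≠ 0)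
    (hW : CornerUnique q r n b k) (j : Fin 3) : CornerUnique q r n j k := by
  rcases U.tri.cover j with rfl | rfl | rfl
  · exact (U.isSpecCol_min h hd hk).cornerUnique
  · exact hW
  · exact (U.isSpecCol_mid h hd hk hs).cornerUnique

theorem UpperSector.hatW_ne_zero (h : IsHalfLineSolution q r) (hd : ZeroDirichlet q r)
    (U : UpperSector n b c ε) (hz : ∀ i, zRank n b ≤ zRank n i) (hk : k ∈ closure (sector n))
    (hW : outerW q r b k ≠ 0) : hatW q r b k ≠ 0 := by
  obtain ⟨γ, hγ0, hγ⟩ := U.exists_hat_eq h hd hz hk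
  rw [hatW, hγ, dotProduct_smul, smul_eq_mul]
  exact mul_ne_zero hγ0 hW

/-! ### The matrices `S_n` assembled from their columns, and their quotients -/

/-- The matrix with given columns. -/
def matOf (u v w : V3) : Mat3 := !![u 0, v 0, w 0; u 1, v 1, w 1; u 2, v 2, w 2]

theorem specS_eq_matOf {u v w : V3} (hu : IsSpecCol q r n 0 k u) (hv : IsSpecCol q r n 1 k v)
    (hw : IsSpecCol q r n 2 k w) : specS q r n k = matOf u v w := by
  ext i j
  fin_cases i <;> fin_cases j <;> simp [specS, matOf, hu.corner, hv.corner, hw.corner]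

theorem jump_eq_of_mul {m n : Fin 12} {K : Mat3} (hdet : (specS q r m k).det = 1)
    (hK : specS q r n k = specS q r m k * K) (x t : ℝ) :
    jump q r m n x t k = Matrix.of fun i j => exp (theta i j x t k) * K i j := by
  rw [jump, hK, Matrix.nonsing_inv_mul_cancel_left _ _ (by rw [hdet]; exact isUnit_one)]

/-- Eliminating with `A · s = 0` reduces the determinant to `A · v`. -/
theorem det_matOf_left {v A s : V3} (hs : s 2 ≠ 0) (hv : A ⬝ᵥ v = 1) (hA : A ⬝ᵥ s = 0) :
    (matOf v ((s 2)⁻¹ • ![-1 * A 1, 1 * A 0, 0]) s).det = 1 := by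
  rw [dot_three] at hv hA
  simp [matOf, Matrix.det_fin_three]
  field_simp
  linear_combination (s 2) * hv - (v 2) * hA

theorem det_matOf_right {v A s : V3} (hs : s 2 ≠ 0) (hv : A ⬝ᵥ v = 1) (hA : A ⬝ᵥ s = 0) :
    (matOf ((s 2)⁻¹ • ![-(-1) * A 1, -1 * A 0, 0]) v s).det = 1 := by
  rw [dot_three] at hv hA
  simp [matOf, Matrix.det_fin_three]
  field_simp
  linear_combination (s 2) * hv - (v 2) * hA

theorem theta_self (i : Fin 3) (x t : ℝ) (k : ℂ) : theta i i x t k = 0 := by simp [theta]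


theorem specS_one (h : IsHalfLineSolution q r) (hd : ZeroDirichlet q r)
    (hk : k ∈ closure (sector 1)) (hs : sCol q r k 2 2 ≠ 0) (hW : hatW q r 0 k ≠ 0) :
    specS q r 1 k = matOf ((hatW q r 0 k)⁻¹ • sCol q r (-k) 0)
      ((sCol q r k 2 2)⁻¹ • midVec q r 0 1 k) (sCol q r k 2) :=
  specS_eq_matOf (upperSector_one.isSpecCol_outer h hd (by decide) hk hW)
    (upperSector_one.isSpecCol_mid h hd hk hs) (upperSector_one.isSpecCol_min h hd hk)

theorem specS_two (h : IsHalfLineSolution q r) (hd : ZeroDirichlet q r)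
    (hk : k ∈ closure (sector 2)) (hs : sCol q r k 2 2 ≠ 0) (hW : hatW q r 0 k ≠ 0)
    (hW' : innerW q r 0 1 k ≠ 0) :
    specS q r 2 k = matOf ((hatW q r 0 k)⁻¹ • innerVec q r 0 k)
      ((sCol q r k 2 2)⁻¹ • midVec q r 0 1 k) (sCol q r k 2) :=
  specS_eq_matOf (upperSector_two.isSpecCol_inner h hd (by decide) hk hs hW' hW)
    (upperSector_two.isSpecCol_mid h hd hk hs) (upperSector_two.isSpecCol_min h hd hk)

theorem specS_three (h : IsHalfLineSolution q r) (hd : ZeroDirichlet q r)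
    (hk : k ∈ closure (sector 3)) (hs : sCol q r k 2 2 ≠ 0) (hW : hatW q r 1 k ≠ 0)
    (hW' : innerW q r 1 0 k ≠ 0) :
    specS q r 3 k = matOf ((sCol q r k 2 2)⁻¹ • midVec q r 1 (-1) k)
      ((hatW q r 1 k)⁻¹ • innerVec q r 1 k) (sCol q r k 2) :=
  specS_eq_matOf (upperSector_three.isSpecCol_mid h hd hk hs)
    (upperSector_three.isSpecCol_inner h hd (by decide) hk hs hW' hW)
    (upperSector_three.isSpecCol_min h hd hk)

/-- The second column is kept in terms of `S`, since in `D₅` it has the same expression and the two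
cancel in the jump. -/
theorem specS_four (h : IsHalfLineSolution q r) (hd : ZeroDirichlet q r)
    (hk : k ∈ closure (sector 4)) (hs : sCol q r k 2 2 ≠ 0) (hW : outerW q r 1 k ≠ 0) :
    specS q r 4 k = matOf ((sCol q r k 2 2)⁻¹ • midVec q r 1 (-1) k)
      ((outerW q r 1 k)⁻¹ • bCol q r k 1) (sCol q r k 2) :=
  specS_eq_matOf (upperSector_four.isSpecCol_mid h hd hk hs)
    (upperSector_four.isSpecCol_outer' h hd (by decide) hk hW)
    (upperSector_four.isSpecCol_min h hd hk)

theorem specS_five (h : IsHalfLineSolution q r) (hd : ZeroDirichlet q r)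
    (hk : k ∈ closure (sector 5)) (hs : sCol q r k 0 0 ≠ 0) (hW : outerW q r 1 k ≠ 0) :
    specS q r 5 k = matOf (sCol q r k 0) ((outerW q r 1 k)⁻¹ • bCol q r k 1)
      ((sCol q r k 0 0)⁻¹ • ![0, -sAdj q r k 1 2, sAdj q r k 1 1]) := by
  have hk' := weakSector_of_mem_closure hk
  refine specS_eq_matOf (isSpecCol_min_of_dot h hd hk (b := 2) (by decide) (by decide) (by decide)
    (by decide)) (isSpecCol_max_min h hd hk' (by decide) (by decide) (inv_mul_cancel₀ hW))
    (isSpecCol_mid h hd hk' tri_012 (by decide) (by decide) (by decide) hs ?_ ?_ ?_)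
  all_goals
    simp
    try field_simp

/-- The two matrices differ only in the first column, where `innerVec` is `ŝ₁` minus a multiple of
the third column `s₃`. -/
theorem jump_one_two (h : IsHalfLineSolution q r) (hd : ZeroDirichlet q r)
    (hk1 : k ∈ closure (sector 1)) (hk2 : k ∈ closure (sector 2)) (hs : sCol q r k 2 2 ≠ 0)
    (hW : hatW q r 0 k ≠ 0) (hW' : innerW q r 0 1 k ≠ 0) (x t : ℝ) :
    jump q r 1 2 x t k = !![1, 0, 0; 0, 1, 0;
      -(exp (theta 2 0 x t k) * sCol q r (-k) 0 2 / (sCol q r k 2 2 * hatW q r 0 k)), 0, 1] := by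
  have h1 := specS_one h hd hk1 hs hW
  have hdet : (specS q r 1 k).det = 1 := by
    rw [h1]
    refine det_matOf_left hs ?_ (upperSector_one.sAdj_dot_sCol h hk1)
    rw [dotProduct_smul, smul_eq_mul]
    exact inv_mul_cancel₀ hW
  rw [jump_eq_of_mul (K := !![1, 0, 0; 0, 1, 0;
    -(sCol q r (-k) 0 2 / (sCol q r k 2 2 * hatW q r 0 k)), 0, 1]) hdet]
  · ext i j
    fin_cases i <;> fin_cases j <;> simp [theta_self]
    ring
  · rw [h1, specS_two h hd hk2 hs hW hW']
    ext i j
    fin_cases i <;> fin_cases j <;>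
      simp [matOf, Matrix.mul_apply, Fin.sum_univ_three, innerVec, midVec] <;> field_simp <;> ring

theorem jump_three_four (h : IsHalfLineSolution q r) (hd : ZeroDirichlet q r)
    (hk3 : k ∈ closure (sector 3)) (hk4 : k ∈ closure (sector 4)) (hs : sCol q r k 2 2 ≠ 0)
    (hW : hatW q r 1 k ≠ 0) (hW' : innerW q r 1 0 k ≠ 0) (x t : ℝ) :
    jump q r 3 4 x t k = !![1, 0, 0; 0, 1, 0;
      0, exp (theta 2 1 x t k) * sCol q r (-k) 1 2 / (sCol q r k 2 2 * hatW q r 1 k), 1] := by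
  have h3 := specS_three h hd hk3 hs hW hW'
  have h4 := specS_eq_matOf (upperSector_four.isSpecCol_mid h hd hk4 hs)
    (upperSector_four.isSpecCol_outer h hd (by decide) hk4 hW)
    (upperSector_four.isSpecCol_min h hd hk4)
  have hdet : (specS q r 3 k).det = 1 := by
    rw [h3]
    refine det_matOf_right hs ?_ (upperSector_three.sAdj_dot_sCol h hk3)
    rw [dotProduct_smul, smul_eq_mul, upperSector_three.sAdj_dot_innerVec h hk3]
    exact inv_mul_cancel₀ hW
  rw [jump_eq_of_mul (K := !![1, 0, 0; 0, 1, 0;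
    0, sCol q r (-k) 1 2 / (sCol q r k 2 2 * hatW q r 1 k), 1]) hdet]
  · ext i j
    fin_cases i <;> fin_cases j <;> simp [theta_self]
    ring
  · rw [h3, h4]
    ext i j
    fin_cases i <;> fin_cases j <;>
      simp [matOf, Matrix.mul_apply, Fin.sum_univ_three, innerVec, midVec] <;> field_simp <;> ring

theorem tri_120 : Tri 1 2 0 1 := by
  constructor <;> first | decide | (intros; simp [cross_apply, dot_three]; try ring)

theorem jump_two_three (h : IsHalfLineSolution q r) (hd : ZeroDirichlet q r)
    (hk2 : k ∈ closure (sector 2)) (hk3 : k ∈ closure (sector 3)) (hs : sCol q r k 2 2 ≠ 0)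
    (hW1 : hatW q r 0 k ≠ 0) (hW1' : innerW q r 0 1 k ≠ 0) (hW4 : hatW q r 1 k ≠ 0)
    (hW4' : innerW q r 1 0 k ≠ 0) (x t : ℝ) :
    jump q r 2 3 x t k =
      !![1, exp (theta 0 1 x t k) * (sCol q r (-k) 1 ⬝ᵥ sAdj q r k 0) / hatW q r 1 k, 0;
        -(exp (theta 1 0 x t k) * (sCol q r (-k) 0 ⬝ᵥ sAdj q r k 1) / hatW q r 0 k),
        1 - (sCol q r (-k) 1 ⬝ᵥ sAdj q r k 0) * (sCol q r (-k) 0 ⬝ᵥ sAdj q r k 1)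
          / (hatW q r 0 k * hatW q r 1 k), 0;
        0, 0, 1] := by
  have h2 := specS_two h hd hk2 hs hW1 hW1'
  have h3 := specS_three h hd hk3 hs hW4 hW4'
  have hdet : (specS q r 2 k).det = 1 := by
    rw [h2]
    refine det_matOf_left hs ?_ (upperSector_two.sAdj_dot_sCol h hk2)
    rw [dotProduct_smul, smul_eq_mul, upperSector_two.sAdj_dot_innerVec h hk2]
    exact inv_mul_cancel₀ hW1
  -- On the common ray `l₁` and `l₂` share the largest real part, so both columns of `s^A` exist and
  -- their cross product is `s₃`.
  have hcr := avec_cross_avec (h.isPot_iPot (t := 0) le_rfl) (lx_sum k) (iPot_trace 0) tri_120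
    (fun i => (weakSector_of_mem_closure hk3).l_le (upperSector_three.max i))
    (fun i => (weakSector_of_mem_closure hk2).l_le (upperSector_two.max i))
    (fun i => (weakSector_of_mem_closure hk2).l_le (upperSector_two.min i))
  rw [one_smul] at hcr
  have c0 := congrFun hcr 0
  have c1 := congrFun hcr 1
  have c2 := congrFun hcr 2
  simp only [cross_apply, Matrix.cons_val_zero, Matrix.cons_val_one, Matrix.cons_val] at c0 c1 c2
  change _ = sCol q r k 2 0 at c0
  change _ = sCol q r k 2 1 at c1
  change _ = sCol q r k 2 2 at c2
  have e1 : hatW q r 0 k = sAdj q r k 0 0 * sCol q r (-k) 0 0 + sAdj q r k 0 1 * sCol q r (-k) 0 1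
    + sAdj q r k 0 2 * sCol q r (-k) 0 2 := dot_three _ _
  have e4 : hatW q r 1 k = sAdj q r k 1 0 * sCol q r (-k) 1 0 + sAdj q r k 1 1 * sCol q r (-k) 1 1
    + sAdj q r k 1 2 * sCol q r (-k) 1 2 := dot_three _ _
  set P := sCol q r (-k) 1 ⬝ᵥ sAdj q r k 0 with hP
  set Q := sCol q r (-k) 0 ⬝ᵥ sAdj q r k 1 with hQ
  rw [dot_three] at hP hQ
  -- These four identities are components of the triple product rule for `ŝ_b × s₃`, with `s₃`
  -- written as the cross product above.
  have E0 : sAdj q r k 1 1 * hatW q r 0 k = sCol q r (-k) 0 0 * sCol q r k 2 2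
      - sCol q r (-k) 0 2 * sCol q r k 2 0 + Q * sAdj q r k 0 1 := by
    linear_combination sAdj q r k 1 1 * e1 - sAdj q r k 0 1 * hQ + sCol q r (-k) 0 0 * c2
      - sCol q r (-k) 0 2 * c0
  have E1 : -(sAdj q r k 1 0 * hatW q r 0 k) = sCol q r (-k) 0 1 * sCol q r k 2 2
      - sCol q r (-k) 0 2 * sCol q r k 2 1 - Q * sAdj q r k 0 0 := by
    linear_combination -sAdj q r k 1 0 * e1 + sAdj q r k 0 0 * hQ + sCol q r (-k) 0 1 * c2
      - sCol q r (-k) 0 2 * c1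
  have F0 : sCol q r (-k) 1 0 * sCol q r k 2 2 - sCol q r (-k) 1 2 * sCol q r k 2 0
      = P * sAdj q r k 1 1 - sAdj q r k 0 1 * hatW q r 1 k := by
    linear_combination sAdj q r k 0 1 * e4 - sAdj q r k 1 1 * hP - sCol q r (-k) 1 0 * c2
      + sCol q r (-k) 1 2 * c0
  have F1 : sCol q r (-k) 1 1 * sCol q r k 2 2 - sCol q r (-k) 1 2 * sCol q r k 2 1
      = -(P * sAdj q r k 1 0) + sAdj q r k 0 0 * hatW q r 1 k := by
    linear_combination -sAdj q r k 0 0 * e4 + sAdj q r k 1 0 * hP - sCol q r (-k) 1 1 * c2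
      + sCol q r (-k) 1 2 * c1
  rw [jump_eq_of_mul (K := !![1, P / hatW q r 1 k, 0;
    -(Q / hatW q r 0 k), 1 - P * Q / (hatW q r 0 k * hatW q r 1 k), 0; 0, 0, 1]) hdet]
  · ext i j
    fin_cases i <;> fin_cases j <;> simp [theta_self] <;> ring
  · rw [h2, h3]
    ext i j
    fin_cases i <;> fin_cases j <;>
      simp [matOf, Matrix.mul_apply, Fin.sum_univ_three, innerVec, midVec] <;> field_simp
    · linear_combination E0
    · linear_combination hatW q r 0 k * F0 + P * E0
    · linear_combination E1
    · linear_combination hatW q r 0 k * F1 + P * E1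
    · exact Or.inr (by ring)
    · ring

theorem jump_four_five (h : IsHalfLineSolution q r) (hd : ZeroDirichlet q r)
    (hk4 : k ∈ closure (sector 4)) (hk5 : k ∈ closure (sector 5)) (hs : sCol q r k 2 2 ≠ 0)
    (hs' : sCol q r k 0 0 ≠ 0) (hW : outerW q r 1 k ≠ 0) (x t : ℝ) :
    jump q r 4 5 x t k =
      !![1, 0, -(exp (theta 0 2 x t k) * sCol q r k 2 0 / sCol q r k 0 0); 0, 1, 0;
        exp (theta 2 0 x t k) * sCol q r k 0 2 / sCol q r k 2 2, 0,
        sAdj q r k 1 1 / (sCol q r k 0 0 * sCol q r k 2 2)] := by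
  have h4 := specS_four h hd hk4 hs hW
  have h5 := specS_five h hd hk5 hs' hW
  have hdot := upperSector_four.sAdj_dot_sCol h hk4
  have hdet : (specS q r 4 k).det = 1 := by
    rw [h4]
    refine det_matOf_right hs ?_ hdot
    rw [dotProduct_smul, smul_eq_mul]
    exact inv_mul_cancel₀ hW
  -- On this ray `l₁` and `l₃` share the smallest real part, so the cross product of the two columns
  -- of `s` gives the column of `s^A` entering both matrices.
  have hcr := vvec_cross_vvec (h.isPot_iPot (t := 0) le_rfl) (lx_sum k) (iPot_trace 0) tri_012
    (fun i => (weakSector_of_mem_closure hk5).l_le (by revert i; decide))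
    (fun i => (weakSector_of_mem_closure hk4).l_le (upperSector_four.min i))
    (fun i => (weakSector_of_mem_closure hk4).l_le (upperSector_four.max i))
  rw [one_smul] at hcr
  have c0 := congrFun hcr 0
  have c1 := congrFun hcr 1
  simp only [cross_apply, Matrix.cons_val_zero, Matrix.cons_val_one] at c0 c1
  change _ = sAdj q r k 1 0 at c0
  change _ = sAdj q r k 1 1 at c1
  rw [dot_three] at hdot
  rw [jump_eq_of_mul (K := !![1, 0, -(sCol q r k 2 0 / sCol q r k 0 0); 0, 1, 0;
    sCol q r k 0 2 / sCol q r k 2 2, 0,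
    sAdj q r k 1 1 / (sCol q r k 0 0 * sCol q r k 2 2)]) hdet]
  · ext i j
    fin_cases i <;> fin_cases j <;> simp [theta_self] <;> ring
  · rw [h4, h5]
    ext i j
    fin_cases i <;> fin_cases j <;>
      simp [matOf, Matrix.mul_apply, Fin.sum_univ_three, midVec] <;> try field_simp
    · linear_combination c1
    · ring
    · linear_combination -c0
    · linear_combination -hdot

end Jumps

/-! ### The main theorem -/

/-! ### Translation between matrix entries, minors and vectors -/

section Translation

variable {q r : ℝ → ℝ → ℂ} {q₀ r₀ : ℝ → ℂ}

theorem calW1_eq (hinit : ∀ x : ℝ, 0 < x → q x 0 = q₀ x ∧ r x 0 = r₀ x) :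
    calW1 q₀ r₀ = hatW q r 0 := by
  funext k
  simp [calW1, combOne, minorOf, sMat_apply hinit, sCof_apply hinit, hatW, dot_three]
  ring

theorem calW4_eq (hinit : ∀ x : ℝ, 0 < x → q x 0 = q₀ x ∧ r x 0 = r₀ x) :
    calW4 q₀ r₀ = hatW q r 1 := by
  funext k
  simp [calW4, combFour, minorOf, sMat_apply hinit, sCof_apply hinit, hatW, dot_three]
  ring

theorem W1_eq (hinit : ∀ x : ℝ, 0 < x → q x 0 = q₀ x ∧ r x 0 = r₀ x) (hd : ZeroDirichlet q r) :
    W1 q r q₀ r₀ = outerW q r 0 := by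
  funext k
  simp [W1, combOne, minorOf, bMat_apply hd, sCof_apply hinit, outerW, dot_three]
  ring

theorem W4_eq (hinit : ∀ x : ℝ, 0 < x → q x 0 = q₀ x ∧ r x 0 = r₀ x) (hd : ZeroDirichlet q r) :
    W4 q r q₀ r₀ = outerW q r 1 := by
  funext k
  simp [W4, combFour, minorOf, bMat_apply hd, sCof_apply hinit, outerW, dot_three]
  ring

theorem W2_eq (hinit : ∀ x : ℝ, 0 < x → q x 0 = q₀ x ∧ r x 0 = r₀ x) (hd : ZeroDirichlet q r) :
    W2 q r q₀ r₀ = innerW q r 0 1 := by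
  funext k
  simp [W2, minorOf, bCof_apply hd, sCof_apply hinit, innerW]

theorem W3_eq (hinit : ∀ x : ℝ, 0 < x → q x 0 = q₀ x ∧ r x 0 = r₀ x) (hd : ZeroDirichlet q r) :
    W3 q r q₀ r₀ = innerW q r 1 0 := by
  funext k
  simp [W3, minorOf, bCof_apply hd, sCof_apply hinit, innerW]

theorem minorOf_one_zero (hinit : ∀ x : ℝ, 0 < x → q x 0 = q₀ x ∧ r x 0 = r₀ x) (k : ℂ) :
    minorOf (sCof q₀ r₀ k) 1 0 = midVec q r 0 1 k 0 := by
  simp [minorOf, sCof_apply hinit, midVec]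

theorem minorOf_one_one (hinit : ∀ x : ℝ, 0 < x → q x 0 = q₀ x ∧ r x 0 = r₀ x) (k : ℂ) :
    minorOf (sCof q₀ r₀ k) 1 1 = midVec q r 1 (-1) k 0 := by
  simp [minorOf, sCof_apply hinit, midVec]

theorem minorOf_two_zero (hinit : ∀ x : ℝ, 0 < x → q x 0 = q₀ x ∧ r x 0 = r₀ x) (k : ℂ) :
    minorOf (sCof q₀ r₀ k) 2 0 = 1 * sAdj q r k 0 2 := by
  simp [minorOf, sCof_apply hinit]

theorem minorOf_two_one (hinit : ∀ x : ℝ, 0 < x → q x 0 = q₀ x ∧ r x 0 = r₀ x) (k : ℂ) :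
    minorOf (sCof q₀ r₀ k) 2 1 = -1 * sAdj q r k 1 2 := by
  simp [minorOf, sCof_apply hinit, pow_succ]

theorem transpose_mul_apply (hinit : ∀ x : ℝ, 0 < x → q x 0 = q₀ x ∧ r x 0 = r₀ x) (k : ℂ)
    (i j : Fin 3) : ((sMat q₀ r₀ (-k)).transpose * sCof q₀ r₀ k) i j
      = sCol q r (-k) i ⬝ᵥ sAdj q r k j := by
  simp [Matrix.mul_apply, Fin.sum_univ_three, sMat_apply hinit, sCof_apply hinit, dot_three]

end Translation

theorem theorem4p1
    (q r : ℝ → ℝ → ℂ) (q₀ r₀ : ℝ → ℂ)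
    -- a solution on the quarter plane, with initial data and vanishing Dirichlet data
    (hsol : IsHalfLineSolution q r)
    (hinit : ∀ x : ℝ, 0 < x → q x 0 = q₀ x ∧ r x 0 = r₀ x)
    (hdir : ∀ t : ℝ, 0 < t → q 0 t = 0 ∧ r 0 t = 0)
    -- notation: s, ŝ, s^A, the minors of s, and s₃₃
    (s sh sA : ℂ → Mat3) (m : ℂ → Fin 3 → Fin 3 → ℂ) (s33 : ℂ → ℂ)
    (hs : s = fun k => sMat q₀ r₀ k)
    (hsh : sh = fun k => s (-k))
    (hsA : sA = fun k => sCof q₀ r₀ k)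
    (hm : m = fun k => minorOf (sA k))
    (hs33 : s33 = fun k => s k 2 2)
    -- none of the functions s₃₃, W₁, …, W₄ vanishes on the boundary of its sectors
    (hb0 : ∀ n : Fin 12, n = 1 ∨ n = 2 ∨ n = 3 ∨ n = 4 → ∀ k ∈ frontier (sector n), s33 k ≠ 0)
    (hb1 : ∀ k ∈ frontier (sector 1), W1 q r q₀ r₀ k ≠ 0)
    (hb2 : ∀ k ∈ frontier (sector 2), W2 q r q₀ r₀ k ≠ 0)
    (hb3 : ∀ k ∈ frontier (sector 3), W3 q r q₀ r₀ k ≠ 0)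
    (hb4 : ∀ k ∈ frontier (sector 4), W4 q r q₀ r₀ k ≠ 0) :
    -- the jump matrices
    (∀ x t : ℝ, 0 ≤ x → 0 ≤ t →
      (∀ k ∈ closure (sector 1) ∩ closure (sector 2),
        jump q r 1 2 x t k =
          !![1, 0, 0;
             0, 1, 0;
             -(exp (theta 2 0 x t k) * sh k 2 0 / (s33 k * calW1 q₀ r₀ k)), 0, 1]) ∧
      (∀ k ∈ closure (sector 2) ∩ closure (sector 3), calW1 q₀ r₀ k ≠ 0 → calW4 q₀ r₀ k ≠ 0 →
        jump q r 2 3 x t k =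
          !![1, exp (theta 0 1 x t k) * ((sh k).transpose * sA k) 1 0 / calW4 q₀ r₀ k, 0;
             -(exp (theta 1 0 x t k) * ((sh k).transpose * sA k) 0 1 / calW1 q₀ r₀ k),
               1 - ((sh k).transpose * sA k) 1 0 * ((sh k).transpose * sA k) 0 1
                 / (calW1 q₀ r₀ k * calW4 q₀ r₀ k), 0;
             0, 0, 1]) ∧
      (∀ k ∈ closure (sector 3) ∩ closure (sector 4),
        jump q r 3 4 x t k =
          !![1, 0, 0;
             0, 1, 0;
             0, exp (theta 2 1 x t k) * sh k 2 1 / (s33 k * calW4 q₀ r₀ k), 1]) ∧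
      (∀ k ∈ closure (sector 4) ∩ closure (sector 5),
        jump q r 4 5 x t k =
          !![1, 0, -(exp (theta 0 2 x t k) * s k 0 2 / s k 0 0);
             0, 1, 0;
             exp (theta 2 0 x t k) * s k 2 0 / s33 k, 0, m k 1 1 / (s k 0 0 * s33 k)]) ∧
      -- the denominators which the assumptions already force to be nonzero
      (∀ k ∈ closure (sector 1) ∩ closure (sector 2), calW1 q₀ r₀ k ≠ 0) ∧
      (∀ k ∈ closure (sector 3) ∩ closure (sector 4), calW4 q₀ r₀ k ≠ 0) ∧
      (∀ k ∈ closure (sector 4) ∩ closure (sector 5), s k 0 0 ≠ 0) ∧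
      -- the remaining jump matrices, by the symmetry
      (∀ n : Fin 12, ∀ k ∈ closure (sector n) ∩ closure (sector (n + 1)),
        jump q r n (n + 1) x t k
          = cycA * jump q r (n + 4) (n + 5) x t (om * k) * cycA⁻¹ ∧
        jump q r (n + 1) n x t k
          = cycA * jump q r (n + 5) (n + 4) x t (om * k) * cycA⁻¹)) ∧
    -- the residue conditions
    (∀ x t : ℝ, 0 ≤ x → 0 ≤ t → ∀ (κ : ℂ) (i : Fin 3),
      (∀ n : Fin 12, n = 1 ∨ n = 2 → κ ∈ sector n → IsSimpleZero s33 κ → s κ 0 2 ≠ 0 →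
        HasSimpleResidue (fun k => eigenCol q r n 1 k x t i) κ
          (m κ 1 0 / (s κ 0 2 * deriv s33 κ)
            * exp (theta 2 1 x t κ) * eigenCol q r n 2 κ x t i)) ∧
      (κ ∈ sector 1 → IsSimpleZero (W1 q r q₀ r₀) κ → s33 κ ≠ 0 → m κ 2 0 ≠ 0 →
        deriv (calW1 q₀ r₀) κ ≠ 0 ∧
        HasSimpleResidue (fun k => eigenCol q r 1 0 k x t i) κ
          (1 / deriv (calW1 q₀ r₀) κ *
            ((sh κ 0 0 * s κ 1 2 - sh κ 1 0 * s κ 0 2) / m κ 2 0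
                * exp (theta 1 0 x t κ) * eigenCol q r 1 1 κ x t i
              + sh κ 2 0 / s33 κ * exp (theta 2 0 x t κ) * eigenCol q r 1 2 κ x t i))) ∧
      (κ ∈ sector 2 → IsSimpleZero (W2 q r q₀ r₀) κ → s33 κ ≠ 0 → m κ 1 0 ≠ 0 →
        deriv (calW1 q₀ r₀) κ ≠ 0 →
        HasSimpleResidue (fun k => eigenCol q r 2 0 k x t i) κ
          ((sh κ 0 0 * s33 κ - sh κ 2 0 * s κ 0 2) / (deriv (calW1 q₀ r₀) κ * m κ 1 0)
            * exp (theta 1 0 x t κ) * eigenCol q r 2 1 κ x t i)) ∧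
      (∀ n : Fin 12, n = 3 ∨ n = 4 → κ ∈ sector n → IsSimpleZero s33 κ → s κ 0 2 ≠ 0 →
        HasSimpleResidue (fun k => eigenCol q r n 0 k x t i) κ
          (m κ 1 1 / (s κ 0 2 * deriv s33 κ)
            * exp (theta 2 0 x t κ) * eigenCol q r n 2 κ x t i)) ∧
      (κ ∈ sector 3 → IsSimpleZero (W3 q r q₀ r₀) κ → s33 κ ≠ 0 → m κ 1 1 ≠ 0 →
        deriv (calW4 q₀ r₀) κ ≠ 0 →
        HasSimpleResidue (fun k => eigenCol q r 3 1 k x t i) κ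
          ((sh κ 0 1 * s33 κ - sh κ 2 1 * s κ 0 2) / (deriv (calW4 q₀ r₀) κ * m κ 1 1)
            * exp (theta 0 1 x t κ) * eigenCol q r 3 0 κ x t i)) ∧
      (κ ∈ sector 4 → IsSimpleZero (W4 q r q₀ r₀) κ → s33 κ ≠ 0 → m κ 2 1 ≠ 0 →
        deriv (calW4 q₀ r₀) κ ≠ 0 ∧
        HasSimpleResidue (fun k => eigenCol q r 4 1 k x t i) κ
          (1 / deriv (calW4 q₀ r₀) κ *
            ((sh κ 0 1 * s κ 1 2 - sh κ 1 1 * s κ 0 2) / m κ 2 1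
                * exp (theta 0 1 x t κ) * eigenCol q r 4 0 κ x t i
              + sh κ 2 1 / s33 κ * exp (theta 2 1 x t κ) * eigenCol q r 4 2 κ x t i)))) := by
  subst hs hsh hsA hm hs33
  have hd := hsol.zeroDirichlet hdir
  simp only [W1_eq hinit hd, W2_eq hinit hd, W3_eq hinit hd, W4_eq hinit hd, sMat_apply hinit]
    at hb0 hb1 hb2 hb3 hb4
  simp only [W1_eq hinit hd, W2_eq hinit hd, W3_eq hinit hd, W4_eq hinit hd, calW1_eq hinit,
    calW4_eq hinit, transpose_mul_apply hinit, sMat_apply hinit, minorOf_one_zero hinit,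
    minorOf_one_one hinit, minorOf_two_zero hinit, minorOf_two_one hinit]
  -- The symmetry compares chosen eigenfunctions, so corner uniqueness is needed on every ray; the
  -- nonvanishing assumptions give it on the boundaries of `D₁, …, D₄`.
  have huniq := cornerUnique_of_frontier (q := q) (r := r) fun n hn k hk => by
    have hcl : k ∈ closure (sector n) := hk.1
    have hs := hb0 n hn k hk
    rcases hn with rfl | rfl | rfl | rfl
    · exact upperSector_one.cornerUnique hsol hd hcl hs
        (upperSector_one.isSpecCol_outer' hsol hd (by decide) hcl (hb1 k hk)).cornerUnique
    · obtain ⟨v, hv⟩ := upperSector_two.isSpecCol_inner' hsol hd (by decide) hcl (hb2 k hk)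
      exact upperSector_two.cornerUnique hsol hd hcl hs hv.cornerUnique
    · obtain ⟨v, hv⟩ := upperSector_three.isSpecCol_inner' hsol hd (by decide) hcl (hb3 k hk)
      exact upperSector_three.cornerUnique hsol hd hcl hs hv.cornerUnique
    · exact upperSector_four.cornerUnique hsol hd hcl hs
        (upperSector_four.isSpecCol_outer' hsol hd (by decide) hcl (hb4 k hk)).cornerUnique
  have hf : ∀ n : Fin 12, ∀ k ∈ closure (sector n) ∩ closure (sector (n + 1)),
      k ∈ frontier (sector n) ∧ k ∈ frontier (sector (n + 1)) := fun n k hk => mem_frontier_left hk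
  have hW1 : ∀ k ∈ closure (sector 1) ∩ closure (sector 2), hatW q r 0 k ≠ 0 := fun k hk =>
    upperSector_one.hatW_ne_zero hsol hd (by decide) hk.1 (hb1 k (hf 1 k hk).1)
  have hW4 : ∀ k ∈ closure (sector 3) ∩ closure (sector 4), hatW q r 1 k ≠ 0 := fun k hk =>
    upperSector_four.hatW_ne_zero hsol hd (by decide) hk.2 (hb4 k (hf 3 k hk).2)
  -- By the rotation symmetry `s₁₁(k) = s₃₃(ω²k)`, and `ω²k` lies on the boundary of `D₁`.
  have hs11 : ∀ k ∈ closure (sector 4) ∩ closure (sector 5), sCol q r k 0 0 ≠ 0 := fun k hk => by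
    have h1 : om ^ 2 * k ∈ frontier (sector 1) := sq_mul_mem_frontier (n := 1) (hf 4 k hk).2
    have h2 := sCol_rot hsol (k := om ^ 2 * k) (j := 2) fun i =>
      (weakSector_of_mem_closure h1.1).l_le (upperSector_one.min i)
    rw [om_mul_sq_mul] at h2
    change sCol q r k 0 = _ at h2
    rw [h2]
    exact hb0 1 (Or.inl rfl) _ h1
  refine ⟨fun x t hx ht => ⟨fun k hk => ?_, fun k hk h1 h4 => ?_, fun k hk => ?_, fun k hk => ?_,
    hW1, hW4, hs11, fun n k hk => ⟨?_, ?_⟩⟩, fun x t hx ht κ i => ⟨fun n hn hκ hz h0 => ?_,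
    fun hκ hz hs hm => ?_, fun hκ hz hs hm hder => ?_, fun n hn hκ hz h0 => ?_,
    fun hκ hz hs hm hder => ?_, fun hκ hz hs hm => ?_⟩⟩
  · exact jump_one_two hsol hd hk.1 hk.2 (hb0 1 (by simp) k (hf 1 k hk).1) (hW1 k hk)
      (hb2 k (hf 1 k hk).2) x t
  · exact jump_two_three hsol hd hk.1 hk.2 (hb0 2 (by simp) k (hf 2 k hk).1) h1
      (hb2 k (hf 2 k hk).1) h4 (hb3 k (hf 2 k hk).2) x t
  · exact jump_three_four hsol hd hk.1 hk.2 (hb0 3 (by simp) k (hf 3 k hk).1) (hW4 k hk)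
      (hb3 k (hf 3 k hk).1) x t
  · have := jump_four_five hsol hd hk.1 hk.2 (hb0 4 (by simp) k (hf 4 k hk).1) (hs11 k hk)
      (hb4 k (hf 4 k hk).1) x t
    simpa [midVec] using this
  · have := jump_rot (huniq n k (hf n k hk).1) (huniq (n + 1) k (hf n k hk).2) x t
    rwa [show n + 1 + 4 = n + 5 by clear * -; revert n; decide] at this
  · have := jump_rot (huniq (n + 1) k (hf n k hk).2) (huniq n k (hf n k hk).1) x t
    rwa [show n + 1 + 4 = n + 5 by clear * -; revert n; decide] at this
  · rcases hn with rfl | rfl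
    · exact upperSector_one.residue_mid hsol hd hκ hz h0 hx ht i
    · exact upperSector_two.residue_mid hsol hd hκ hz h0 hx ht i
  · obtain ⟨h1, h2⟩ := upperSector_one.residue_outer hsol hd (by decide) hκ hz hs hm
    exact ⟨h1, h2 x t hx ht i⟩
  · exact upperSector_two.residue_inner hsol hd (by decide) hκ hz hs hm hder hx ht i
  · rcases hn with rfl | rfl
    · exact upperSector_three.residue_mid hsol hd hκ hz h0 hx ht i
    · exact upperSector_four.residue_mid hsol hd hκ hz h0 hx ht i
  · exact upperSector_three.residue_inner hsol hd (by decide) hκ hz hs hm hder hx ht i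
  · obtain ⟨h1, h2⟩ := upperSector_four.residue_outer hsol hd (by decide) hκ hz hs hm
    exact ⟨h1, h2 x t hx ht i⟩
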